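/- **Setting.** Write $\mathbf e=e^{-1/\varepsilon}$ for $\varepsilon>0$. Let $K$ be the field of convergent Puiseux series in $\mathbf e$, with valuation $\mathrm{val}$; the leading coefficient of a series is the coefficient of its lowest power of $\mathbf e$. Let $$f_\varepsilon(x,y)=\sum_{i=0}^N a_i(x)y^{N-i},\qquad a_i(x)=c_i\mathbf e^{A_i}x^{m_i}\prod_{j=1}^{d_i}(x-u_{i,j}\mathbf e^{B_{i,j}}),$$ with $A_i,B_{i,j}\in\mathbb Q$, $m_i\ge 0$, all $u_{i,j}\in K$ of valuation $0$, and each $c_i\in K$ either $0$ or of valuation $0$, $c_0,c_N\ne0$. Write $f_\varepsilon=\sum_w a_w x^{w_1}y^{w_2}$, $\mathrm{Val}(P)=\min_w(\mathrm{val}(a_w)+w_1X+w_2Y)$ for $P=(X,Y)\in\mathbb R^2$, let $\Theta(P)$ be the set of $w$ attaining this minimum, and let $f^P=\sum_{w\in\Theta(P)}(\text{leading coefficient of }a_w)\,x^{w_1}y^{w_2}$. The tropical curve is the set of points where $\mathrm{Val}$ is not smooth; its open cells are the sets on which $\Theta$ is constant, and an *edge* is the closure of a bounded one-dimensional cell.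 For $1\le i\le N$ put $\mathcal N_i(X)=\min_{j\ge i}\{Y: \exists w\in\Theta(X,Y),\ w_2=N-j\}$ and $G_i=\{Y=\mathcal N_i(X)\}$. The *vertical thickness* of an edge $L$ is $\#\{i: L\subset G_i\}$. The *cylinders* over an edge $L$ correspond to the irreducible factors $g$ (up to units) of the polynomial $f^P$, $P$ in the interior of $L$. **Assumptions.** (i) For small $\varepsilon$ the curve $f_\varepsilon=0$ in $(\mathbb C^*)^2$ is non-singular, and $f^P=0$ is non-singular in $(\mathbb C^*)^2$ for every point $P$ of the tropical curve. (ii) The leading terms of the roots $u_{i,j}\mathbf e^{B_{i,j}}$ (over all $i$ with $c_i\ne 0$ and all $j$) are pairwise distinct. (iii) $\#\Theta(P)=2$ for every inner point $P$ of every non-vertical edge. Let $1\le I\le N-1$, fix a root $u\,\mathbf e^{B}$, $u=u_{I,j_0}$, $B=B_{I,j_0}$, and suppose $Y_0:=\mathcal N_I(B)<Y_1:=\mathcal N_{I+1}(B)$. Put $$\omega_E=\frac{\phi(x)\,y^{N-I-1}\,dx}{\partial_yf_\varepsilon},\qquad \frac{\phi(x)}{a_I(x)}=\frac{-1}{2\pi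 i\,(x-u\,\mathbf e^{B})},$$ where $dx/\partial_yf_\varepsilon=-dy/\partial_xf_\varepsilon$ on the curve. **Paths.** For points $P_0,P_1$ of an edge $L$, a path $\rho$ *runs along* the cylinder $g$ over $L$ from $P_0$ to $P_1$ if it is a family of $C^1$ paths $\rho_\varepsilon(t)=(e^{\xi_\varepsilon(t)},e^{\eta_\varepsilon(t)})$, $t\in[0,1]$, on $f_\varepsilon=0$ such that, with $P(t)=(1-t)P_0+tP_1$, the vector $(\xi_\varepsilon(t),\eta_\varepsilon(t))+P(t)/\varepsilon$ is bounded and $(\xi_\varepsilon'(t),\eta_\varepsilon'(t))=O(1/\varepsilon)$, both uniformly in $t$ and in small $\varepsilon$, and such that for each $0<t<1$ the value of $g$ at the point of $(\mathbb C^*)^2$ whose logarithms are $(\xi_\varepsilon(t),\eta_\varepsilon(t))+P(t)/\varepsilon$ tends to $0$ as $\varepsilon\to0^+$. It is *straight* if $(\xi_\varepsilon(1)-\xi_\varepsilon(0),\ \eta_\varepsilon(1)-\eta_\varepsilon(0))=-(P_1-P_0)/\varepsilon+o(1)$. **Claim.** The segment from $(B,Y_0)$ to $(B,Y_1)$ is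 an edge $E'$, and $x-\bar u$, with $\bar u$ the leading coefficient of $u$, is one of its cylinders, denoted $E$. For a path $\rho$ running along a cylinder over an edge $L$ from $P_0=(x_0,y_0)$ to $P_1=(x_1,y_1)$, as $\varepsilon\to0^+$, $$\int_\rho\omega_E=\mathfrak M(P_0,P_1)+\begin{cases}o(1)&\text{if }P_0,P_1\text{ are inner points of }L\text{ and }\rho\text{ is straight,}\\O(1)&\text{if }P_0,P_1\text{ are the two end points of }L,\end{cases}$$ where the main term $\mathfrak M$ is: 1. $-(2\pi i\varepsilon)^{-1}(y_1-y_0)$ for the cylinder $E$ over $L=E'$ (so $-(2\pi i\varepsilon)^{-1}(Y_1-Y_0)$ for the whole edge traversed upwards); 2. $0$ for every other cylinder over a vertical edge; 3. $-(2q\pi i\varepsilon)^{-1}(\min[B,x_1]-\min[B,x_0])$ for the cylinders over a non-vertical edge $L\subset G_I$, $L\not\subset G_{I+1}$, of vertical thickness $q$; 4. $+(2q\pi i\varepsilon)^{-1}(\min[B,x_1]-\min[B,x_0])$ for the cylinders over a non-vertical edge $L\subset G_{I+1}$, $L\not\subset G_I$, of vertical thickness $q$; 5. $0$ for the cylinders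 over a non-vertical edge contained in some $G_J$ but in neither $G_I$ nor $G_{I+1}$; 6. $0$ for the cylinders over an edge contained in $G_I\cap G_{I+1}$. -/

import Mathlib

open Filter Topology Set

noncomputable section

namespace TropInt

/-- The ambient ring of formal series in `𝐞 = e^{-1/ε}` with rational exponents. -/
abbrev Series : Type := HahnSeries ℚ ℂ

/-- The real number `𝐞 ^ q = e^{-q/ε}`. -/
def ePow (ε q : ℝ) : ℝ := Real.exp (-q / ε)

/-- Convergent Puiseux series in `𝐞`: the exponents have a common denominator and the series
converges for all sufficiently small `ε > 0`. -/
def IsConvPuiseux (p : Series) : Prop :=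
  (∃ n : ℕ, 0 < n ∧ ∀ q ∈ p.support, ∃ k : ℤ, q = (k : ℚ) / n) ∧
  ∃ δ : ℝ, 0 < δ ∧ ∀ ε : ℝ, 0 < ε → ε < δ → Summable fun q : ℚ => p.coeff q * (ePow ε q : ℂ)

/-- The value at `ε` of a convergent Puiseux series. -/
def seriesVal (ε : ℝ) (p : Series) : ℂ := ∑' q : ℚ, p.coeff q * (ePow ε q : ℂ)

/-- Convergent Puiseux series of valuation `0`. -/
def IsUnitSeries (p : Series) : Prop := IsConvPuiseux p ∧ p.orderTop = 0

/-- The polynomial `c x^m ∏_j (x - z_j)`. -/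
def factored {R : Type*} [CommRing R] (c : R) (m : ℕ) {d : ℕ} (z : Fin d → R) : Polynomial R :=
  Polynomial.C c * Polynomial.X ^ m * ∏ j, (Polynomial.X - Polynomial.C (z j))

/-- A polynomial `f_ε(x,y) = ∑_{i=0}^N a_i(x) y^{N-i}` over the field of convergent Puiseux series,
with `a_i(x) = c_i 𝐞^{A_i} x^{m_i} ∏_j (x - u_{i,j} 𝐞^{B_{i,j}})`; intermediate coefficients
`a_i` may vanish. -/
structure CurveData where
  N : ℕ
  c : ℕ → Series
  A : ℕ → ℚ
  m : ℕ → ℕ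
  d : ℕ → ℕ
  u : (i : ℕ) → Fin (d i) → Series
  B : (i : ℕ) → Fin (d i) → ℚ
  c_unit : ∀ i ≤ N, c i = 0 ∨ IsUnitSeries (c i)
  c_first : c 0 ≠ 0
  c_last : c N ≠ 0
  u_unit : ∀ i ≤ N, ∀ j, IsUnitSeries (u i j)

namespace CurveData

variable (D : CurveData)

/-! ### The polynomial over the series ring, and its values -/

/-- The coefficient `a_i(x)`. -/
def a (i : ℕ) : Polynomial Series :=
  factored (D.c i * HahnSeries.single (D.A i) 1) (D.m i)
    fun j => D.u i j * HahnSeries.single (D.B i j) 1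

/-- The polynomial `f`; the outer variable is `y`, the inner one is `x`. -/
def f : Polynomial (Polynomial Series) :=
  ∑ i ∈ Finset.range (D.N + 1), Polynomial.C (D.a i) * Polynomial.X ^ (D.N - i)

/-- The coefficient of `x^{w.1} y^{w.2}` in `f`. -/
def coeff (w : ℕ × ℕ) : Series := (D.f.coeff w.2).coeff w.1

/-- The point `u_{i,j} 𝐞^{B_{i,j}}` at the parameter `ε`. -/
def rootAt (ε : ℝ) (i : ℕ) (j : Fin (D.d i)) : ℂ :=
  seriesVal ε (D.u i j) * (ePow ε (D.B i j) : ℂ)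

/-- The polynomial `a_i(x)` at the parameter `ε`. -/
def aAt (ε : ℝ) (i : ℕ) : Polynomial ℂ :=
  factored (seriesVal ε (D.c i) * (ePow ε (D.A i) : ℂ)) (D.m i) (D.rootAt ε i)

/-- The function `(x,y) ↦ f_ε(x,y)`. -/
def fAt (ε : ℝ) (x y : ℂ) : ℂ :=
  ∑ i ∈ Finset.range (D.N + 1), (D.aAt ε i).eval x * y ^ (D.N - i)

/-! ### Tropical geometry -/

/-- The tropical monomial `val(a_w) + w₁ X + w₂ Y` (used for `a_w ≠ 0`). -/
def term (w : ℕ × ℕ) (P : ℝ × ℝ) : ℝ := ((D.coeff w).order : ℝ) + w.1 * P.1 + w.2 * P.2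

/-- The tropical polynomial `Val(P; f)`, a minimum over finitely many monomials. -/
def tropVal (P : ℝ × ℝ) : ℝ := sInf ((fun w => D.term w P) '' {w | D.coeff w ≠ 0})

/-- The set `Θ(P)` of exponents at which the minimum `Val(P; f)` is attained. -/
def Theta (P : ℝ × ℝ) : Set (ℕ × ℕ) := {w | D.coeff w ≠ 0 ∧ D.term w P = D.tropVal P}

/-- The tropical curve: the points at which `Val(·; f)` is not smooth. -/
def tropCurve : Set (ℝ × ℝ) := {P | ¬ ContDiffAt ℝ (⊤ : ℕ∞) D.tropVal P}

open Classical in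
/-- The truncation `f^P = ∑_{w ∈ Θ(P)} (leading coefficient of a_w) x^{w.1} y^{w.2}`. -/
def trunc (P : ℝ × ℝ) : Polynomial (Polynomial ℂ) :=
  ∑ k ∈ D.f.support, ∑ l ∈ (D.f.coeff k).support,
    if (l, k) ∈ D.Theta P then
      Polynomial.monomial k (Polynomial.monomial l (D.coeff (l, k)).leadingCoeff)
    else 0

/-- The segment from `Q₀` to `Q₁` is an edge (a bounded one-dimensional cell) of the tropical
curve. The open cells are the sets on which `Θ` is constant. -/
def IsEdge (Q₀ Q₁ : ℝ × ℝ) : Prop :=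
  Q₀ ≠ Q₁ ∧ ∃ P ∈ D.tropCurve, {Q | D.Theta Q = D.Theta P} = openSegment ℝ Q₀ Q₁

/-- The domain `𝔇_i`, where `Val(X,Y; f) = Val(X; a_i) + (N-i) Y`. -/
def domain (i : ℕ) : Set (ℝ × ℝ) := {P | i ≤ D.N ∧ ∃ w ∈ D.Theta P, w.2 = D.N - i}

/-- The piecewise linear function `𝒩_i(X) = min_{j ≥ i} {Y | (X,Y) ∈ 𝔇_j}`, for `1 ≤ i ≤ N`. -/
def NN (i : ℕ) (X : ℝ) : ℝ := sInf {Y | ∃ j ≥ i, (X, Y) ∈ D.domain j}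

/-- The graph `G_i` of `𝒩_i`. -/
def G (i : ℕ) : Set (ℝ × ℝ) := {P | P.2 = D.NN i P.1}

/-- The vertical thickness `#{i | L ⊂ G_i}` of the edge `L` from `Q₀` to `Q₁`. -/
def vThickness (Q₀ Q₁ : ℝ × ℝ) : ℕ :=
  {i : ℕ | 1 ≤ i ∧ i ≤ D.N ∧ segment ℝ Q₀ Q₁ ⊆ D.G i}.ncard

/-! ### Assumptions on the curve -/

/-- The curve `F = 0` in the algebraic torus has no singular point. -/
def _root_.TropInt.SmoothInTorus (F : ℂ → ℂ → ℂ) : Prop :=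
  ∀ x y : ℂ, x ≠ 0 → y ≠ 0 → F x y = 0 →
    deriv (fun s => F s y) x ≠ 0 ∨ deriv (fun s => F x s) y ≠ 0

/-- `f_ε` is non-singular. -/
def NonSingular : Prop := ∃ δ > 0, ∀ ε : ℝ, 0 < ε → ε ≤ δ → SmoothInTorus (D.fAt ε)

/-- `f_ε` is totally non-singular. -/
def TotallyNonSingular : Prop :=
  ∀ P ∈ D.tropCurve, SmoothInTorus fun x y => (D.trunc P).evalEval x y

/-- Genericness: no two of the non-zero roots of the coefficients `a_i` (with multiplicity, and for
all `i` together) have the same leading term. -/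
def Generic : Prop :=
  ∀ p q : (i : ℕ) × Fin (D.d i), p.1 ≤ D.N → q.1 ≤ D.N → D.c p.1 ≠ 0 → D.c q.1 ≠ 0 → p ≠ q →
    D.B p.1 p.2 = D.B q.1 q.2 → (D.u p.1 p.2).leadingCoeff ≠ (D.u q.1 q.2).leadingCoeff

/-- Regularity: exactly two monomials are minimal at an inner point of a non-vertical edge. -/
def Regular : Prop :=
  ∀ Q₀ Q₁ : ℝ × ℝ, D.IsEdge Q₀ Q₁ → Q₀.1 ≠ Q₁.1 →
    ∀ P ∈ openSegment ℝ Q₀ Q₁, (D.Theta P).ncard = 2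

/-! ### The differential of an edge and its integral -/

/-- The polynomial `φ`, determined by `φ(x) / a_I(x) = -1 / (2πi (x - u_{I,j₀} 𝐞^{B_{I,j₀}}))`. -/
def phi (ε : ℝ) (I : ℕ) (j₀ : Fin (D.d I)) (x : ℂ) : ℂ :=
  -(2 * Real.pi * Complex.I)⁻¹ * (seriesVal ε (D.c I) * (ePow ε (D.A I) : ℂ)) * x ^ D.m I *
    ∏ j ∈ Finset.univ.erase j₀, (x - D.rootAt ε I j)

open Classical in
/-- The value of `ω_E = φ(x) y^{N-I-1} dx / f_y` at the point `(x,y)` of the curve `f_ε = 0` on the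
tangent vector `(v,w)`; where `f_y = 0` one has `dx / f_y = - dy / f_x`. -/
def omega (ε : ℝ) (I : ℕ) (j₀ : Fin (D.d I)) (x y v w : ℂ) : ℂ :=
  D.phi ε I j₀ x * y ^ (D.N - I - 1) *
    if deriv (fun s => D.fAt ε x s) y ≠ 0 then v / deriv (fun s => D.fAt ε x s) y
    else -(w / deriv (fun s => D.fAt ε s y) x)

/-- The integral of `ω_E` along the path `t ↦ (e^{ξ(t)}, e^{η(t)})`, `0 ≤ t ≤ 1`. -/
def pathIntegral (ε : ℝ) (I : ℕ) (j₀ : Fin (D.d I)) (ξ η : ℝ → ℂ) : ℂ :=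
  ∫ t in (0 : ℝ)..1, D.omega ε I j₀ (Complex.exp (ξ t)) (Complex.exp (η t))
    (deriv (fun s => Complex.exp (ξ s)) t) (deriv (fun s => Complex.exp (η s)) t)

/-! ### Cylinders and paths along them -/

/-- `g` is an irreducible factor of the truncation of `f` on the interior of the edge from `Q₀` to
`Q₁`. The cylinders associated with the edge correspond to these factors (up to units). -/
def IsComponent (Q₀ Q₁ : ℝ × ℝ) (g : Polynomial (Polynomial ℂ)) : Prop :=
  Irreducible g ∧ ∀ P ∈ openSegment ℝ Q₀ Q₁, g ∣ D.trunc P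

/-- The family of `C¹` paths `t ↦ (x,y) = (e^{ξ_ε(t)}, e^{η_ε(t)})` on the curves `f_ε = 0`, written
with continuous branches of the logarithms, runs from `P₀` to `P₁` along the cylinder of `g`:
the logarithms stay within bounded distance of the uniform motion from `-P₀/ε` to `-P₁/ε`, with
speed `O(1/ε)`, and for `0 < t < 1` the rescaled point `(x 𝐞^{-X(t)}, y 𝐞^{-Y(t)})` approaches
`g = 0`. -/
def RunsAlong (g : Polynomial (Polynomial ℂ)) (P₀ P₁ : ℝ × ℝ) (ξ η : ℝ → ℝ → ℂ) : Prop :=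
  (∃ M : ℝ, ∀ᶠ ε : ℝ in 𝓝[>] 0, ContDiff ℝ 1 (ξ ε) ∧ ContDiff ℝ 1 (η ε) ∧
    ∀ t ∈ Icc (0 : ℝ) 1,
      D.fAt ε (Complex.exp (ξ ε t)) (Complex.exp (η ε t)) = 0 ∧
      ‖ξ ε t + ((((1 - t) * P₀.1 + t * P₁.1) / ε : ℝ) : ℂ)‖ ≤ M ∧
      ‖η ε t + ((((1 - t) * P₀.2 + t * P₁.2) / ε : ℝ) : ℂ)‖ ≤ M ∧
      ‖deriv (ξ ε) t‖ ≤ M / ε ∧ ‖deriv (η ε) t‖ ≤ M / ε) ∧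
  ∀ t ∈ Ioo (0 : ℝ) 1,
    Tendsto (fun ε : ℝ => g.evalEval
      (Complex.exp (ξ ε t + ((((1 - t) * P₀.1 + t * P₁.1) / ε : ℝ) : ℂ)))
      (Complex.exp (η ε t + ((((1 - t) * P₀.2 + t * P₁.2) / ε : ℝ) : ℂ)))) (𝓝[>] 0) (𝓝 0)

/-- The net displacement of the logarithms along the path is `-(P₁ - P₀)/ε + o(1)`: asymptotically
the path neither turns around the cylinder nor over- or undershoots. -/
def IsStraight (P₀ P₁ : ℝ × ℝ) (ξ η : ℝ → ℝ → ℂ) : Prop :=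
  Tendsto (fun ε : ℝ => ξ ε 1 - ξ ε 0 + (((P₁.1 - P₀.1) / ε : ℝ) : ℂ)) (𝓝[>] 0) (𝓝 0) ∧
  Tendsto (fun ε : ℝ => η ε 1 - η ε 0 + (((P₁.2 - P₀.2) / ε : ℝ) : ℂ)) (𝓝[>] 0) (𝓝 0)

/-- The integrals of `ω_E` along the cylinder of `g` over the edge from `Q₀` to `Q₁` have the main
term `main`: with error `o(1)` along straight paths between two inner points of the edge, and
with error `O(1)` along paths that run from one end of the edge to the other. -/
def IntegralAsymp (I : ℕ) (j₀ : Fin (D.d I)) (Q₀ Q₁ : ℝ × ℝ) (g : Polynomial (Polynomial ℂ))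
    (main : ℝ × ℝ → ℝ × ℝ → ℝ → ℂ) : Prop :=
  (∀ P₀ ∈ openSegment ℝ Q₀ Q₁, ∀ P₁ ∈ openSegment ℝ Q₀ Q₁, ∀ ξ η : ℝ → ℝ → ℂ,
    D.RunsAlong g P₀ P₁ ξ η → IsStraight P₀ P₁ ξ η →
      (fun ε => D.pathIntegral ε I j₀ (ξ ε) (η ε) - main P₀ P₁ ε)
        =o[𝓝[>] (0 : ℝ)] (fun _ => (1 : ℝ))) ∧
  (∀ ξ η : ℝ → ℝ → ℂ, D.RunsAlong g Q₀ Q₁ ξ η →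
      (fun ε => D.pathIntegral ε I j₀ (ξ ε) (η ε) - main Q₀ Q₁ ε)
        =O[𝓝[>] (0 : ℝ)] (fun _ => (1 : ℝ)))

/-- The irreducible polynomial `x - (leading coefficient of u_{I,j₀})`, which singles out the
component `E` of its vertical edge. -/
def compE (I : ℕ) (j₀ : Fin (D.d I)) : Polynomial (Polynomial ℂ) :=
  Polynomial.C (Polynomial.X - Polynomial.C (D.u I j₀).leadingCoeff)

end CurveData

end TropInt

end

noncomputable section

namespace TropInt

/-! ### Evaluation of series -/

/-! Put x = e^ξ, y = e^η and let n = φ(x) x y^{N-I} be the numerator of ω_E in logarithmic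
coordinates (`num`). A tangent vector of the curve has the form (ξ', η') = l (y f_y, -x f_x), and
ω_E takes the value n l on it. Hence, if n = α x f_x + β y f_y + error with constants α, β, then ω_E
= -α dη + β dξ + error, and the exact part only sees the net displacement of the logarithms, -(P₁ -
P₀)/ε. The main term is therefore α (y₁ - y₀)/ε - β (x₁ - x₀)/ε.

The error is controlled as follows. By compactness, total non-singularity bounds max(|x f_x|, |y
f_y|) below by a constant times 𝐞^{Val(P)}, uniformly along the closed edge
(`EdgeSupp.eventually_le_grad`). The error in n is at most a constant times 𝐞^{Val(P)} 𝐞^{c d},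
where d is the relative distance from the ends, because a non-minimal monomial loses at least a
multiple of d (`EdgeSupp.exists_gap`). With speed O(1/ε) there remains the integral of 𝐞^{c d}/ε,
which is bounded over a whole edge and tends to 0 between inner points
(`integralAsymp_of_numApprox`).

It remains to find α and β. Let r = u 𝐞^B and κ = -1/(2πi). Then n (x - r) = κ x · a_I(x) y^{N-I}.
(a) If a_I y^{N-I} contributes no minimal monomial, then n itself is small and α = β = 0. (b) On a
vertical edge with minimal power y^{N-I}, the equation f = 0 makes a_I y^{N-I} small, so n is small
wherever |x| = O(|x - r|). Near r, write a_I = (x - r)ψ. Then x f_x ≈ x ψ y^{N-I}, and φ = κψ gives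
α = κ, β = 0 (`numApprox_of_near`). (c) On a non-vertical edge with minimal exponents w, v and w₂ =
N - I, the relation f = 0 gives a_I y^{N-I} ≈ y f_y/(w₂ - v₂), while x/(x - r) tends to 1 for X < B
and to 0 for X > B. Thus α = 0, and β is κ/(w₂ - v₂) or 0, whence the function min[B, X]. Such an
edge cannot cross X = B, where two monomials of a_I are minimal.

A path is tied to its cylinder at t = 1/2 and cannot change cylinders afterwards: crossing a small
circle around the root ū of the truncation would contradict f = 0 (`exists_circle`). -/

lemma ePow_pos (ε q : ℝ) : 0 < ePow ε q := Real.exp_pos _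

lemma ePow_add (ε p q : ℝ) : ePow ε (p + q) = ePow ε p * ePow ε q := by
  rw [ePow, ePow, ePow, ← Real.exp_add]; congr 1; ring

lemma ePow_zero (ε : ℝ) : ePow ε 0 = 1 := by simp [ePow]

lemma ePow_sub (ε p q : ℝ) : ePow ε (p - q) = ePow ε p / ePow ε q := by
  rw [ePow, ePow, ePow, ← Real.exp_sub]; congr 1; ring

/-- The series `p` converges at the parameter `ε`. -/
def ConvAt (ε : ℝ) (p : Series) : Prop := Summable fun q : ℚ => p.coeff q * (ePow ε q : ℂ)

lemma ConvAt.hasSum {ε : ℝ} {p : Series} (hp : ConvAt ε p) :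
    HasSum (fun q : ℚ => p.coeff q * (ePow ε q : ℂ)) (seriesVal ε p) := Summable.hasSum hp

lemma hasSum_coeff_single (ε : ℝ) (a : ℚ) (r : ℂ) :
    HasSum (fun q : ℚ => (HahnSeries.single a r : Series).coeff q * (ePow ε q : ℂ))
      (r * (ePow ε a : ℂ)) := by
  convert hasSum_single (f := fun q : ℚ => (HahnSeries.single a r : Series).coeff q *
    (ePow ε q : ℂ)) a ?_ using 1
  · simp
  · intro b hb
    simp [HahnSeries.coeff_single_of_ne hb]

/-- Absolute convergence allows the double series to be summed along the fibres of (q, q') ↦ q + q'.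
In each fibre only the finite antidiagonal of the two supports contributes. -/
lemma hasSum_mul {ε : ℝ} {p p' : Series} (hp : ConvAt ε p) (hp' : ConvAt ε p') :
    HasSum (fun q : ℚ => (p * p').coeff q * (ePow ε q : ℂ)) (seriesVal ε p * seriesVal ε p') := by
  let α : ℚ → ℂ := fun q => p.coeff q * (ePow ε q : ℂ)
  let α' : ℚ → ℂ := fun q => p'.coeff q * (ePow ε q : ℂ)
  have hα : Summable α := hp
  have hα' : Summable α' := hp'
  let F : ℚ × ℚ → ℂ := fun x => α x.1 * α' x.2
  have hF : ∀ x, F x = (p.coeff x.1 * (ePow ε x.1 : ℂ)) * (p'.coeff x.2 * (ePow ε x.2 : ℂ)) :=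
    fun _ => rfl
  have h1 : HasSum F (seriesVal ε p * seriesVal ε p') :=
    HasSum.mul hα.hasSum hα'.hasSum (summable_mul_of_summable_norm hα.norm hα'.norm)
  have h2 := (Equiv.sigmaFiberEquiv (fun x : ℚ × ℚ => x.1 + x.2)).hasSum_iff.mpr h1
  refine h2.sigma fun q => ?_
  have h3 : HasSum (F ∘ ((↑) : {x : ℚ × ℚ | x.1 + x.2 = q} → ℚ × ℚ))
      ((p * p').coeff q * (ePow ε q : ℂ)) := by
    rw [hasSum_subtype_iff_indicator]
    have : (p * p').coeff q * (ePow ε q : ℂ) = ∑ x ∈ Finset.antidiagonal p.isPWO_support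
        p'.isPWO_support q, ({x : ℚ × ℚ | x.1 + x.2 = q}.indicator F) x := by
      rw [HahnSeries.coeff_mul, Finset.sum_mul]
      refine Finset.sum_congr rfl fun x hx => ?_
      have hx' := (Finset.mem_antidiagonal.mp hx).2.2
      rw [Set.indicator_of_mem (by exact hx'), hF, ← hx']
      push_cast [ePow_add]
      ring
    rw [this]
    refine hasSum_sum_of_ne_finset_zero fun x hx => ?_
    by_cases hq : x.1 + x.2 = q
    · rw [Set.indicator_of_mem (by exact hq)]
      by_contra hne
      refine hx (Finset.mem_antidiagonal.mpr ⟨?_, ?_, hq⟩)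
      · intro h; exact hne (by simp [hF, h])
      · intro h; exact hne (by simp [hF, h])
    · exact Set.indicator_of_notMem (s := {x : ℚ × ℚ | x.1 + x.2 = q}) hq F
  exact h3

/-- The subring of the series that converge at `ε`. -/
def convSubring (ε : ℝ) : Subring Series where
  carrier := {p | ConvAt ε p}
  mul_mem' hp hq := (hasSum_mul hp hq).summable
  one_mem' := (hasSum_coeff_single ε 0 1).summable
  add_mem' hp hq := by
    refine (hp.hasSum.add hq.hasSum).summable.congr fun q => ?_
    simp [add_mul]
  zero_mem' := by simp [ConvAt]
  neg_mem' hp := by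
    refine hp.hasSum.neg.summable.congr fun q => ?_
    simp

/-- Evaluation at `ε` of the series that converge there. -/
def evalHom (ε : ℝ) : convSubring ε →+* ℂ where
  toFun p := seriesVal ε p
  map_one' := (hasSum_coeff_single ε 0 1).tsum_eq.trans (by simp [ePow_zero])
  map_mul' p q := (hasSum_mul p.2 q.2).tsum_eq
  map_zero' := by simp [seriesVal]
  map_add' p q := by
    rw [← (ConvAt.hasSum p.2 |>.add (ConvAt.hasSum q.2)).tsum_eq]
    refine tsum_congr fun r => ?_
    simp [add_mul]

lemma seriesVal_zero (ε : ℝ) : seriesVal ε 0 = 0 := by simp [seriesVal]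

lemma convAt_zero (ε : ℝ) : ConvAt ε 0 := (convSubring ε).zero_mem

lemma seriesVal_mul_single {ε : ℝ} {p : Series} (hp : ConvAt ε p) (a : ℚ) :
    ConvAt ε (p * HahnSeries.single a 1) ∧
    seriesVal ε (p * HahnSeries.single a 1) = seriesVal ε p * (ePow ε a : ℂ) := by
  have h := hasSum_mul hp (hasSum_coeff_single ε a 1).summable
  refine ⟨h.summable, ?_⟩
  rw [seriesVal, h.tsum_eq]
  congr 1
  exact (hasSum_coeff_single ε a 1).tsum_eq.trans (one_mul _)

lemma tendsto_exp_neg_div {c : ℝ} (hc : 0 < c) :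
    Tendsto (fun ε : ℝ => Real.exp (-c / ε)) (𝓝[>] 0) (𝓝 0) := by
  refine Real.tendsto_exp_atBot.comp ?_
  have := tendsto_inv_nhdsGT_zero (𝕜 := ℝ)
  exact this.const_mul_atTop_of_neg (neg_lt_zero.mpr hc)

lemma tendsto_ePow {c : ℝ} (hc : 0 < c) : Tendsto (fun ε : ℝ => ePow ε c) (𝓝[>] 0) (𝓝 0) :=
  tendsto_exp_neg_div hc

/-- A series converging for small `ε` is asymptotic to its leading term. -/
lemma tendsto_seriesVal {p : Series} (hp : ∀ᶠ ε in 𝓝[>] (0 : ℝ), ConvAt ε p) :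
    Tendsto (fun ε : ℝ => seriesVal ε p / (ePow ε p.order : ℂ)) (𝓝[>] 0) (𝓝 p.leadingCoeff) := by
  rcases eq_or_ne p 0 with rfl | hp0
  · simp [seriesVal]
  have hord : ∀ q : ℚ, p.coeff q ≠ 0 → p.order ≤ q := fun q hq =>
    HahnSeries.order_le_of_coeff_ne_zero hq
  obtain ⟨δ, hδ, hconv⟩ : ∃ δ > (0 : ℝ), ConvAt δ p := by
    obtain ⟨δ, h1, h2⟩ := (hp.and self_mem_nhdsWithin).exists
    exact ⟨δ, h2, h1⟩
  have hlim : p.leadingCoeff = ∑' q : ℚ, if q = p.order then p.leadingCoeff else 0 := by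
    rw [tsum_ite_eq]
  rw [hlim]
  have hval : ∀ ε : ℝ, seriesVal ε p / (ePow ε p.order : ℂ) =
      ∑' q : ℚ, p.coeff q * (ePow ε (q - p.order) : ℂ) := by
    intro ε
    rw [seriesVal, ← tsum_div_const]
    refine tsum_congr fun q => ?_
    rw [ePow_sub]; push_cast; ring
  simp_rw [hval]
  -- All exponents q - order are non-negative on the support, so each factor decreases as ε
  -- decreases, and the terms at a fixed δ dominate those at every ε < δ.
  refine tendsto_tsum_of_dominated_convergence
    (bound := fun q : ℚ => ‖p.coeff q * (ePow δ q : ℂ)‖ / ePow δ p.order) ?_ ?_ ?_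
  · exact (Summable.norm hconv).div_const _
  · intro q
    by_cases hq : q = p.order
    · subst hq
      simp [ePow_zero, HahnSeries.leadingCoeff_eq]
    · rw [if_neg hq]
      by_cases hc : p.coeff q = 0
      · simp [hc]
      · have : p.order < q := lt_of_le_of_ne (hord q hc) (Ne.symm hq)
        have h' : (0 : ℝ) < (q : ℝ) - p.order := by
          have : ((p.order : ℚ) : ℝ) < q := by exact_mod_cast this
          linarith
        have := (Complex.continuous_ofReal.tendsto _).comp (tendsto_ePow h')
        simpa using this.const_mul (p.coeff q)
  · filter_upwards [self_mem_nhdsWithin, nhdsWithin_le_nhds (Iio_mem_nhds hδ)] with ε hε hεδ q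
    by_cases hc : p.coeff q = 0
    · simp [hc]
    have h' : (0 : ℝ) ≤ (q : ℝ) - p.order := by
      have : ((p.order : ℚ) : ℝ) ≤ q := by exact_mod_cast hord q hc
      linarith
    rw [norm_mul, norm_mul, mul_div_assoc, Complex.norm_real, Complex.norm_real,
      Real.norm_of_nonneg (ePow_pos _ _).le, Real.norm_of_nonneg (ePow_pos _ _).le, ← ePow_sub]
    refine mul_le_mul_of_nonneg_left ?_ (norm_nonneg _)
    refine Real.exp_le_exp.mpr ?_
    have hε' : (0 : ℝ) < ε := hε
    have : ((q : ℝ) - p.order) / δ ≤ ((q : ℝ) - p.order) / ε :=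
      div_le_div_of_nonneg_left h' hε' (le_of_lt hεδ)
    rw [neg_div, neg_div]; linarith

lemma IsConvPuiseux.eventually {p : Series} (hp : IsConvPuiseux p) :
    ∀ᶠ ε in 𝓝[>] (0 : ℝ), ConvAt ε p := by
  obtain ⟨-, δ, hδ, h⟩ := hp
  filter_upwards [self_mem_nhdsWithin, nhdsWithin_le_nhds (Iio_mem_nhds hδ)] with ε h1 h2
  exact h ε h1 h2

lemma IsUnitSeries.ne_zero {p : Series} (hp : IsUnitSeries p) : p ≠ 0 := by
  rintro rfl
  simpa using hp.2

lemma IsUnitSeries.leadingCoeff_ne {p : Series} (hp : IsUnitSeries p) : p.leadingCoeff ≠ 0 :=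
  HahnSeries.leadingCoeff_ne_zero.mpr hp.ne_zero

lemma IsUnitSeries.tendsto {p : Series} (hp : IsUnitSeries p) :
    Tendsto (fun ε : ℝ => seriesVal ε p) (𝓝[>] 0) (𝓝 p.leadingCoeff) := by
  have h := tendsto_seriesVal hp.1.eventually
  have h0 : p.order = 0 := by
    have := HahnSeries.order_eq_orderTop_of_ne_zero hp.ne_zero
    rw [hp.2] at this
    exact_mod_cast this
  simpa [h0, ePow_zero] using h

lemma factored_map {R S : Type*} [CommRing R] [CommRing S] (φ : R →+* S) (c : R) (m : ℕ) {d : ℕ}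
    (z : Fin d → R) : (factored c m z).map φ = factored (φ c) m fun j => φ (z j) := by
  simp [factored, Polynomial.map_prod]

/-! ### The coefficients of `f` as functions of ε -/

namespace CurveData

variable (D : CurveData)

lemma eventually_conv : ∀ᶠ ε in 𝓝[>] (0 : ℝ), ∀ i ∈ Finset.range (D.N + 1),
    ConvAt ε (D.c i) ∧ ∀ j, ConvAt ε (D.u i j) := by
  rw [Filter.eventually_all_finset]
  intro i hi
  have hi' : i ≤ D.N := by simpa [Nat.lt_succ_iff] using hi
  refine Filter.Eventually.and ?_ (Filter.eventually_all.mpr fun j => (D.u_unit i hi' j).1.eventually)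
  rcases D.c_unit i hi' with h | h
  · simp [h, convAt_zero]
  · exact h.1.eventually

/-- Both sides are images of one factored polynomial over `convSubring ε`, under the inclusion and
under `evalHom ε`. Evaluation therefore commutes with expanding the product. -/
lemma eventually_coeff_aAt : ∀ᶠ ε in 𝓝[>] (0 : ℝ), ∀ i ≤ D.N, ∀ l,
    ConvAt ε ((D.a i).coeff l) ∧ (D.aAt ε i).coeff l = seriesVal ε ((D.a i).coeff l) := by
  filter_upwards [D.eventually_conv] with ε hε i hi l
  obtain ⟨hc, hu⟩ := hε i (by simpa [Nat.lt_succ_iff] using hi)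
  let c' : convSubring ε := ⟨_, (seriesVal_mul_single hc (D.A i)).1⟩
  let z' : Fin (D.d i) → convSubring ε := fun j => ⟨_, (seriesVal_mul_single (hu j) (D.B i j)).1⟩
  have h1 : D.a i = (factored c' (D.m i) z').map (convSubring ε).subtype := by
    rw [factored_map]; rfl
  have h2 : D.aAt ε i = (factored c' (D.m i) z').map (evalHom ε) := by
    rw [factored_map, aAt]
    congr 1
    · exact (seriesVal_mul_single hc (D.A i)).2.symm
    · funext j
      exact (seriesVal_mul_single (hu j) (D.B i j)).2.symm
  rw [h1, h2, Polynomial.coeff_map, Polynomial.coeff_map]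
  exact ⟨((factored c' (D.m i) z').coeff l).2, rfl⟩

lemma f_coeff (k : ℕ) : D.f.coeff k = if k ≤ D.N then D.a (D.N - k) else 0 := by
  rw [f, Polynomial.finsetSum_coeff]
  simp only [Polynomial.coeff_C_mul, Polynomial.coeff_X_pow, mul_ite, mul_one, mul_zero]
  split_ifs with h
  · rw [Finset.sum_eq_single (D.N - k)]
    · rw [if_pos (by omega)]
    · intro i hi hne
      rw [Finset.mem_range] at hi
      rw [if_neg (by omega)]
    · intro h'; exact absurd (Finset.mem_range.mpr (by omega)) h'
  · refine Finset.sum_eq_zero fun i hi => ?_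
    rw [if_neg (by omega)]

/-- The finite set of exponents of `f`. -/
def supp : Finset (ℕ × ℕ) :=
  (D.f.support.sigma fun k => (D.f.coeff k).support).image fun x => (x.2, x.1)

lemma mem_supp {w : ℕ × ℕ} : w ∈ D.supp ↔ D.coeff w ≠ 0 := by
  simp only [supp, Finset.mem_image, Finset.mem_sigma, Polynomial.mem_support_iff, coeff]
  constructor
  · rintro ⟨x, ⟨h1, h2⟩, rfl⟩; exact h2
  · intro h
    refine ⟨⟨w.2, w.1⟩, ⟨?_, h⟩, rfl⟩
    intro h'; rw [h'] at h; simp at h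

lemma coeff_eq_a {w : ℕ × ℕ} (hw : w ∈ D.supp) :
    w.2 ≤ D.N ∧ D.coeff w = (D.a (D.N - w.2)).coeff w.1 := by
  rw [mem_supp, coeff, f_coeff] at hw
  split_ifs at hw with h
  · exact ⟨h, by rw [coeff, f_coeff, if_pos h]⟩
  · simp at hw

/-- The coefficient of `x^{w.1} y^{w.2}` at the parameter `ε`. -/
def b (ε : ℝ) (w : ℕ × ℕ) : ℂ := seriesVal ε (D.coeff w)

/-- The polynomial in `x, y` with the coefficients `β w`, where `w` runs through the exponents of
`f`. -/
def polySum (β : ℕ × ℕ → ℂ) (x y : ℂ) : ℂ := ∑ w ∈ D.supp, β w * (x ^ w.1 * y ^ w.2)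

lemma sum_supp {M : Type*} [AddCommMonoid M] (F : ℕ × ℕ → M) :
    ∑ w ∈ D.supp, F w = ∑ k ∈ D.f.support, ∑ l ∈ (D.f.coeff k).support, F (l, k) := by
  rw [supp, Finset.sum_image, Finset.sum_sigma]
  rintro ⟨a, b⟩ - ⟨c, d⟩ - h
  simp only [Prod.mk.injEq] at h
  obtain ⟨rfl, rfl⟩ := h
  rfl

lemma eventually_convAt_coeff : ∀ᶠ ε in 𝓝[>] (0 : ℝ), ∀ w ∈ D.supp, ConvAt ε (D.coeff w) := by
  filter_upwards [D.eventually_coeff_aAt] with ε h w hw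
  rw [(D.coeff_eq_a hw).2]
  exact (h _ (Nat.sub_le _ _) _).1

lemma tendsto_b {w : ℕ × ℕ} (hw : w ∈ D.supp) :
    Tendsto (fun ε : ℝ => D.b ε w / (ePow ε (D.coeff w).order : ℂ)) (𝓝[>] 0)
      (𝓝 (D.coeff w).leadingCoeff) :=
  tendsto_seriesVal (D.eventually_convAt_coeff.mono fun _ h => h w hw)

/-- The bridge between the two descriptions of a_i: its roots determine φ, while its monomials
determine the tropical sizes. -/
lemma eventually_aAt_eval : ∀ᶠ ε in 𝓝[>] (0 : ℝ), ∀ i ≤ D.N, ∀ x y : ℂ,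
    (D.aAt ε i).eval x * y ^ (D.N - i) =
      D.polySum (fun w => if w.2 = D.N - i then D.b ε w else 0) x y := by
  filter_upwards [D.eventually_coeff_aAt] with ε h i hi x y
  have hki : D.N - (D.N - i) = i := by omega
  have hc : D.f.coeff (D.N - i) = D.a i := by rw [f_coeff, if_pos (Nat.sub_le _ _), hki]
  rw [polySum, D.sum_supp]
  have h1 : ∀ k ∈ D.f.support, k ≠ D.N - i → ∑ l ∈ (D.f.coeff k).support,
      (if k = D.N - i then D.b ε (l, k) else 0) * (x ^ l * y ^ k) = 0 := by
    intro k _ hk; simp [hk]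
  rw [Finset.sum_eq_single (D.N - i) h1]
  · have hdeg : (D.aAt ε i).eval x = ∑ l ∈ (D.a i).support, (D.aAt ε i).coeff l * x ^ l := by
      rw [Polynomial.eval_eq_sum, Polynomial.sum]
      refine Finset.sum_subset_zero_on_sdiff ?_ ?_ fun _ _ => rfl
      · intro l hl
        rw [Polynomial.mem_support_iff] at hl ⊢
        intro h0
        rw [(h i hi l).2, h0, seriesVal_zero] at hl
        exact hl rfl
      · intro l hl
        have := (Finset.mem_sdiff.mp hl).2
        rw [Polynomial.notMem_support_iff] at this
        rw [this, zero_mul]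
    rw [hdeg, hc, Finset.sum_mul]
    refine Finset.sum_congr rfl fun l _ => ?_
    rw [(h i hi l).2]
    simp only [b, coeff, hc, if_true]
    ring
  · intro h0
    rw [Polynomial.notMem_support_iff] at h0
    simp [h0]

lemma eventually_fAt : ∀ᶠ ε in 𝓝[>] (0 : ℝ), ∀ x y : ℂ, D.fAt ε x y = D.polySum (D.b ε) x y := by
  filter_upwards [D.eventually_aAt_eval] with ε h x y
  rw [fAt, Finset.sum_congr rfl fun i hi => h i (by simpa [Nat.lt_succ_iff] using hi) x y]
  simp only [polySum]
  rw [Finset.sum_comm]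
  refine Finset.sum_congr rfl fun w hw => ?_
  have hw2 := (D.coeff_eq_a hw).1
  rw [Finset.sum_eq_single (D.N - w.2)]
  · rw [if_pos (by omega)]
  · intro i hi hne
    rw [Finset.mem_range] at hi
    rw [if_neg (by omega), zero_mul]
  · intro h'; exact absurd (Finset.mem_range.mpr (by omega)) h'

lemma trunc_eval (P : ℝ × ℝ) (x y : ℂ) [DecidablePred (· ∈ D.Theta P)] :
    (D.trunc P).evalEval x y =
      D.polySum (fun w => if w ∈ D.Theta P then (D.coeff w).leadingCoeff else 0) x y := by
  classical
  rw [polySum, D.sum_supp, trunc]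
  simp only [Polynomial.evalEval_finsetSum]
  refine Finset.sum_congr rfl fun k _ => Finset.sum_congr rfl fun l _ => ?_
  split_ifs with h
  · simp [Polynomial.evalEval, mul_assoc]
  · simp

end CurveData

end TropInt

end

/-! ### Minimal exponents, edges, and the graphs of the functions 𝒩_i -/

noncomputable section

namespace TropInt

/-- The point `(1 - s) Q₀ + s Q₁`. -/
def pt (Q₀ Q₁ : ℝ × ℝ) (s : ℝ) : ℝ × ℝ := ((1 - s) * Q₀.1 + s * Q₁.1, (1 - s) * Q₀.2 + s * Q₁.2)

lemma openSegment_eq_pt (Q₀ Q₁ : ℝ × ℝ) : openSegment ℝ Q₀ Q₁ = pt Q₀ Q₁ '' Ioo 0 1 := by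
  rw [openSegment_eq_image]; rfl

lemma segment_eq_pt (Q₀ Q₁ : ℝ × ℝ) : segment ℝ Q₀ Q₁ = pt Q₀ Q₁ '' Icc 0 1 := by
  rw [segment_eq_image]; rfl

lemma pt_mem_openSegment (Q₀ Q₁ : ℝ × ℝ) {s : ℝ} (hs : s ∈ Ioo (0 : ℝ) 1) :
    pt Q₀ Q₁ s ∈ openSegment ℝ Q₀ Q₁ := by
  rw [openSegment_eq_pt]; exact mem_image_of_mem _ hs

lemma pt_pt (Q₀ Q₁ : ℝ × ℝ) (s₀ s₁ t : ℝ) :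
    pt (pt Q₀ Q₁ s₀) (pt Q₀ Q₁ s₁) t = pt Q₀ Q₁ ((1 - t) * s₀ + t * s₁) := by
  simp only [pt, Prod.mk.injEq]; constructor <;> ring

lemma exists_pos_le_finset {ι : Type*} (s : Finset ι) (g : ι → ℝ) (hg : ∀ i ∈ s, 0 < g i) :
    ∃ c > 0, ∀ i ∈ s, c ≤ g i := by
  have h : ∀ᶠ c in 𝓝[>] (0 : ℝ), ∀ i ∈ s, c ≤ g i := by
    rw [Filter.eventually_all_finset]
    intro i hi
    exact nhdsWithin_le_nhds (Iic_mem_nhds (hg i hi))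
  obtain ⟨c, h1, h2⟩ := (h.and self_mem_nhdsWithin).exists
  exact ⟨c, h2, h1⟩

lemma exists_le_finset {ι : Type*} (s : Finset ι) (g : ι → ℝ) :
    ∃ C > 0, ∀ i ∈ s, g i ≤ C := by
  have h : ∀ᶠ C in atTop, ∀ i ∈ s, g i ≤ C := by
    rw [Filter.eventually_all_finset]
    intro i _
    exact eventually_ge_atTop _
  obtain ⟨c, h1, h2⟩ := (h.and (eventually_gt_atTop 0)).exists
  exact ⟨c, h2, h1⟩

namespace CurveData

variable (D : CurveData)

/-! ### Minimal exponents -/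

lemma a_ne_zero {i : ℕ} (hc : D.c i ≠ 0) : D.a i ≠ 0 := by
  rw [a, factored]
  refine mul_ne_zero (mul_ne_zero ?_ (pow_ne_zero _ Polynomial.X_ne_zero)) ?_
  · exact Polynomial.C_ne_zero.mpr (mul_ne_zero hc (HahnSeries.single_ne_zero one_ne_zero))
  · exact (Polynomial.monic_prod_of_monic _ _ fun j _ => Polynomial.monic_X_sub_C _).ne_zero

lemma exists_mem_supp {i : ℕ} (hi : i ≤ D.N) (hc : D.c i ≠ 0) : ∃ w ∈ D.supp, w.2 = D.N - i := by
  have h : D.f.coeff (D.N - i) = D.a i := by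
    rw [f_coeff, if_pos (Nat.sub_le _ _)]; congr 1; omega
  have h0 := D.a_ne_zero hc
  obtain ⟨l, hl⟩ : ∃ l, (D.a i).coeff l ≠ 0 := by
    by_contra hcon
    push Not at hcon
    exact h0 (Polynomial.ext fun n => by simpa using hcon n)
  exact ⟨(l, D.N - i), D.mem_supp.mpr (by rw [coeff, h]; exact hl), rfl⟩

lemma supp_nonempty : D.supp.Nonempty := by
  obtain ⟨w, hw, -⟩ := D.exists_mem_supp (Nat.zero_le _) D.c_first
  exact ⟨w, hw⟩

lemma mem_Theta {w : ℕ × ℕ} {P : ℝ × ℝ} :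
    w ∈ D.Theta P ↔ w ∈ D.supp ∧ ∀ v ∈ D.supp, D.term w P ≤ D.term v P := by
  have hset : {w | D.coeff w ≠ 0} = (D.supp : Set (ℕ × ℕ)) := by
    ext w; simp [mem_supp]
  have hfin : ((fun w => D.term w P) '' (D.supp : Set (ℕ × ℕ))).Finite :=
    D.supp.finite_toSet.image _
  rw [Theta, tropVal, hset, mem_ofPred_eq, ← mem_supp]
  refine and_congr_right fun hw => ⟨fun h v hv => ?_, fun h => ?_⟩
  · rw [h]; exact csInf_le hfin.bddBelow (mem_image_of_mem _ hv)
  · refine le_antisymm (le_csInf ⟨_, mem_image_of_mem _ hw⟩ ?_)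
      (csInf_le hfin.bddBelow (mem_image_of_mem _ hw))
    rintro _ ⟨v, hv, rfl⟩
    exact h v hv

lemma Theta_nonempty (P : ℝ × ℝ) : (D.Theta P).Nonempty := by
  obtain ⟨w, hw, h⟩ := D.supp.exists_min_image (fun w => D.term w P) D.supp_nonempty
  exact ⟨w, D.mem_Theta.mpr ⟨hw, h⟩⟩

lemma tropVal_le {w : ℕ × ℕ} (hw : w ∈ D.supp) (P : ℝ × ℝ) : D.tropVal P ≤ D.term w P := by
  obtain ⟨v, hv⟩ := D.Theta_nonempty P
  rw [← hv.2]
  exact (D.mem_Theta.mp hv).2 w hw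

lemma term_pt (w : ℕ × ℕ) (Q₀ Q₁ : ℝ × ℝ) (s : ℝ) :
    D.term w (pt Q₀ Q₁ s) = (1 - s) * D.term w Q₀ + s * D.term w Q₁ := by
  simp only [term, pt]; ring

lemma continuous_term (w : ℕ × ℕ) : Continuous (D.term w) := by
  unfold term; fun_prop

/-- An exponent that is not minimal at P loses strictly to a minimal one, and finitely many strict
inequalities between continuous functions persist near P. -/
lemma eventually_Theta_subset (P : ℝ × ℝ) : ∀ᶠ Q in 𝓝 P, D.Theta Q ⊆ D.Theta P := by
  obtain ⟨w₀, hw₀⟩ := D.Theta_nonempty P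
  have h : ∀ᶠ Q in 𝓝 P, ∀ w ∈ D.supp, w ∉ D.Theta P → D.term w₀ Q < D.term w Q := by
    rw [Filter.eventually_all_finset]
    intro w hw
    by_cases hwP : w ∈ D.Theta P
    · exact Eventually.of_forall fun _ h => absurd hwP h
    have : D.term w₀ P < D.term w P := by
      rw [hw₀.2]
      refine lt_of_le_of_ne (D.tropVal_le hw P) fun h => hwP ⟨D.mem_supp.mp hw, h.symm⟩
    filter_upwards [(D.continuous_term w₀).continuousAt.eventually_lt
      (D.continuous_term w).continuousAt this] with Q hQ _ using hQ
  filter_upwards [h] with Q hQ w hw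
  by_contra hwP
  have h1 := D.mem_Theta.mp hw
  exact absurd (h1.2 w₀ (D.mem_Theta.mp hw₀).1) (not_le.mpr (hQ w h1.1 hwP))

/-- With a single minimal exponent, `tropVal` coincides near P with an affine function. -/
lemma Theta_nontrivial_of_mem {P : ℝ × ℝ} (hP : P ∈ D.tropCurve) : (D.Theta P).Nontrivial := by
  by_contra h
  rw [Set.not_nontrivial_iff] at h
  obtain ⟨w, hw⟩ := D.Theta_nonempty P
  refine hP ?_
  have h1 : D.tropVal =ᶠ[𝓝 P] D.term w := by
    filter_upwards [D.eventually_Theta_subset P] with Q hQ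
    obtain ⟨v, hv⟩ := D.Theta_nonempty Q
    rw [← hv.2, h (hQ hv) hw]
  refine ContDiffAt.congr_of_eventuallyEq ?_ h1
  unfold term
  fun_prop

/-- Each minimal term touches `tropVal` from above at P, so a derivative of `tropVal` would have to
equal the gradient of every minimal term. Distinct exponents have distinct gradients. -/
lemma mem_tropCurve {P : ℝ × ℝ} (hP : (D.Theta P).Nontrivial) : P ∈ D.tropCurve := by
  intro hd
  obtain ⟨w, hw, v, hv, hne⟩ := hP
  have hdiff : DifferentiableAt ℝ D.tropVal P := hd.differentiableAt (by simp)
  have key : ∀ u ∈ D.Theta P, ∀ e : ℝ × ℝ,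
      fderiv ℝ D.tropVal P e = (u.1 : ℝ) * e.1 + (u.2 : ℝ) * e.2 := by
    intro u hu e
    have hmax : IsLocalMax (fun Q => D.tropVal Q - D.term u Q) P := by
      refine Eventually.of_forall fun Q => ?_
      have h1 := D.tropVal_le (D.mem_Theta.mp hu).1 Q
      have h2 := hu.2
      simp only; linarith
    have hterm : HasFDerivAt (D.term u)
        ((u.1 : ℝ) • ContinuousLinearMap.fst ℝ ℝ ℝ + (u.2 : ℝ) • ContinuousLinearMap.snd ℝ ℝ ℝ) P := by
      unfold term
      exact ((hasFDerivAt_fst.const_mul _).const_add _).add (hasFDerivAt_snd.const_mul _)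
    have h0 := hmax.hasFDerivAt_eq_zero (hdiff.hasFDerivAt.sub hterm)
    have h1 := congrArg (fun L => L e) h0
    simp only [sub_apply, add_apply,
      smul_apply, ContinuousLinearMap.coe_fst', ContinuousLinearMap.coe_snd',
      smul_eq_mul, zero_apply] at h1
    linarith
  have h1 := (key w hw (1, 0)).symm.trans (key v hv (1, 0))
  have h2 := (key w hw (0, 1)).symm.trans (key v hv (0, 1))
  simp at h1 h2
  exact hne (Prod.ext h1 h2)

/-! ### Edges -/

/-- On the interior of the edge from `Q₀` to `Q₁`, the set of minimal exponents is `T`. -/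
structure EdgeSupp (Q₀ Q₁ : ℝ × ℝ) (T : Set (ℕ × ℕ)) : Prop where
  ne : Q₀ ≠ Q₁
  eq : {Q | D.Theta Q = T} = openSegment ℝ Q₀ Q₁
  nontrivial : T.Nontrivial

variable {D}

lemma IsEdge.exists_edgeSupp {Q₀ Q₁ : ℝ × ℝ} (h : D.IsEdge Q₀ Q₁) :
    ∃ T, D.EdgeSupp Q₀ Q₁ T := by
  obtain ⟨hne, P, hP, heq⟩ := h
  exact ⟨D.Theta P, hne, heq, D.Theta_nontrivial_of_mem hP⟩

namespace EdgeSupp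

variable {Q₀ Q₁ : ℝ × ℝ} {T : Set (ℕ × ℕ)}

lemma Theta_eq (h : D.EdgeSupp Q₀ Q₁ T) {P : ℝ × ℝ} (hP : P ∈ openSegment ℝ Q₀ Q₁) : D.Theta P = T := by
  rw [← h.eq] at hP; exact hP

lemma Theta_half (h : D.EdgeSupp Q₀ Q₁ T) : D.Theta (pt Q₀ Q₁ (1 / 2)) = T :=
  h.Theta_eq (pt_mem_openSegment _ _ (by norm_num))

lemma isEdge (h : D.EdgeSupp Q₀ Q₁ T) : D.IsEdge Q₀ Q₁ :=
  ⟨h.ne, pt Q₀ Q₁ (1 / 2), D.mem_tropCurve (by rw [h.Theta_half]; exact h.nontrivial),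
    by rw [h.Theta_half]; exact h.eq⟩

lemma subset_supp (h : D.EdgeSupp Q₀ Q₁ T) {w : ℕ × ℕ} (hw : w ∈ T) : w ∈ D.supp := by
  rw [← h.Theta_half] at hw; exact (D.mem_Theta.mp hw).1

/-- Minimality is a closed condition and so passes from the open edge to its end points. Only an
inclusion survives, since further exponents may become minimal there. -/
lemma subset_Theta (h : D.EdgeSupp Q₀ Q₁ T) {P : ℝ × ℝ} (hP : P ∈ segment ℝ Q₀ Q₁) : T ⊆ D.Theta P := by
  intro w hw
  refine D.mem_Theta.mpr ⟨h.subset_supp hw, fun v hv => ?_⟩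
  have hcl : IsClosed {Q | D.term w Q ≤ D.term v Q} :=
    isClosed_le (D.continuous_term w) (D.continuous_term v)
  have hsub : openSegment ℝ Q₀ Q₁ ⊆ {Q | D.term w Q ≤ D.term v Q} := by
    intro Q hQ
    rw [← h.Theta_eq hQ] at hw
    exact (D.mem_Theta.mp hw).2 v hv
  have := closure_minimal hsub hcl
  rw [closure_openSegment] at this
  exact this hP

lemma mem_tropCurve (h : D.EdgeSupp Q₀ Q₁ T) {P : ℝ × ℝ} (hP : P ∈ segment ℝ Q₀ Q₁) : P ∈ D.tropCurve :=
  D.mem_tropCurve (h.nontrivial.mono (h.subset_Theta hP))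

/-- Along an edge, the exponents outside `T` are non-minimal by an amount comparable to the
distance from the end points. -/
lemma exists_gap (h : D.EdgeSupp Q₀ Q₁ T) : ∃ c > 0, ∀ s ∈ Icc (0 : ℝ) 1, ∀ w ∈ D.supp,
    (w ∈ T → D.term w (pt Q₀ Q₁ s) = D.tropVal (pt Q₀ Q₁ s)) ∧
    (w ∉ T → D.tropVal (pt Q₀ Q₁ s) + c * min s (1 - s) ≤ D.term w (pt Q₀ Q₁ s)) := by
  classical
  obtain ⟨w₀, hw₀⟩ := h.nontrivial.nonempty
  have hseg : ∀ s ∈ Icc (0 : ℝ) 1, pt Q₀ Q₁ s ∈ segment ℝ Q₀ Q₁ := fun s hs => by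
    rw [segment_eq_pt]; exact mem_image_of_mem _ hs
  have hval : ∀ s ∈ Icc (0 : ℝ) 1, ∀ w ∈ T, D.term w (pt Q₀ Q₁ s) = D.tropVal (pt Q₀ Q₁ s) :=
    fun s hs w hw => (h.subset_Theta (hseg s hs) hw).2
  have h0 : pt Q₀ Q₁ 0 = Q₀ := by simp [pt]
  have h1 : pt Q₀ Q₁ 1 = Q₁ := by simp [pt]
  -- The excess of an exponent outside `T` is affine in s and non-negative at both ends, hence at
  -- least min(s, 1 - s) times the sum of its two end values. That sum is twice the excess at the
  -- midpoint, which is positive; c is a lower bound of these sums.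
  obtain ⟨c, hc, hcl⟩ := exists_pos_le_finset (D.supp.filter fun w => w ∉ T)
    (fun w => (D.term w Q₀ - D.term w₀ Q₀) + (D.term w Q₁ - D.term w₀ Q₁)) (by
      intro w hw
      obtain ⟨hw, hwT⟩ := Finset.mem_filter.mp hw
      have hlt : D.tropVal (pt Q₀ Q₁ (1 / 2)) < D.term w (pt Q₀ Q₁ (1 / 2)) := by
        refine lt_of_le_of_ne (D.tropVal_le hw _) fun hh => hwT ?_
        rw [← h.Theta_half]
        exact ⟨D.mem_supp.mp hw, hh.symm⟩
      rw [← hval (1 / 2) (by norm_num) w₀ hw₀, term_pt, term_pt] at hlt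
      linarith)
  refine ⟨c, hc, fun s hs w hw => ⟨hval s hs w, fun hwT => ?_⟩⟩
  have hcw := hcl w (Finset.mem_filter.mpr ⟨hw, hwT⟩)
  have ha0 : 0 ≤ D.term w Q₀ - D.term w₀ Q₀ := by
    have e1 := hval 0 (by norm_num) w₀ hw₀
    have e2 := D.tropVal_le hw Q₀
    rw [h0] at e1; linarith
  have ha1 : 0 ≤ D.term w Q₁ - D.term w₀ Q₁ := by
    have e1 := hval 1 (by norm_num) w₀ hw₀
    have e2 := D.tropVal_le hw Q₁
    rw [h1] at e1; linarith
  rw [← hval s hs w₀ hw₀, term_pt, term_pt]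
  have m0 : 0 ≤ min s (1 - s) := le_min hs.1 (by linarith [hs.2])
  have m1 : min s (1 - s) ≤ s := min_le_left _ _
  have m2 : min s (1 - s) ≤ 1 - s := min_le_right _ _
  nlinarith [mul_le_mul_of_nonneg_right hcw m0, mul_le_mul_of_nonneg_right m1 ha1,
    mul_le_mul_of_nonneg_right m2 ha0]

/-- On a vertical edge only one power of `y` is minimal. -/
lemma snd_eq_of_vertical (h : D.EdgeSupp Q₀ Q₁ T) (hv : Q₀.1 = Q₁.1) {w v : ℕ × ℕ} (hw : w ∈ T) (hv' : v ∈ T) :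
    w.2 = v.2 := by
  obtain ⟨c, -, hc⟩ := h.exists_gap
  have e := fun s hs => ((hc s hs w (h.subset_supp hw)).1 hw).trans
    ((hc s hs v (h.subset_supp hv')).1 hv').symm
  have e0 := e 0 (by norm_num)
  have e1 := e 1 (by norm_num)
  simp only [term, pt, ← hv] at e0 e1
  have hne : Q₀.2 ≠ Q₁.2 := fun h2 => h.ne (Prod.ext hv h2)
  have : ((w.2 : ℝ) - v.2) * (Q₀.2 - Q₁.2) = 0 := by linarith
  rcases mul_eq_zero.mp this with h3 | h3
  · exact_mod_cast sub_eq_zero.mp h3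
  · exact absurd (sub_eq_zero.mp h3) hne

/-- On a non-vertical edge, minimal exponents are determined by the power of `y`. -/
lemma eq_of_snd_eq (h : D.EdgeSupp Q₀ Q₁ T) (hv : Q₀.1 ≠ Q₁.1) {w v : ℕ × ℕ} (hw : w ∈ T) (hv' : v ∈ T)
    (h2 : w.2 = v.2) : w = v := by
  obtain ⟨c, -, hc⟩ := h.exists_gap
  have e := fun s hs => ((hc s hs w (h.subset_supp hw)).1 hw).trans
    ((hc s hs v (h.subset_supp hv')).1 hv').symm
  have e0 := e 0 (by norm_num)
  have e1 := e 1 (by norm_num)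
  simp only [term, pt, h2] at e0 e1
  have : ((w.1 : ℝ) - v.1) * (Q₀.1 - Q₁.1) = 0 := by linarith
  rcases mul_eq_zero.mp this with h3 | h3
  · exact Prod.ext (by exact_mod_cast sub_eq_zero.mp h3) h2
  · exact absurd (sub_eq_zero.mp h3) hv

/-- A non-vertical edge of a regular curve has exactly two minimal exponents. -/
lemma exists_pair (h : D.EdgeSupp Q₀ Q₁ T) (hreg : D.Regular) (hv : Q₀.1 ≠ Q₁.1) :
    ∃ w v : ℕ × ℕ, v.2 < w.2 ∧ T = {w, v} := by
  have hcard := hreg Q₀ Q₁ h.isEdge hv _ (pt_mem_openSegment Q₀ Q₁ (s := 1 / 2) (by norm_num))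
  rw [h.Theta_half, Set.ncard_eq_two] at hcard
  obtain ⟨w, v, hne, hT⟩ := hcard
  have hwT : w ∈ T := by rw [hT]; simp
  have hvT : v ∈ T := by rw [hT]; simp
  have h2 : w.2 ≠ v.2 := fun h2 => hne (h.eq_of_snd_eq hv hwT hvT h2)
  rcases lt_or_gt_of_ne h2 with h3 | h3
  · exact ⟨v, w, h3, by rw [hT, Set.pair_comm]⟩
  · exact ⟨w, v, h3, hT⟩

end EdgeSupp

/-! ### The functions `𝒩_i` -/

variable (D)

/-- Adding the two minimality inequalities gives (w₂ - v₂)(Y' - Y) ≥ 0: the slope of a concave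
function of Y decreases. -/
lemma snd_le_of_mem_Theta {X Y Y' : ℝ} {w v : ℕ × ℕ} (hw : w ∈ D.Theta (X, Y))
    (hv : v ∈ D.Theta (X, Y')) (hY : Y < Y') : v.2 ≤ w.2 := by
  have h1 := (D.mem_Theta.mp hw).2 v (D.mem_Theta.mp hv).1
  have h2 := (D.mem_Theta.mp hv).2 w (D.mem_Theta.mp hw).1
  simp only [term] at h1 h2
  by_contra hlt
  push Not at hlt
  have h3 : (w.2 : ℝ) < v.2 := by exact_mod_cast hlt
  nlinarith [mul_pos (sub_pos.mpr h3) (sub_pos.mpr hY)]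

lemma exists_domain_iff {j : ℕ} {P : ℝ × ℝ} :
    (∃ i ≥ j, P ∈ D.domain i) ↔ ∃ w ∈ D.Theta P, w.2 + j ≤ D.N := by
  constructor
  · rintro ⟨i, hi, hiN, w, hw, hw2⟩
    exact ⟨w, hw, by omega⟩
  · rintro ⟨w, hw, h⟩
    exact ⟨D.N - w.2, by omega, by omega, w, hw, by omega⟩

/-- Since a_0 ≠ 0, the power y^N dominates for very negative Y. This bounds the set defining 𝒩_j
below for j ≥ 1, so that the real `sInf` is a true infimum and not the default value 0. -/
lemma exists_forall_lt_snd (X : ℝ) : ∃ Y₀ : ℝ, ∀ Y ≤ Y₀, ∀ w ∈ D.Theta (X, Y), w.2 = D.N := by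
  obtain ⟨w₀, hw₀, hw₀2⟩ := D.exists_mem_supp (Nat.zero_le _) D.c_first
  obtain ⟨C, -, hC⟩ := exists_le_finset D.supp fun w => |D.term w₀ (X, 0) - D.term w (X, 0)| + 1
  refine ⟨-C, fun Y hY w hw => ?_⟩
  by_contra hne
  have hwS := (D.mem_Theta.mp hw).1
  have hle := (D.coeff_eq_a hwS).1
  have h1 := (D.mem_Theta.mp hw).2 w₀ hw₀
  have h2 := hC w hwS
  have h3 := neg_abs_le (D.term w₀ (X, 0) - D.term w (X, 0))
  have h4 := le_abs_self (D.term w₀ (X, 0) - D.term w (X, 0))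
  simp only [term, hw₀2] at h1 h2 h3 h4
  have h5 : (w.2 : ℝ) + 1 ≤ (D.N - 0 : ℕ) := by
    have : w.2 + 1 ≤ D.N - 0 := by omega
    exact_mod_cast this
  nlinarith

/-- Since a_N ≠ 0, the power y^0 dominates for large Y; this makes the set defining 𝒩_j non-empty
for j ≤ N. -/
lemma exists_forall_gt_snd (X : ℝ) : ∃ Y : ℝ, ∀ w ∈ D.Theta (X, Y), w.2 = 0 := by
  obtain ⟨w₀, hw₀, hw₀2⟩ := D.exists_mem_supp le_rfl D.c_last
  obtain ⟨C, hC0, hC⟩ := exists_le_finset D.supp fun w => |D.term w₀ (X, 0) - D.term w (X, 0)| + 1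
  refine ⟨C, fun w hw => ?_⟩
  by_contra hne
  have hwS := (D.mem_Theta.mp hw).1
  have h1 := (D.mem_Theta.mp hw).2 w₀ hw₀
  have h2 := hC w hwS
  have h4 := le_abs_self (D.term w₀ (X, 0) - D.term w (X, 0))
  rw [Nat.sub_self] at hw₀2
  simp only [term, hw₀2] at h1 h2 h4
  have h5 : (1 : ℝ) ≤ w.2 := by exact_mod_cast Nat.one_le_iff_ne_zero.mpr hne
  push_cast at h1 h2 h4
  nlinarith

lemma NN_bddBelow {j : ℕ} (h1 : 1 ≤ j) (X : ℝ) :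
    BddBelow {Y | ∃ i ≥ j, (X, Y) ∈ D.domain i} := by
  obtain ⟨Y₀, hY₀⟩ := D.exists_forall_lt_snd X
  refine ⟨Y₀, fun Y hY => ?_⟩
  obtain ⟨w, hw, hw2⟩ := D.exists_domain_iff.mp hY
  by_contra hlt
  have := hY₀ Y (not_le.mp hlt).le w hw
  omega

lemma NN_nonempty {j : ℕ} (hj : j ≤ D.N) (X : ℝ) :
    {Y | ∃ i ≥ j, (X, Y) ∈ D.domain i}.Nonempty := by
  obtain ⟨Y, hY⟩ := D.exists_forall_gt_snd X
  obtain ⟨w, hw⟩ := D.Theta_nonempty (X, Y)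
  exact ⟨Y, D.exists_domain_iff.mpr ⟨w, hw, by have := hY w hw; omega⟩⟩

lemma lt_snd_of_lt_NN {j : ℕ} (h1 : 1 ≤ j) {X Y : ℝ} (hY : Y < D.NN j X)
    {w : ℕ × ℕ} (hw : w ∈ D.Theta (X, Y)) : D.N < w.2 + j := by
  by_contra hle
  exact notMem_of_lt_csInf hY (D.NN_bddBelow h1 X)
    (D.exists_domain_iff.mpr ⟨w, hw, not_lt.mp hle⟩)

lemma eventually_Theta_subset_snd (X Y : ℝ) :
    ∀ᶠ Z in 𝓝 Y, D.Theta (X, Z) ⊆ D.Theta (X, Y) := by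
  have hc : ContinuousAt (fun Z : ℝ => (X, Z)) Y := by fun_prop
  exact hc.eventually (D.eventually_Theta_subset (X, Y))

lemma exists_le_at_NN {j : ℕ} (h1 : 1 ≤ j) (hj : j ≤ D.N) (X : ℝ) :
    ∃ w ∈ D.Theta (X, D.NN j X), w.2 + j ≤ D.N := by
  have hmem := csInf_mem_closure (D.NN_nonempty hj X) (D.NN_bddBelow h1 X)
  obtain ⟨Z, hZ, hZ'⟩ := ((mem_closure_iff_frequently.mp hmem).and_eventually
    (D.eventually_Theta_subset_snd X (D.NN j X))).exists
  obtain ⟨w, hw, hw2⟩ := D.exists_domain_iff.mp hZ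
  exact ⟨w, hZ' hw, hw2⟩

lemma exists_gt_at_NN {j : ℕ} (h1 : 1 ≤ j) (X : ℝ) :
    ∃ w ∈ D.Theta (X, D.NN j X), D.N < w.2 + j := by
  obtain ⟨Z, hZ, hZ'⟩ := (((D.eventually_Theta_subset_snd X (D.NN j X)).filter_mono
    (nhdsWithin_le_nhds (s := Iio (D.NN j X)))).and self_mem_nhdsWithin).exists
  obtain ⟨w, hw⟩ := D.Theta_nonempty (X, Z)
  exact ⟨w, hZ hw, D.lt_snd_of_lt_NN h1 hZ' hw⟩

/-- G_j is the wall between the powers of y above N - j and those up to N - j. The infimum is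
attained because `Theta` is upper semicontinuous, approaching it from below yields an exponent on
the other side, and monotonicity of the power in Y gives the converse. -/
lemma mem_G_iff {j : ℕ} (h1 : 1 ≤ j) (hj : j ≤ D.N) {P : ℝ × ℝ} :
    P ∈ D.G j ↔ (∃ w ∈ D.Theta P, w.2 + j ≤ D.N) ∧ ∃ w ∈ D.Theta P, D.N < w.2 + j := by
  obtain ⟨X, Y⟩ := P
  constructor
  · intro h
    have hY : Y = D.NN j X := h
    rw [hY]
    exact ⟨D.exists_le_at_NN h1 hj X, D.exists_gt_at_NN h1 X⟩
  · rintro ⟨hle, w, hw, hw2⟩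
    refine le_antisymm (le_csInf (D.NN_nonempty hj X) fun Z hZ => ?_)
      (csInf_le (D.NN_bddBelow h1 X) (D.exists_domain_iff.mpr hle))
    obtain ⟨v, hv, hv2⟩ := D.exists_domain_iff.mp hZ
    by_contra hlt
    have := D.snd_le_of_mem_Theta hv hw (not_le.mp hlt)
    omega

variable {D}

/-- Containment in the graphs becomes arithmetic of the two powers of y. Comparing j = I with j = I
+ 1 then tells whether N - I is one of these powers, which is all that the integrals depend on. -/
lemma EdgeSupp.subset_G_iff {Q₀ Q₁ : ℝ × ℝ} {w v : ℕ × ℕ} (h : D.EdgeSupp Q₀ Q₁ {w, v})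
    (hwv : v.2 < w.2) {j : ℕ} (h1 : 1 ≤ j) (hj : j ≤ D.N) :
    segment ℝ Q₀ Q₁ ⊆ D.G j ↔ v.2 + j ≤ D.N ∧ D.N < w.2 + j := by
  constructor
  · intro hs
    have hmem := pt_mem_openSegment Q₀ Q₁ (s := 1 / 2) (by norm_num)
    have := (D.mem_G_iff h1 hj).mp (hs (openSegment_subset_segment ℝ Q₀ Q₁ hmem))
    rw [h.Theta_half] at this
    simp only [mem_insert_iff, mem_singleton_iff, exists_eq_or_imp, exists_eq_left] at this
    omega
  · rintro ⟨h2, h3⟩ P hP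
    exact (D.mem_G_iff h1 hj).mpr ⟨⟨v, h.subset_Theta hP (by simp), h2⟩,
      ⟨w, h.subset_Theta hP (by simp), h3⟩⟩

lemma EdgeSupp.vThickness_eq {Q₀ Q₁ : ℝ × ℝ} {w v : ℕ × ℕ} (h : D.EdgeSupp Q₀ Q₁ {w, v})
    (hwv : v.2 < w.2) : D.vThickness Q₀ Q₁ = w.2 - v.2 := by
  have hwN := (D.coeff_eq_a (h.subset_supp (w := w) (by simp))).1
  have : {i : ℕ | 1 ≤ i ∧ i ≤ D.N ∧ segment ℝ Q₀ Q₁ ⊆ D.G i} =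
      (Finset.Ioc (D.N - w.2) (D.N - v.2) : Set ℕ) := by
    ext i
    simp only [mem_ofPred_eq, Finset.coe_Ioc, mem_Ioc]
    constructor
    · rintro ⟨h1, h2, h3⟩
      have := (h.subset_G_iff hwv h1 h2).mp h3
      omega
    · rintro ⟨h1, h2⟩
      refine ⟨by omega, by omega, (h.subset_G_iff hwv (by omega) (by omega)).mpr (by omega)⟩
  rw [vThickness, this, Set.ncard_coe_finset, Nat.card_Ioc]
  omega

lemma not_segment_subset_G {Q₀ Q₁ : ℝ × ℝ} (hne : Q₀ ≠ Q₁) (hv : Q₀.1 = Q₁.1) (j : ℕ) :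
    ¬ segment ℝ Q₀ Q₁ ⊆ D.G j := by
  intro hs
  have h0 : Q₀.2 = D.NN j Q₀.1 := hs (left_mem_segment ℝ Q₀ Q₁)
  have h1 : Q₁.2 = D.NN j Q₁.1 := hs (right_mem_segment ℝ Q₀ Q₁)
  exact hne (Prod.ext hv (by rw [h0, h1, hv]))

lemma mem_openSegment_vertical {B Y₀ Y₁ : ℝ} (hY : Y₀ < Y₁) (P : ℝ × ℝ) :
    P ∈ openSegment ℝ (B, Y₀) (B, Y₁) ↔ P.1 = B ∧ Y₀ < P.2 ∧ P.2 < Y₁ := by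
  rw [← Prod.image_mk_openSegment_right, openSegment_eq_Ioo hY]
  constructor
  · rintro ⟨y, hy, rfl⟩; exact ⟨rfl, hy⟩
  · rintro ⟨h1, h2⟩; exact ⟨P.2, h2, Prod.ext h1.symm rfl⟩

/-! ### Vertical edges between consecutive graphs -/

section VerticalEdge

variable {I : ℕ} {B : ℝ}

lemma snd_eq_of_between (hI : 1 ≤ I) (hIN : I + 1 ≤ D.N) {Y : ℝ} (h0 : D.NN I B < Y) (h1 : Y < D.NN (I + 1) B) {w : ℕ × ℕ}
    (hw : w ∈ D.Theta (B, Y)) : w.2 = D.N - I := by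
  have h2 := D.lt_snd_of_lt_NN (by omega) h1 hw
  obtain ⟨v, hv, hv2⟩ := D.exists_le_at_NN hI (by omega) B
  have := D.snd_le_of_mem_Theta hv hw h0
  omega

/-- Strictly between the two graphs only the power N - I is minimal, so `Theta` does not depend on Y
there. Two exponents with this common power fix X = B, and at each end an exponent with another
power enters, so the cell is exactly the open segment. -/
lemma edgeSupp_vertical (hI : 1 ≤ I) (hIN : I + 1 ≤ D.N) {Y : ℝ} (h0 : D.NN I B < Y) (h1 : Y < D.NN (I + 1) B)
    (hnt : (D.Theta (B, Y)).Nontrivial) :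
    D.EdgeSupp (B, D.NN I B) (B, D.NN (I + 1) B) (D.Theta (B, Y)) := by
  have hY := h0.trans h1
  refine ⟨fun h => hY.ne (congrArg Prod.snd h), ?_, hnt⟩
  have hle : ∀ Y₁ Y₂, D.NN I B < Y₁ → Y₁ < D.NN (I + 1) B → D.NN I B < Y₂ →
      Y₂ < D.NN (I + 1) B → D.Theta (B, Y₁) ⊆ D.Theta (B, Y₂) := by
    intro Y₁ Y₂ a1 a2 b1 b2 w hw
    obtain ⟨v, hv⟩ := D.Theta_nonempty (B, Y₂)
    have e : (w.2 : ℝ) = v.2 := by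
      rw [snd_eq_of_between hI hIN a1 a2 hw, snd_eq_of_between hI hIN b1 b2 hv]
    have hw' := D.mem_Theta.mp hw
    have hv' := D.mem_Theta.mp hv
    refine D.mem_Theta.mpr ⟨hw'.1, fun u hu => le_trans ?_ (hv'.2 u hu)⟩
    have := hw'.2 v hv'.1
    simp only [term, e] at this ⊢
    linarith
  ext ⟨X, Z⟩
  rw [mem_openSegment_vertical hY]
  constructor
  · intro h
    have h : D.Theta (X, Z) = D.Theta (B, Y) := h
    obtain ⟨w, hw, v, hv, hne⟩ := hnt
    have ew := snd_eq_of_between hI hIN h0 h1 hw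
    have ev := snd_eq_of_between hI hIN h0 h1 hv
    have e : D.term w (B, Y) = D.term v (B, Y) := hw.2.trans hv.2.symm
    -- The two terms agree at (B, Y) and at (X, Z). With equal powers of y, their difference is a
    -- non-constant affine function of the abscissa alone.
    have hXB : X = B := by
      have e' : D.term w (X, Z) = D.term v (X, Z) := by
        rw [← h] at hw hv; exact hw.2.trans hv.2.symm
      simp only [term, ew, ev] at e e'
      have h3 : ((w.1 : ℝ) - v.1) * (X - B) = 0 := by linarith
      rcases mul_eq_zero.mp h3 with h4 | h4
      · exact absurd (Prod.ext (by exact_mod_cast sub_eq_zero.mp h4) (ew.trans ev.symm)) hne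
      · exact sub_eq_zero.mp h4
    subst hXB
    refine ⟨rfl, ?_, ?_⟩
    · by_contra hle'
      rcases lt_or_eq_of_le (not_lt.mp hle') with h3 | h3
      · rw [← h] at hw
        have := D.lt_snd_of_lt_NN hI h3 hw
        omega
      · obtain ⟨u, hu, hu2⟩ := D.exists_gt_at_NN hI X
        rw [← h3] at hu
        simp only at hu
        rw [h] at hu
        have := snd_eq_of_between hI hIN h0 h1 hu
        omega
    · by_contra hle'
      obtain ⟨u, hu, hu2⟩ := D.exists_le_at_NN (by omega) hIN X
      rcases lt_or_eq_of_le (not_lt.mp hle') with h3 | h3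
      · rw [← h] at hw
        have := D.snd_le_of_mem_Theta hu hw h3
        omega
      · rw [h3] at hu
        simp only at hu
        rw [h] at hu
        have := snd_eq_of_between hI hIN h0 h1 hu
        omega
  · rintro ⟨h2, h3, h4⟩
    simp only at h2 h3 h4
    subst h2
    exact Subset.antisymm (hle _ _ h3 h4 h0 h1) (hle _ _ h0 h1 h3 h4)

/-- Two vertical edges with the same abscissa and the same power of `y` coincide. -/
lemma EdgeSupp.segment_eq {Q₀ Q₁ R₀ R₁ : ℝ × ℝ} {T T' : Set (ℕ × ℕ)} {k : ℕ}
    (h : D.EdgeSupp Q₀ Q₁ T) (h' : D.EdgeSupp R₀ R₁ T') (hQ : Q₀.1 = Q₁.1) (hR : R₀.1 = R₁.1)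
    (hQR : Q₀.1 = R₀.1) (hT : ∀ w ∈ T, w.2 = k) (hT' : ∀ w ∈ T', w.2 = k) :
    segment ℝ Q₀ Q₁ = segment ℝ R₀ R₁ := by
  have key : ∀ P P' : ℝ × ℝ, P.1 = P'.1 → (∀ w ∈ D.Theta P, w.2 = k) →
      (∀ w ∈ D.Theta P', w.2 = k) → D.Theta P ⊆ D.Theta P' := by
    rintro ⟨X, Y₁⟩ ⟨X', Y₂⟩ hX h1 h2 w hw
    simp only at hX
    subst hX
    obtain ⟨v, hv⟩ := D.Theta_nonempty (X, Y₂)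
    have e : (w.2 : ℝ) = v.2 := by rw [h1 w hw, h2 v hv]
    have hw' := D.mem_Theta.mp hw
    have hv' := D.mem_Theta.mp hv
    refine D.mem_Theta.mpr ⟨hw'.1, fun u hu => le_trans ?_ (hv'.2 u hu)⟩
    have := hw'.2 v hv'.1
    simp only [term, e] at this ⊢
    linarith
  have hx : (pt Q₀ Q₁ (1 / 2)).1 = (pt R₀ R₁ (1 / 2)).1 := by
    simp only [pt, ← hQ, ← hR, hQR]
  have hTT : T = T' := by
    have a := h.Theta_half
    have a' := h'.Theta_half
    rw [← a] at hT
    rw [← a'] at hT'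
    rw [← a, ← a']
    exact Subset.antisymm (key _ _ hx hT hT') (key _ _ hx.symm hT' hT)
  rw [← closure_openSegment, ← closure_openSegment, ← h.eq, ← h'.eq, hTT]

end VerticalEdge

end CurveData

end TropInt

end

/-! ### Rescaled coefficients and bounds for the logarithmic gradient -/

noncomputable section

namespace TropInt

lemma ePow_le {ε p q : ℝ} (hε : 0 < ε) (h : p ≤ q) : ePow ε q ≤ ePow ε p := by
  refine Real.exp_le_exp.mpr (div_le_div_of_nonneg_right (by linarith) hε.le)

lemma norm_ePow (ε q : ℝ) : ‖(ePow ε q : ℂ)‖ = ePow ε q := by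
  rw [Complex.norm_real, Real.norm_of_nonneg (ePow_pos _ _).le]

lemma ePow_ne_zero (ε q : ℝ) : (ePow ε q : ℂ) ≠ 0 :=
  Complex.ofReal_ne_zero.mpr (ePow_pos _ _).ne'

lemma ePow_pow (ε q : ℝ) (n : ℕ) : ePow ε q ^ n = ePow ε (n * q) := by
  rw [ePow, ePow, ← Real.exp_nat_mul]; congr 1; ring

lemma tendsto_ePow_complex {c : ℝ} (hc : 0 < c) :
    Tendsto (fun ε : ℝ => (ePow ε c : ℂ)) (𝓝[>] 0) (𝓝 0) := by
  have := (Complex.continuous_ofReal.tendsto _).comp (tendsto_ePow hc)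
  rwa [Complex.ofReal_zero] at this

lemma exp_eq_mul_ePow (ξ : ℂ) (ε X : ℝ) :
    Complex.exp ξ = Complex.exp (ξ + ((X / ε : ℝ) : ℂ)) * (ePow ε X : ℂ) := by
  rw [ePow, Complex.ofReal_exp, ← Complex.exp_add]
  congr 1; push_cast; ring

/-- At distance at least Kε from the vertices the factor 𝐞^{c d} is at most e^{-cK}, uniformly in ε.
This fixes the width Kε of the zones around the vertices that need separate treatment. -/
lemma exists_mul_ePow_le (C : ℝ) {c δ : ℝ} (hc : 0 < c) (hδ : 0 < δ) (hC : 0 ≤ C) :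
    ∃ K > 0, ∀ ε > 0, ∀ d, K * ε ≤ d → C * ePow ε (c * d) ≤ δ := by
  obtain ⟨K, hK, hK0⟩ : ∃ K : ℝ, C * Real.exp (-(c * K)) ≤ δ ∧ 0 < K := by
    have h1 : Tendsto (fun K : ℝ => C * Real.exp (-(c * K))) atTop (𝓝 0) := by
      have := (Real.tendsto_exp_neg_atTop_nhds_zero.comp
        (tendsto_id.const_mul_atTop hc)).const_mul C
      simpa using this
    exact (((h1.eventually_lt_const hδ).mono fun _ h => h.le).and (eventually_gt_atTop 0)).exists
  refine ⟨K, hK0, fun ε hε d hd => le_trans (mul_le_mul_of_nonneg_left ?_ hC) hK⟩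
  refine Real.exp_le_exp.mpr ?_
  rw [div_le_iff₀ hε]
  nlinarith

lemma norm_exp_le {z : ℂ} {M : ℝ} (h : ‖z‖ ≤ M) : ‖Complex.exp z‖ ≤ Real.exp M := by
  rw [Complex.norm_exp]
  exact Real.exp_le_exp.mpr ((Complex.re_le_norm z).trans h)

lemma exp_neg_le_norm_exp {z : ℂ} {M : ℝ} (h : ‖z‖ ≤ M) : Real.exp (-M) ≤ ‖Complex.exp z‖ := by
  rw [Complex.norm_exp]
  exact Real.exp_le_exp.mpr (by have := neg_abs_le z.re; have := Complex.abs_re_le_norm z; linarith)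

namespace CurveData

variable (D : CurveData)

/-! ### Polynomials with given exponents -/

lemma hasDerivAt_polySum_fst (β : ℕ × ℕ → ℂ) (x y : ℂ) :
    HasDerivAt (fun s => D.polySum β s y)
      (∑ w ∈ D.supp, β w * ((w.1 * x ^ (w.1 - 1)) * y ^ w.2)) x := by
  unfold polySum
  exact HasDerivAt.fun_sum fun w _ => ((hasDerivAt_pow w.1 x).mul_const _).const_mul _

lemma hasDerivAt_polySum_snd (β : ℕ × ℕ → ℂ) (x y : ℂ) :
    HasDerivAt (fun s => D.polySum β x s)
      (∑ w ∈ D.supp, β w * (x ^ w.1 * (w.2 * y ^ (w.2 - 1)))) y := by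
  unfold polySum
  exact HasDerivAt.fun_sum fun w _ => ((hasDerivAt_pow w.2 y).const_mul _).const_mul _

lemma mul_pow_pred (n : ℕ) (x : ℂ) : x * (n * x ^ (n - 1)) = n * x ^ n := by
  rcases n with _ | n
  · simp
  · simp [pow_succ]; ring

lemma mul_deriv_fst (β : ℕ × ℕ → ℂ) (x y : ℂ) :
    x * deriv (fun s => D.polySum β s y) x = D.polySum (fun w => w.1 * β w) x y := by
  rw [(D.hasDerivAt_polySum_fst β x y).deriv, polySum, Finset.mul_sum]
  refine Finset.sum_congr rfl fun w _ => ?_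
  linear_combination β w * y ^ w.2 * mul_pow_pred w.1 x

lemma mul_deriv_snd (β : ℕ × ℕ → ℂ) (x y : ℂ) :
    y * deriv (fun s => D.polySum β x s) y = D.polySum (fun w => w.2 * β w) x y := by
  rw [(D.hasDerivAt_polySum_snd β x y).deriv, polySum, Finset.mul_sum]
  refine Finset.sum_congr rfl fun w _ => ?_
  linear_combination β w * x ^ w.1 * mul_pow_pred w.2 y

lemma polySum_sub (β γ : ℕ × ℕ → ℂ) (x y : ℂ) :
    D.polySum β x y - D.polySum γ x y = D.polySum (fun w => β w - γ w) x y := by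
  simp only [polySum, ← Finset.sum_sub_distrib, sub_mul]

lemma polySum_congr {β γ : ℕ × ℕ → ℂ} (h : ∀ w ∈ D.supp, β w = γ w) (x y : ℂ) :
    D.polySum β x y = D.polySum γ x y :=
  Finset.sum_congr rfl fun w hw => by rw [h w hw]

/-- A bound for the monomials of `f` at points with logarithms bounded by `M`. -/
def monBound (M : ℝ) : ℝ := ∑ w ∈ D.supp, Real.exp M ^ w.1 * Real.exp M ^ w.2

lemma monBound_pos (M : ℝ) : 0 < D.monBound M :=
  Finset.sum_pos (fun _ _ => by positivity) D.supp_nonempty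

lemma norm_polySum_le {β : ℕ × ℕ → ℂ} {δ : ℝ} (h : ∀ w ∈ D.supp, ‖β w‖ ≤ δ) {M : ℝ} {x y : ℂ}
    (hx : ‖x‖ ≤ Real.exp M) (hy : ‖y‖ ≤ Real.exp M) :
    ‖D.polySum β x y‖ ≤ δ * D.monBound M := by
  rw [polySum, monBound, Finset.mul_sum]
  refine norm_sum_le_of_le _ fun w hw => ?_
  rw [norm_mul, norm_mul, norm_pow, norm_pow]
  have h0 : 0 ≤ δ := (norm_nonneg _).trans (h w hw)
  gcongr
  exact h w hw

/-- The coefficients of `f`, rescaled at the point `P`. -/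
def nb (ε : ℝ) (P : ℝ × ℝ) (w : ℕ × ℕ) : ℂ :=
  D.b ε w / (ePow ε (D.coeff w).order : ℂ) * (ePow ε (D.term w P - D.tropVal P) : ℂ)

lemma b_mul_eq (ε : ℝ) (P : ℝ × ℝ) (w : ℕ × ℕ) (x y : ℂ) :
    D.b ε w * ((x * (ePow ε P.1 : ℂ)) ^ w.1 * (y * (ePow ε P.2 : ℂ)) ^ w.2) =
      (ePow ε (D.tropVal P) : ℂ) * (D.nb ε P w * (x ^ w.1 * y ^ w.2)) := by
  have h1 : ePow ε (D.tropVal P) * ePow ε (D.term w P - D.tropVal P) =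
      ePow ε (D.coeff w).order * (ePow ε P.1 ^ w.1 * ePow ε P.2 ^ w.2) := by
    rw [ePow_pow, ePow_pow, ← ePow_add, ← ePow_add, ← ePow_add]
    congr 1; simp only [term]; ring
  have h2 : (ePow ε (D.tropVal P) : ℂ) * (ePow ε (D.term w P - D.tropVal P) : ℂ) =
      (ePow ε (D.coeff w).order : ℂ) * ((ePow ε P.1 : ℂ) ^ w.1 * (ePow ε P.2 : ℂ) ^ w.2) := by
    exact_mod_cast h1
  have h3 := ePow_ne_zero ε ((D.coeff w).order : ℝ)
  rw [nb, mul_pow, mul_pow]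
  field_simp
  linear_combination -(D.b ε w * x ^ w.1 * y ^ w.2) * h2

/-- The weights γ allow one rescaling to serve f, x f_x, y f_y and the single layers a_i(x) y^{N-i}.
-/
lemma polySum_scale (γ : ℕ × ℕ → ℂ) (ε : ℝ) (P : ℝ × ℝ) (x y : ℂ) :
    D.polySum (fun w => γ w * D.b ε w) (x * (ePow ε P.1 : ℂ)) (y * (ePow ε P.2 : ℂ)) =
      (ePow ε (D.tropVal P) : ℂ) * D.polySum (fun w => γ w * D.nb ε P w) x y := by
  rw [polySum, polySum, Finset.mul_sum]
  refine Finset.sum_congr rfl fun w _ => ?_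
  linear_combination γ w * D.b_mul_eq ε P w x y

lemma polySum_scale_exp (γ : ℕ × ℕ → ℂ) (ε : ℝ) (P : ℝ × ℝ) (ξ η : ℂ) :
    D.polySum (fun w => γ w * D.b ε w) (Complex.exp ξ) (Complex.exp η) =
      (ePow ε (D.tropVal P) : ℂ) * D.polySum (fun w => γ w * D.nb ε P w)
        (Complex.exp (ξ + ((P.1 / ε : ℝ) : ℂ))) (Complex.exp (η + ((P.2 / ε : ℝ) : ℂ))) := by
  rw [← polySum_scale, ← exp_eq_mul_ePow, ← exp_eq_mul_ePow]

lemma exists_norm_b_le : ∃ C > 0, ∀ᶠ ε in 𝓝[>] (0 : ℝ), ∀ w ∈ D.supp,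
    ‖D.b ε w / (ePow ε (D.coeff w).order : ℂ)‖ ≤ C := by
  obtain ⟨C, hC, h⟩ := exists_le_finset D.supp fun w => ‖(D.coeff w).leadingCoeff‖ + 1
  refine ⟨C, hC, (Filter.eventually_all_finset _).mpr fun w hw => ?_⟩
  filter_upwards [(D.tendsto_b hw).norm.eventually_lt_const (lt_add_one _)] with ε hε
  exact hε.le.trans (h w hw)

open Classical in
/-- The coefficients of the truncation of `f` to the exponents in `T`. -/
def lead (T : Set (ℕ × ℕ)) (w : ℕ × ℕ) : ℂ := if w ∈ T then (D.coeff w).leadingCoeff else 0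

lemma trunc_eval_lead (P : ℝ × ℝ) (x y : ℂ) :
    (D.trunc P).evalEval x y = D.polySum (D.lead (D.Theta P)) x y := by
  classical
  rw [trunc_eval]
  exact D.polySum_congr (fun w _ => by rw [lead]) x y

/-- Rescaled at P, the polynomial f converges to the truncation f^P: a non-minimal exponent carries
a positive power of 𝐞. -/
lemma tendsto_nb (P : ℝ × ℝ) {w : ℕ × ℕ} (hw : w ∈ D.supp) :
    Tendsto (fun ε => D.nb ε P w) (𝓝[>] 0) (𝓝 (D.lead (D.Theta P) w)) := by
  rw [lead]
  split_ifs with h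
  · have : ∀ ε, D.nb ε P w = D.b ε w / (ePow ε (D.coeff w).order : ℂ) := fun ε => by
      rw [nb, h.2, sub_self, ePow_zero]; simp
    simp_rw [this]
    exact D.tendsto_b hw
  · have hlt : D.tropVal P < D.term w P :=
      lt_of_le_of_ne (D.tropVal_le hw P) fun hh => h ⟨D.mem_supp.mp hw, hh.symm⟩
    have := (D.tendsto_b hw).mul (tendsto_ePow_complex (sub_pos.mpr hlt))
    rwa [mul_zero] at this

/-! ### Lower bounds for the gradient -/

/-- Non-singularity in the torus persists, uniformly on compact sets, under small changes of the
coefficients. -/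
lemma exists_gradient_bound {β₀ : ℕ × ℕ → ℂ} (hs : SmoothInTorus (D.polySum β₀)) (M : ℝ) :
    ∃ c > 0, ∃ δ > 0, ∀ β : ℕ × ℕ → ℂ, (∀ w ∈ D.supp, ‖β w - β₀ w‖ ≤ δ) →
      ∀ z ζ : ℂ, ‖z‖ ≤ M → ‖ζ‖ ≤ M → D.polySum β (Complex.exp z) (Complex.exp ζ) = 0 →
        c ≤ max ‖D.polySum (fun w => w.1 * β w) (Complex.exp z) (Complex.exp ζ)‖
          ‖D.polySum (fun w => w.2 * β w) (Complex.exp z) (Complex.exp ζ)‖ := by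
  rcases lt_or_ge M 0 with hM | hM
  · exact ⟨1, one_pos, 1, one_pos, fun β _ z ζ hz => absurd ((norm_nonneg z).trans hz)
      (not_le.mpr hM)⟩
  set Φ : (ℕ × ℕ → ℂ) → ℂ × ℂ → ℝ := fun β p =>
    ‖D.polySum β (Complex.exp p.1) (Complex.exp p.2)‖ +
    ‖D.polySum (fun w => w.1 * β w) (Complex.exp p.1) (Complex.exp p.2)‖ +
    ‖D.polySum (fun w => w.2 * β w) (Complex.exp p.1) (Complex.exp p.2)‖ with hΦ
  have hcont : Continuous (Φ β₀) := by
    simp only [hΦ, polySum]; fun_prop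
  have hK : IsCompact (Metric.closedBall (0 : ℂ) M ×ˢ Metric.closedBall (0 : ℂ) M) :=
    (isCompact_closedBall _ _).prod (isCompact_closedBall _ _)
  obtain ⟨p, -, hp⟩ := hK.exists_isMinOn ⟨(0, 0), by simp [hM]⟩ hcont.continuousOn
  have hpos : 0 < Φ β₀ p := by
    by_contra hle
    have h1 := norm_nonneg (D.polySum β₀ (Complex.exp p.1) (Complex.exp p.2))
    have h2 := norm_nonneg (D.polySum (fun w => w.1 * β₀ w) (Complex.exp p.1) (Complex.exp p.2))
    -- A zero of the sum would be a common zero of the polynomial and both logarithmic derivatives,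
    -- that is, a singular point in the torus.
    have h3 := norm_nonneg (D.polySum (fun w => w.2 * β₀ w) (Complex.exp p.1) (Complex.exp p.2))
    simp only [hΦ] at hle
    have e1 : ‖D.polySum β₀ (Complex.exp p.1) (Complex.exp p.2)‖ = 0 := by linarith
    have e2 : ‖D.polySum (fun w => w.1 * β₀ w) (Complex.exp p.1) (Complex.exp p.2)‖ = 0 := by
      linarith
    have e3 : ‖D.polySum (fun w => w.2 * β₀ w) (Complex.exp p.1) (Complex.exp p.2)‖ = 0 := by
      linarith
    rw [norm_eq_zero] at e1 e2 e3
    rw [← mul_deriv_fst] at e2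
    rw [← mul_deriv_snd] at e3
    rcases hs _ _ (Complex.exp_ne_zero p.1) (Complex.exp_ne_zero p.2) e1 with h | h
    · exact h ((mul_eq_zero.mp e2).resolve_left (Complex.exp_ne_zero _))
    · exact h ((mul_eq_zero.mp e3).resolve_left (Complex.exp_ne_zero _))
  obtain ⟨L, hL, hLw⟩ := exists_le_finset D.supp fun w => (w.1 : ℝ) + w.2 + 1
  set m := Φ β₀ p
  have hA := D.monBound_pos M
  -- The tolerance moves each of the three values by at most m/6. The first value vanishes on the
  -- perturbed curve, so the two gradient norms sum to at least m - m/2, and the larger one is at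
  -- least m/4.
  refine ⟨m / 4, by positivity, m / (6 * L * D.monBound M), by positivity, ?_⟩
  intro β hβ z ζ hz hζ h0
  have hmin : m ≤ Φ β₀ (z, ζ) := hp (by simp [hz, hζ])
  have hdiff : ∀ g : ℕ × ℕ → ℂ, (∀ w ∈ D.supp, ‖g w‖ ≤ L) →
      ‖D.polySum (fun w => g w * β₀ w) (Complex.exp z) (Complex.exp ζ)‖ ≤
        ‖D.polySum (fun w => g w * β w) (Complex.exp z) (Complex.exp ζ)‖ + m / 6 := by
    intro g hg
    have h1 : ‖D.polySum (fun w => g w * β w - g w * β₀ w) (Complex.exp z) (Complex.exp ζ)‖ ≤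
        (L * (m / (6 * L * D.monBound M))) * D.monBound M := by
      refine D.norm_polySum_le (fun w hw => ?_) (norm_exp_le hz) (norm_exp_le hζ)
      rw [← mul_sub, norm_mul]
      exact mul_le_mul (hg w hw) (hβ w hw) (norm_nonneg _) hL.le
    rw [← polySum_sub] at h1
    have h2 : (L * (m / (6 * L * D.monBound M))) * D.monBound M = m / 6 := by
      field_simp
    rw [h2] at h1
    have h3 := norm_sub_norm_le
      (D.polySum (fun w => g w * β₀ w) (Complex.exp z) (Complex.exp ζ))
      (D.polySum (fun w => g w * β w) (Complex.exp z) (Complex.exp ζ))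
    rw [norm_sub_rev] at h3
    linarith
  have d0 := hdiff (fun _ => 1) (fun w hw => by
    have := hLw w hw
    simp only [norm_one]
    have h1 : (0 : ℝ) ≤ w.1 := Nat.cast_nonneg _
    have h2 : (0 : ℝ) ≤ w.2 := Nat.cast_nonneg _
    linarith)
  have d1 := hdiff (fun w => w.1) (fun w hw => by
    have := hLw w hw
    have h2 : (0 : ℝ) ≤ w.2 := Nat.cast_nonneg _
    simp only [Complex.norm_natCast]; linarith)
  have d2 := hdiff (fun w => w.2) (fun w hw => by
    have := hLw w hw
    have h2 : (0 : ℝ) ≤ w.1 := Nat.cast_nonneg _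
    simp only [Complex.norm_natCast]; linarith)
  simp only [one_mul] at d0
  rw [h0, norm_zero] at d0
  simp only [hΦ] at hmin
  have e1 := le_max_left ‖D.polySum (fun w => w.1 * β w) (Complex.exp z) (Complex.exp ζ)‖
    ‖D.polySum (fun w => w.2 * β w) (Complex.exp z) (Complex.exp ζ)‖
  have e2 := le_max_right ‖D.polySum (fun w => w.1 * β w) (Complex.exp z) (Complex.exp ζ)‖
    ‖D.polySum (fun w => w.2 * β w) (Complex.exp z) (Complex.exp ζ)‖
  linarith

/-- The logarithms of `(e^ξ, e^η)` differ from those of `(𝐞^X, 𝐞^Y)` by at most `M`. -/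
def Near (M ε : ℝ) (P : ℝ × ℝ) (ξ η : ℂ) : Prop :=
  ‖ξ + ((P.1 / ε : ℝ) : ℂ)‖ ≤ M ∧ ‖η + ((P.2 / ε : ℝ) : ℂ)‖ ≤ M

/-- The larger one of `|x f_x|` and `|y f_y|`. -/
def grad (ε : ℝ) (x y : ℂ) : ℝ :=
  max ‖D.polySum (fun w => w.1 * D.b ε w) x y‖ ‖D.polySum (fun w => w.2 * D.b ε w) x y‖

lemma le_grad_of_nb_close {β₀ : ℕ × ℕ → ℂ} (hs : SmoothInTorus (D.polySum β₀)) (M : ℝ) :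
    ∃ c > 0, ∃ δ > 0, ∀ ε P, (∀ w ∈ D.supp, ‖D.nb ε P w - β₀ w‖ ≤ δ) →
      ∀ ξ η : ℂ, Near M ε P ξ η → D.polySum (D.b ε) (Complex.exp ξ) (Complex.exp η) = 0 →
        c * ePow ε (D.tropVal P) ≤ D.grad ε (Complex.exp ξ) (Complex.exp η) := by
  obtain ⟨c, hc, δ, hδ, h⟩ := D.exists_gradient_bound hs M
  refine ⟨c, hc, δ, hδ, fun ε P hP ξ η hn h0 => ?_⟩
  have e0 := D.polySum_scale_exp (fun _ => 1) ε P ξ η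
  simp only [one_mul] at e0
  rw [e0] at h0
  have := h _ hP _ _ hn.1 hn.2 ((mul_eq_zero.mp h0).resolve_left (ePow_ne_zero _ _))
  rw [grad, D.polySum_scale_exp (fun w => w.1) ε P, D.polySum_scale_exp (fun w => w.2) ε P,
    norm_mul, norm_mul, norm_ePow, ← mul_max_of_nonneg _ _ (ePow_pos _ _).le, mul_comm]
  exact mul_le_mul_of_nonneg_left this (ePow_pos _ _).le

variable {D}

lemma smooth_lead (htns : D.TotallyNonSingular) {P : ℝ × ℝ} (hP : P ∈ D.tropCurve) :
    SmoothInTorus (D.polySum (D.lead (D.Theta P))) := by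
  have h := htns P hP
  have e : (fun x y => (D.trunc P).evalEval x y) = D.polySum (D.lead (D.Theta P)) := by
    funext x y; exact D.trunc_eval_lead P x y
  rwa [e] at h

lemma eventually_le_grad_of_mem (htns : D.TotallyNonSingular) {P : ℝ × ℝ} (hP : P ∈ D.tropCurve)
    (M : ℝ) : ∃ c > 0, ∀ᶠ ε in 𝓝[>] (0 : ℝ), ∀ ξ η : ℂ, Near M ε P ξ η →
      D.polySum (D.b ε) (Complex.exp ξ) (Complex.exp η) = 0 →
        c * ePow ε (D.tropVal P) ≤ D.grad ε (Complex.exp ξ) (Complex.exp η) := by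
  obtain ⟨c, hc, δ, hδ, h⟩ := D.le_grad_of_nb_close (smooth_lead htns hP) M
  refine ⟨c, hc, ?_⟩
  have : ∀ᶠ ε in 𝓝[>] (0 : ℝ), ∀ w ∈ D.supp, ‖D.nb ε P w - D.lead (D.Theta P) w‖ ≤ δ := by
    refine (Filter.eventually_all_finset _).mpr fun w hw => ?_
    have h1 := (tendsto_iff_norm_sub_tendsto_zero.mp (D.tendsto_nb P hw)).eventually_lt_const hδ
    exact h1.mono fun _ h => h.le
  filter_upwards [this] with ε hε ξ η hn h0
  exact h ε P hε ξ η hn h0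

/-- `T` is minimal on the edge from `Q₀` to `Q₁`, up to the quantity `c min(s, 1 - s)`. -/
def Gap (D : CurveData) (Q₀ Q₁ : ℝ × ℝ) (T : Set (ℕ × ℕ)) (c : ℝ) : Prop :=
  ∀ s ∈ Icc (0 : ℝ) 1, ∀ w ∈ D.supp,
    (w ∈ T → D.term w (pt Q₀ Q₁ s) = D.tropVal (pt Q₀ Q₁ s)) ∧
    (w ∉ T → D.tropVal (pt Q₀ Q₁ s) + c * min s (1 - s) ≤ D.term w (pt Q₀ Q₁ s))

/-! ### Estimates uniform along an edge -/

namespace EdgeSupp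

variable {Q₀ Q₁ : ℝ × ℝ} {T : Set (ℕ × ℕ)}

lemma symm (h : D.EdgeSupp Q₀ Q₁ T) : D.EdgeSupp Q₁ Q₀ T :=
  ⟨h.ne.symm, by rw [openSegment_symm]; exact h.eq, h.nontrivial⟩

lemma tropVal_pt (h : D.EdgeSupp Q₀ Q₁ T) {s : ℝ} (hs : s ∈ Icc (0 : ℝ) 1) :
    D.tropVal (pt Q₀ Q₁ s) = (1 - s) * D.tropVal Q₀ + s * D.tropVal Q₁ := by
  obtain ⟨w, hw⟩ := h.nontrivial.nonempty
  have hm : pt Q₀ Q₁ s ∈ segment ℝ Q₀ Q₁ := by rw [segment_eq_pt]; exact mem_image_of_mem _ hs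
  rw [← (h.subset_Theta hm hw).2, term_pt, (h.subset_Theta (left_mem_segment ℝ Q₀ Q₁) hw).2,
    (h.subset_Theta (right_mem_segment ℝ Q₀ Q₁) hw).2]

/-- Within parameter distance Kε of the vertex, the rescaled logarithms relative to the vertex
itself stay bounded, so non-singularity of the truncation at the vertex applies. Val changes by O(ε)
there, and 𝐞^{Val} by a bounded factor. -/
lemma eventually_le_grad_left (h : D.EdgeSupp Q₀ Q₁ T) (htns : D.TotallyNonSingular) (M K : ℝ) :
    ∃ c > 0, ∀ᶠ ε in 𝓝[>] (0 : ℝ), ∀ s ∈ Icc (0 : ℝ) 1, s ≤ K * ε → ∀ ξ η : ℂ,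
      Near M ε (pt Q₀ Q₁ s) ξ η → D.polySum (D.b ε) (Complex.exp ξ) (Complex.exp η) = 0 →
        c * ePow ε (D.tropVal (pt Q₀ Q₁ s)) ≤ D.grad ε (Complex.exp ξ) (Complex.exp η) := by
  obtain ⟨c, hc, hev⟩ := eventually_le_grad_of_mem htns (h.mem_tropCurve (left_mem_segment ℝ Q₀ Q₁))
    (M + K * |Q₁.1 - Q₀.1| + K * |Q₁.2 - Q₀.2|)
  refine ⟨c * Real.exp (-(K * |D.tropVal Q₁ - D.tropVal Q₀|)), by positivity, ?_⟩
  filter_upwards [hev, self_mem_nhdsWithin] with ε hε hε0 s hs hsK ξ η hn h0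
  have hε0 : 0 < ε := hε0
  have hsε : s / ε ≤ K := (div_le_iff₀ hε0).mpr hsK
  have hsε0 : 0 ≤ s / ε := div_nonneg hs.1 hε0.le
  have hK : 0 ≤ K := hsε0.trans hsε
  have shift : ∀ (ζ : ℂ) (a b : ℝ), ‖ζ + ((((1 - s) * a + s * b) / ε : ℝ) : ℂ)‖ ≤ M →
      ‖ζ + ((a / ε : ℝ) : ℂ)‖ ≤ M + K * |b - a| := by
    intro ζ a b hz
    have e : ζ + ((a / ε : ℝ) : ℂ) = (ζ + ((((1 - s) * a + s * b) / ε : ℝ) : ℂ)) -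
        ((s / ε * (b - a) : ℝ) : ℂ) := by push_cast; ring
    rw [e]
    refine (norm_sub_le _ _).trans (add_le_add hz ?_)
    rw [Complex.norm_real, Real.norm_eq_abs, abs_mul, abs_of_nonneg hsε0]
    exact mul_le_mul_of_nonneg_right hsε (abs_nonneg _)
  have hn' : Near (M + K * |Q₁.1 - Q₀.1| + K * |Q₁.2 - Q₀.2|) ε Q₀ ξ η := by
    have h1 := shift ξ Q₀.1 Q₁.1 hn.1
    have h2 := shift η Q₀.2 Q₁.2 hn.2
    have h3 := mul_nonneg hK (abs_nonneg (Q₁.1 - Q₀.1))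
    have h4 := mul_nonneg hK (abs_nonneg (Q₁.2 - Q₀.2))
    exact ⟨by linarith, by linarith⟩
  refine le_trans ?_ (hε ξ η hn' h0)
  rw [mul_assoc]
  refine mul_le_mul_of_nonneg_left ?_ hc.le
  rw [ePow, ePow, ← Real.exp_add, h.tropVal_pt hs]
  refine Real.exp_le_exp.mpr ?_
  have e : -((1 - s) * D.tropVal Q₀ + s * D.tropVal Q₁) / ε =
      -D.tropVal Q₀ / ε - s / ε * (D.tropVal Q₁ - D.tropVal Q₀) := by field_simp; ring
  rw [e]
  have h5 := neg_abs_le (s / ε * (D.tropVal Q₁ - D.tropVal Q₀))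
  rw [abs_mul, abs_of_nonneg hsε0] at h5
  have h6 := mul_le_mul_of_nonneg_right hsε (abs_nonneg (D.tropVal Q₁ - D.tropVal Q₀))
  linarith

/-- Outside the Kε-zones at the ends, the truncation of the open edge approximates the rescaled f
uniformly in s, and not only pointwise as in `tendsto_nb`. -/
lemma nb_close {c : ℝ} (hc : 0 < c) (hg : D.Gap Q₀ Q₁ T c) {δ : ℝ} (hδ : 0 < δ) :
    ∃ K > 0, ∀ᶠ ε in 𝓝[>] (0 : ℝ), ∀ s ∈ Icc (0 : ℝ) 1, K * ε ≤ min s (1 - s) →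
      ∀ w ∈ D.supp, ‖D.nb ε (pt Q₀ Q₁ s) w - D.lead T w‖ ≤ δ := by
  obtain ⟨C, hC, hCb⟩ := D.exists_norm_b_le
  obtain ⟨K, hK0, hK⟩ := exists_mul_ePow_le C hc hδ hC.le
  refine ⟨K, hK0, ?_⟩
  have hT : ∀ᶠ ε in 𝓝[>] (0 : ℝ), ∀ w ∈ D.supp,
      ‖D.b ε w / (ePow ε (D.coeff w).order : ℂ) - (D.coeff w).leadingCoeff‖ ≤ δ := by
    refine (Filter.eventually_all_finset _).mpr fun w hw => ?_
    have h1 := (tendsto_iff_norm_sub_tendsto_zero.mp (D.tendsto_b hw)).eventually_lt_const hδ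
    exact h1.mono fun _ h => h.le
  filter_upwards [hCb, hT, self_mem_nhdsWithin] with ε h1 h2 hε s hs hsK w hw
  have hε : 0 < ε := hε
  rw [lead]
  split_ifs with hwT
  · rw [nb, (hg s hs w hw).1 hwT, sub_self, ePow_zero]
    simpa using h2 w hw
  · rw [sub_zero, nb, norm_mul, norm_ePow]
    refine le_trans (mul_le_mul (h1 w hw) (ePow_le hε ?_) (ePow_pos _ _).le hC.le) (hK ε hε _ hsK)
    linarith [(hg s hs w hw).2 hwT]

/-- On the curve, near an edge, the logarithmic gradient of `f` is not smaller than the largest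
monomials. -/
lemma eventually_le_grad (h : D.EdgeSupp Q₀ Q₁ T) (htns : D.TotallyNonSingular) (M : ℝ) :
    ∃ c > 0, ∀ᶠ ε in 𝓝[>] (0 : ℝ), ∀ s ∈ Icc (0 : ℝ) 1, ∀ ξ η : ℂ,
      Near M ε (pt Q₀ Q₁ s) ξ η → D.polySum (D.b ε) (Complex.exp ξ) (Complex.exp η) = 0 →
        c * ePow ε (D.tropVal (pt Q₀ Q₁ s)) ≤ D.grad ε (Complex.exp ξ) (Complex.exp η) := by
  have hs : SmoothInTorus (D.polySum (D.lead T)) := by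
    have := smooth_lead htns (h.mem_tropCurve (openSegment_subset_segment ℝ _ _
      (pt_mem_openSegment Q₀ Q₁ (s := 1 / 2) (by norm_num))))
    rwa [h.Theta_half] at this
  obtain ⟨g, hg, hgap⟩ := h.exists_gap
  obtain ⟨c, hc, δ, hδ, hcl⟩ := D.le_grad_of_nb_close hs M
  obtain ⟨K, -, hev⟩ := nb_close hg hgap hδ
  obtain ⟨c₀, hc₀, hev₀⟩ := h.eventually_le_grad_left htns M K
  obtain ⟨c₁, hc₁, hev₁⟩ := h.symm.eventually_le_grad_left htns M K
  -- Three zones: near either end the truncation at that vertex governs the gradient, in between the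
  -- truncation of the edge. The K of the middle zone fixes the width of the outer ones.
  refine ⟨min c (min c₀ c₁), by positivity, ?_⟩
  filter_upwards [hev, hev₀, hev₁] with ε e e₀ e₁ s hs ξ η hn h0
  have hE := ePow_pos ε (D.tropVal (pt Q₀ Q₁ s))
  have hflip : pt Q₁ Q₀ (1 - s) = pt Q₀ Q₁ s := by
    simp only [pt, Prod.mk.injEq]; constructor <;> ring
  rcases le_or_gt s (K * ε) with h1 | h1
  · refine le_trans (mul_le_mul_of_nonneg_right ?_ hE.le) (e₀ s hs h1 ξ η hn h0)
    exact (min_le_right _ _).trans (min_le_left _ _)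
  rcases le_or_gt (1 - s) (K * ε) with h2 | h2
  · have := e₁ (1 - s) ⟨by linarith [hs.2], by linarith [hs.1]⟩ h2 ξ η (by rwa [hflip]) h0
    rw [hflip] at this
    refine le_trans (mul_le_mul_of_nonneg_right ?_ hE.le) this
    exact (min_le_right _ _).trans (min_le_right _ _)
  · refine le_trans (mul_le_mul_of_nonneg_right (min_le_left _ _) hE.le)
      (hcl ε _ (e s hs (le_min h1.le h2.le)) ξ η hn h0)

open Classical in
/-- The terms of `f` with exponents outside `T` are small inside the edge. -/
lemma eventually_rest_le {c : ℝ} (hg : D.Gap Q₀ Q₁ T c) (M : ℝ) (γ : ℕ × ℕ → ℂ) :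
    ∃ C > 0, ∀ᶠ ε in 𝓝[>] (0 : ℝ), ∀ s ∈ Icc (0 : ℝ) 1, ∀ ξ η : ℂ,
      Near M ε (pt Q₀ Q₁ s) ξ η →
        ‖D.polySum (fun w => (if w ∈ T then 0 else γ w) * D.b ε w) (Complex.exp ξ) (Complex.exp η)‖
          ≤ C * (ePow ε (D.tropVal (pt Q₀ Q₁ s)) * ePow ε (c * min s (1 - s))) := by
  obtain ⟨C, hC, hCb⟩ := D.exists_norm_b_le
  obtain ⟨L, hL, hLw⟩ := exists_le_finset D.supp fun w => ‖γ w‖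
  have hA := D.monBound_pos M
  refine ⟨L * C * D.monBound M, by positivity, ?_⟩
  filter_upwards [hCb, self_mem_nhdsWithin] with ε h1 hε s hs ξ η hn
  rw [D.polySum_scale_exp _ ε (pt Q₀ Q₁ s), norm_mul, norm_ePow]
  have h2 := D.norm_polySum_le (β := fun w => (if w ∈ T then 0 else γ w) *
    D.nb ε (pt Q₀ Q₁ s) w) (δ := L * (C * ePow ε (c * min s (1 - s)))) (fun w hw => by
      split_ifs with hwT
      · rw [zero_mul, norm_zero]
        have := ePow_pos ε (c * min s (1 - s))
        positivity
      · rw [norm_mul, nb, norm_mul, norm_ePow]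
        refine mul_le_mul (hLw w hw) (mul_le_mul (h1 w hw) (ePow_le hε ?_) (ePow_pos _ _).le hC.le)
          (mul_nonneg (norm_nonneg _) (ePow_pos _ _).le) hL.le
        linarith [(hg s hs w hw).2 hwT]) (norm_exp_le hn.1) (norm_exp_le hn.2)
  calc _ ≤ ePow ε (D.tropVal (pt Q₀ Q₁ s)) *
        (L * (C * ePow ε (c * min s (1 - s))) * D.monBound M) :=
        mul_le_mul_of_nonneg_left h2 (ePow_pos _ _).le
    _ = _ := by ring

end EdgeSupp

/-- The upper counterpart of the gradient bound. It gives the crude estimates that suffice within Kε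
of a vertex. -/
lemma exists_grad_le (D : CurveData) (M : ℝ) : ∃ C > 0, ∀ᶠ ε in 𝓝[>] (0 : ℝ), ∀ (P : ℝ × ℝ) (ξ η : ℂ),
    Near M ε P ξ η →
      D.grad ε (Complex.exp ξ) (Complex.exp η) ≤ C * ePow ε (D.tropVal P) := by
  obtain ⟨C, hC, hCb⟩ := D.exists_norm_b_le
  obtain ⟨L, hL, hLw⟩ := exists_le_finset D.supp fun w => (w.1 : ℝ) + w.2
  have hA := D.monBound_pos M
  refine ⟨L * C * D.monBound M, by positivity, ?_⟩
  filter_upwards [hCb, self_mem_nhdsWithin] with ε h1 hε P ξ η hn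
  have key : ∀ g : ℕ × ℕ → ℂ, (∀ w ∈ D.supp, ‖g w‖ ≤ L) →
      ‖D.polySum (fun w => g w * D.b ε w) (Complex.exp ξ) (Complex.exp η)‖ ≤
        L * C * D.monBound M * ePow ε (D.tropVal P) := by
    intro g hgL
    rw [D.polySum_scale_exp _ ε P, norm_mul, norm_ePow, mul_comm]
    refine mul_le_mul_of_nonneg_right (D.norm_polySum_le (fun w hw => ?_) (norm_exp_le hn.1)
      (norm_exp_le hn.2)) (ePow_pos _ _).le
    rw [norm_mul, nb, norm_mul, norm_ePow]
    refine mul_le_mul (hgL w hw) ?_ (mul_nonneg (norm_nonneg _) (ePow_pos _ _).le) hL.le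
    have h2 : ePow ε (D.term w P - D.tropVal P) ≤ 1 := by
      rw [← ePow_zero ε]
      exact ePow_le hε (by linarith [D.tropVal_le hw P])
    calc _ ≤ C * 1 := mul_le_mul (h1 w hw) h2 (ePow_pos _ _).le hC.le
      _ = C := mul_one C
  refine max_le (key _ fun w hw => ?_) (key _ fun w hw => ?_)
  · have := hLw w hw
    have h2 : (0 : ℝ) ≤ w.2 := Nat.cast_nonneg _
    simp only [Complex.norm_natCast]; linarith
  · have := hLw w hw
    have h2 : (0 : ℝ) ≤ w.1 := Nat.cast_nonneg _
    simp only [Complex.norm_natCast]; linarith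

end CurveData

end TropInt

end

/-! ### The numerator of ω_E and the pointwise form of the integrand -/

noncomputable section

namespace TropInt

lemma ePow_sum {ι : Type*} (s : Finset ι) (ε : ℝ) (g : ι → ℝ) :
    ePow ε (∑ i ∈ s, g i) = ∏ i ∈ s, ePow ε (g i) := by
  simp only [ePow]
  rw [← Real.exp_sum, neg_div, Finset.sum_div, ← Finset.sum_neg_distrib]
  simp only [neg_div]

lemma tendsto_ePow_of_nonneg {c : ℝ} (hc : 0 ≤ c) :
    Tendsto (fun ε : ℝ => (ePow ε c : ℂ)) (𝓝[>] 0) (𝓝 (if c = 0 then 1 else 0)) := by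
  split_ifs with h
  · subst h; simp [ePow_zero]
  · exact tendsto_ePow_complex (lt_of_le_of_ne hc (Ne.symm h))

namespace CurveData

variable (D : CurveData)

/-! ### The size of the numerator of `ω_E` -/

/-- The valuation of `a_I` at `X`, computed from its factorization. -/
def rootVal (I : ℕ) (X : ℝ) : ℝ := D.A I + D.m I * X + ∑ j, min X (D.B I j)

lemma aAt_eval (ε : ℝ) (I : ℕ) (x : ℂ) : (D.aAt ε I).eval x =
    seriesVal ε (D.c I) * (ePow ε (D.A I) : ℂ) * x ^ D.m I * ∏ j, (x - D.rootAt ε I j) := by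
  simp [aAt, factored, Polynomial.eval_prod]

variable {D}

/-- Some monomial must be as large as the product of the factors. Otherwise a_I(z 𝐞^X), divided by 𝐞
to the power `rootVal`, would tend to 0 by the monomial expansion, whereas its factorization gives a
non-zero limit for generic z. -/
lemma exists_term_le_rootVal {I : ℕ} (hI : I ≤ D.N) (hc : D.c I ≠ 0) (X : ℝ) :
    ∃ w ∈ D.supp, w.2 = D.N - I ∧ ((D.coeff w).order : ℝ) + w.1 * X ≤ D.rootVal I X := by
  classical
  by_contra hcon
  push Not at hcon
  -- Avoiding 0 and the leading coefficients of the roots keeps every limiting factor non-zero, also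
  -- where X equals some B_{I,j}.
  obtain ⟨z, hz⟩ : ∃ z : ℂ, z ∉ insert 0 (Finset.univ.image fun j => (D.u I j).leadingCoeff) :=
    Infinite.exists_notMem_finset _
  simp only [Finset.mem_insert, Finset.mem_image, Finset.mem_univ, true_and, not_or,
    not_exists] at hz
  obtain ⟨hz0, hzu⟩ := hz
  have hlim0 : Tendsto (fun ε : ℝ => D.polySum (fun w => if w.2 = D.N - I then D.b ε w else 0)
      (z * (ePow ε X : ℂ)) 1 / (ePow ε (D.rootVal I X) : ℂ)) (𝓝[>] 0) (𝓝 0) := by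
    simp only [polySum, Finset.sum_div]
    rw [← Finset.sum_const_zero (s := D.supp)]
    refine tendsto_finsetSum _ fun w hw => ?_
    by_cases hw2 : w.2 = D.N - I
    · have h1 := ((D.tendsto_b hw).mul_const (z ^ w.1)).mul
        (tendsto_ePow_complex (sub_pos.mpr (hcon w hw hw2)))
      rw [mul_zero] at h1
      refine h1.congr fun ε => ?_
      rw [if_pos hw2, ePow_sub, ePow_add, ← ePow_pow, mul_pow]
      push_cast
      have h2 := ePow_ne_zero ε ((D.coeff w).order : ℝ)
      have h3 := ePow_ne_zero ε (D.rootVal I X)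
      rw [one_pow, mul_one]
      field_simp
    · simp [hw2]
  have hlim1 : Tendsto (fun ε : ℝ => (D.aAt ε I).eval (z * (ePow ε X : ℂ)) /
      (ePow ε (D.rootVal I X) : ℂ)) (𝓝[>] 0)
      (𝓝 ((D.c I).leadingCoeff * z ^ D.m I * ∏ j, (z * (if X - min X (D.B I j) = 0 then 1 else 0) -
        (D.u I j).leadingCoeff * (if D.B I j - min X (D.B I j) = 0 then 1 else 0)))) := by
    have hcu : IsUnitSeries (D.c I) := (D.c_unit I hI).resolve_left hc
    have hprod := tendsto_finsetProd (Finset.univ : Finset (Fin (D.d I))) fun j _ =>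
      ((tendsto_ePow_of_nonneg (sub_nonneg.mpr (min_le_left X (D.B I j)))).const_mul z).sub
        ((D.u_unit I hI j).tendsto.mul
          (tendsto_ePow_of_nonneg (sub_nonneg.mpr (min_le_right X (D.B I j)))))
    refine ((hcu.tendsto.mul_const (z ^ D.m I)).mul hprod).congr fun ε => ?_
    rw [aAt_eval, rootVal, ePow_add, ePow_add, ePow_sum, ← ePow_pow, mul_pow]
    have hfac : ∀ j, z * (ePow ε X : ℂ) - D.rootAt ε I j = (ePow ε (min X (D.B I j)) : ℂ) *
        (z * (ePow ε (X - min X (D.B I j)) : ℂ) -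
          seriesVal ε (D.u I j) * (ePow ε (D.B I j - min X (D.B I j)) : ℂ)) := by
      intro j
      rw [rootAt, ePow_sub, ePow_sub]
      push_cast
      have := ePow_ne_zero ε (min X (D.B I j))
      field_simp
    rw [Finset.prod_congr rfl fun j _ => hfac j, Finset.prod_mul_distrib]
    push_cast
    have h1 := ePow_ne_zero ε (D.A I)
    have h2 := ePow_ne_zero ε X
    have h3 : ∏ j, (ePow ε (min X (D.B I j)) : ℂ) ≠ 0 :=
      Finset.prod_ne_zero_iff.mpr fun j _ => ePow_ne_zero _ _
    field_simp
  have heq := tendsto_nhds_unique (hlim1.congr' (by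
    filter_upwards [D.eventually_aAt_eval] with ε hε
    rw [← hε I hI (z * (ePow ε X : ℂ)) 1, one_pow, mul_one])) hlim0
  have hcu : IsUnitSeries (D.c I) := (D.c_unit I hI).resolve_left hc
  refine mul_ne_zero (mul_ne_zero hcu.leadingCoeff_ne (pow_ne_zero _ hz0))
    (Finset.prod_ne_zero_iff.mpr fun j _ => ?_) heq
  rcases lt_trichotomy X (D.B I j) with h | h | h
  · rw [min_eq_left h.le, if_pos (sub_self _), if_neg (sub_pos.mpr h).ne']
    simpa using hz0
  · rw [← h, min_self, if_pos (sub_self _)]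
    simpa [sub_eq_zero] using fun h => hzu j h.symm
  · rw [min_eq_right h.le, if_pos (sub_self _), if_neg (sub_pos.mpr h).ne']
    simpa using (D.u_unit I hI j).leadingCoeff_ne

variable (D) in
/-- The numerator `φ(x) x y^{N-I}` of `ω_E` in logarithmic coordinates. -/
def num (ε : ℝ) (I : ℕ) (j₀ : Fin (D.d I)) (x y : ℂ) : ℂ := D.phi ε I j₀ x * x * y ^ (D.N - I)

lemma IsUnitSeries_norm_le {p : Series} (hp : IsUnitSeries p) :
    ∃ C > 0, ∀ᶠ ε in 𝓝[>] (0 : ℝ), ‖seriesVal ε p‖ ≤ C :=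
  ⟨‖p.leadingCoeff‖ + 1, by positivity,
    (hp.tendsto.norm.eventually_lt_const (lt_add_one _)).mono fun _ h => h.le⟩

/-- In the numerator the factor x - r of a_I is replaced by x, which is no larger tropically because
X ≥ min(X, B). So the numerator is dominated by a single monomial of a_I y^{N-I}. -/
lemma exists_num_le {I : ℕ} (hI : I ≤ D.N) (hc : D.c I ≠ 0) (j₀ : Fin (D.d I)) (M : ℝ) :
    ∃ C > 0, ∀ᶠ ε in 𝓝[>] (0 : ℝ), ∀ (P : ℝ × ℝ) (ξ η : ℂ), Near M ε P ξ η →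
      ∃ w ∈ D.supp, w.2 = D.N - I ∧
        ‖D.num ε I j₀ (Complex.exp ξ) (Complex.exp η)‖ ≤ C * ePow ε (D.term w P) := by
  obtain ⟨Cc, hCc, hc'⟩ := IsUnitSeries_norm_le ((D.c_unit I hI).resolve_left hc)
  choose Cu hCu hu using fun j => IsUnitSeries_norm_le (D.u_unit I hI j)
  refine ⟨‖(2 * Real.pi * Complex.I : ℂ)⁻¹‖ * Cc * Real.exp M ^ D.m I *
    (∏ j ∈ Finset.univ.erase j₀, (Real.exp M + Cu j)) * Real.exp M * Real.exp M ^ (D.N - I), ?_, ?_⟩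
  · have : (2 * Real.pi * Complex.I : ℂ) ≠ 0 := Complex.two_pi_I_ne_zero
    have h1 : 0 < ‖(2 * Real.pi * Complex.I : ℂ)⁻¹‖ := norm_pos_iff.mpr (inv_ne_zero this)
    have h2 : 0 < ∏ j ∈ Finset.univ.erase j₀, (Real.exp M + Cu j) :=
      Finset.prod_pos fun j _ => add_pos (Real.exp_pos _) (hCu j)
    exact mul_pos (mul_pos (mul_pos (by positivity) h2) (Real.exp_pos _)) (by positivity)
  filter_upwards [hc', Filter.eventually_all.mpr hu, self_mem_nhdsWithin] with ε hcε huε hε P ξ η hn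
  have hε : 0 < ε := hε
  obtain ⟨w, hw, hw2, hle⟩ := exists_term_le_rootVal hI hc P.1
  refine ⟨w, hw, hw2, ?_⟩
  have hx : ‖Complex.exp ξ‖ ≤ Real.exp M * ePow ε P.1 := by
    rw [exp_eq_mul_ePow ξ ε P.1, norm_mul, norm_ePow]
    exact mul_le_mul_of_nonneg_right (norm_exp_le hn.1) (ePow_pos _ _).le
  have hy : ‖Complex.exp η‖ ≤ Real.exp M * ePow ε P.2 := by
    rw [exp_eq_mul_ePow η ε P.2, norm_mul, norm_ePow]
    exact mul_le_mul_of_nonneg_right (norm_exp_le hn.2) (ePow_pos _ _).le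
  have hfac : ∀ j, ‖Complex.exp ξ - D.rootAt ε I j‖ ≤
      (Real.exp M + Cu j) * ePow ε (min P.1 (D.B I j)) := by
    intro j
    refine (norm_sub_le _ _).trans ?_
    rw [rootAt, norm_mul, norm_ePow, add_mul]
    refine add_le_add (hx.trans ?_) ?_
    · exact mul_le_mul_of_nonneg_left (ePow_le hε (min_le_left _ _)) (Real.exp_pos _).le
    · exact mul_le_mul (huε j) (ePow_le hε (min_le_right _ _)) (ePow_pos _ _).le (hCu j).le
  have hexp : D.A I + D.m I * P.1 + ∑ j ∈ Finset.univ.erase j₀, min P.1 (D.B I j : ℝ) + P.1 +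
      (D.N - I : ℕ) * P.2 ≥ D.term w P := by
    have h1 := Finset.add_sum_erase Finset.univ (fun j => min P.1 (D.B I j : ℝ))
      (Finset.mem_univ j₀)
    have h2 := min_le_left P.1 (D.B I j₀ : ℝ)
    simp only [rootVal] at hle
    simp only [term, hw2]
    linarith
  have hE : ePow ε (D.A I) * ePow ε P.1 ^ D.m I *
      (∏ j ∈ Finset.univ.erase j₀, ePow ε (min P.1 (D.B I j))) * ePow ε P.1 *
      ePow ε P.2 ^ (D.N - I) ≤ ePow ε (D.term w P) := by
    rw [ePow_pow, ePow_pow, ← ePow_sum, ← ePow_add, ← ePow_add, ← ePow_add, ← ePow_add]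
    exact ePow_le hε hexp
  rw [num, phi]
  simp only [norm_mul, norm_neg, norm_pow, norm_prod, norm_ePow]
  calc _ ≤ ‖(2 * Real.pi * Complex.I : ℂ)⁻¹‖ * (Cc * ePow ε (D.A I)) *
        (Real.exp M * ePow ε P.1) ^ D.m I *
        (∏ j ∈ Finset.univ.erase j₀, ((Real.exp M + Cu j) * ePow ε (min P.1 (D.B I j)))) *
        (Real.exp M * ePow ε P.1) * (Real.exp M * ePow ε P.2) ^ (D.N - I) := by
        simp only [norm_inv, norm_mul]
        have p1 := ePow_pos ε (D.A I)
        have p2 := ePow_pos ε P.1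
        have p3 := ePow_pos ε P.2
        have hpr : ∏ j ∈ Finset.univ.erase j₀, ‖Complex.exp ξ - D.rootAt ε I j‖ ≤
            ∏ j ∈ Finset.univ.erase j₀, ((Real.exp M + Cu j) * ePow ε (min P.1 (D.B I j))) :=
          Finset.prod_le_prod (fun _ _ => norm_nonneg _) fun j _ => hfac j
        have hpr0 : 0 ≤ ∏ j ∈ Finset.univ.erase j₀, ‖Complex.exp ξ - D.rootAt ε I j‖ :=
          Finset.prod_nonneg fun _ _ => norm_nonneg _
        have hpr1 := hpr0.trans hpr
        gcongr
    _ = ‖(2 * Real.pi * Complex.I : ℂ)⁻¹‖ * Cc * Real.exp M ^ D.m I *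
        (∏ j ∈ Finset.univ.erase j₀, (Real.exp M + Cu j)) * Real.exp M * Real.exp M ^ (D.N - I) *
        (ePow ε (D.A I) * ePow ε P.1 ^ D.m I *
      (∏ j ∈ Finset.univ.erase j₀, ePow ε (min P.1 (D.B I j))) * ePow ε P.1 *
      ePow ε P.2 ^ (D.N - I)) := by
        rw [Finset.prod_mul_distrib, mul_pow, mul_pow]; ring
    _ ≤ _ := by
        refine mul_le_mul_of_nonneg_left hE ?_
        have h2 : 0 < ∏ j ∈ Finset.univ.erase j₀, (Real.exp M + Cu j) :=
          Finset.prod_pos fun j _ => add_pos (Real.exp_pos _) (hCu j)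
        positivity

/-! ### Integration along a path -/

/-- On a tangent vector of the curve, `ω_E` is the multiple of `η' , ξ'` given by an approximate
expression of its numerator through `x f_x` and `y f_y`. -/
lemma norm_omega_sub_le {ε : ℝ} {I : ℕ} (hIN : I + 1 ≤ D.N) (j₀ : Fin (D.d I))
    (hf : ∀ x y : ℂ, D.fAt ε x y = D.polySum (D.b ε) x y) {x y ξ' η' α β : ℂ} (hx : x ≠ 0)
    (hy : y ≠ 0) (htan : D.polySum (fun w => w.1 * D.b ε w) x y * ξ' +
      D.polySum (fun w => w.2 * D.b ε w) x y * η' = 0) {δ m S : ℝ} (hm : 0 < m)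
    (hgrad : m ≤ D.grad ε x y) (hξ : ‖ξ'‖ ≤ S) (hη : ‖η'‖ ≤ S)
    (hG : ‖D.num ε I j₀ x y - α * D.polySum (fun w => w.1 * D.b ε w) x y -
      β * D.polySum (fun w => w.2 * D.b ε w) x y‖ ≤ δ) :
    ‖D.omega ε I j₀ x y (x * ξ') (y * η') + α * η' - β * ξ'‖ ≤ δ * (S / m) := by
  have ex := D.mul_deriv_fst (D.b ε) x y
  have ey := D.mul_deriv_snd (D.b ε) x y
  have hN : D.N - I = D.N - I - 1 + 1 := by omega
  have hfx : (fun s => D.fAt ε s y) = fun s => D.polySum (D.b ε) s y := by funext s; exact hf s y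
  have hfy : (fun s => D.fAt ε x s) = fun s => D.polySum (D.b ε) x s := by funext s; exact hf x s
  rw [omega, hfx, hfy]
  rw [grad] at hgrad
  rw [← ex, ← ey] at htan hG hgrad
  set fx := deriv (fun s => D.polySum (D.b ε) s y) x
  set fy := deriv (fun s => D.polySum (D.b ε) x s) y
  have hnum : D.num ε I j₀ x y = D.phi ε I j₀ x * x * (y ^ (D.N - I - 1) * y) := by
    rw [num]; conv_lhs => rw [hN, pow_succ]
  -- Tangency makes (ξ', η') a multiple l of (y f_y, -x f_x). Expressed through l, both branches in
  -- the definition of `omega` become `num * l`.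
  obtain ⟨l, h1, h2, h3⟩ : ∃ l : ℂ, ξ' = l * (y * fy) ∧ η' = -(l * (x * fx)) ∧
      (D.phi ε I j₀ x * y ^ (D.N - I - 1) *
        if fy ≠ 0 then x * ξ' / fy else -(y * η' / fx)) = D.num ε I j₀ x y * l := by
    by_cases h0 : fy = 0
    · have hfx0 : fx ≠ 0 := by
        rintro h
        rw [h0, h] at hgrad
        simp at hgrad
        linarith
      have hξ0 : ξ' = 0 := by
        rw [h0] at htan
        simpa [hx, hfx0] using htan
      refine ⟨-(η' / (x * fx)), by simp [hξ0, h0], by field_simp, ?_⟩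
      rw [if_neg (by simpa using h0), hnum]
      field_simp
    · refine ⟨ξ' / (y * fy), by field_simp, ?_, ?_⟩
      · field_simp
        linear_combination htan
      · rw [if_pos h0, hnum]
        field_simp
  rw [h3]
  -- Multiplying l by x f_x and y f_y gives ∓η' and ξ', both at most S, while one of the two
  -- derivatives is at least m in norm.
  have hl : ‖l‖ ≤ S / m := by
    rw [le_div_iff₀ hm]
    refine (mul_le_mul_of_nonneg_left hgrad (norm_nonneg _)).trans ?_
    rw [mul_max_of_nonneg _ _ (norm_nonneg _), ← norm_mul, ← norm_mul]
    refine max_le ?_ ?_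
    · rw [h2, norm_neg] at hη; exact hη
    · rw [h1] at hξ; exact hξ
  have e : D.num ε I j₀ x y * l + α * η' - β * ξ' =
      (D.num ε I j₀ x y - α * (x * fx) - β * (y * fy)) * l := by rw [h1, h2]; ring
  rw [e, norm_mul]
  exact mul_le_mul hG hl (norm_nonneg _) ((norm_nonneg _).trans hG)

lemma hasDerivAt_exp_pow {ξ : ℝ → ℂ} {t : ℝ} {ξ' : ℂ} (h : HasDerivAt ξ ξ' t) (n : ℕ) :
    HasDerivAt (fun s => Complex.exp (ξ s) ^ n) (n * Complex.exp (ξ t) ^ n * ξ') t := by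
  have h1 := (h.const_mul (n : ℂ)).cexp
  simp only [Complex.exp_nat_mul] at h1
  exact h1.congr_deriv (by ring)

lemma tangent_eq_zero {β : ℕ × ℕ → ℂ} {ξ η : ℝ → ℂ} {ξ' η' : ℂ} {t : ℝ}
    (hξ : HasDerivAt ξ ξ' t) (hη : HasDerivAt η η' t)
    (h0 : ∀ᶠ s in 𝓝 t, D.polySum β (Complex.exp (ξ s)) (Complex.exp (η s)) = 0) :
    D.polySum (fun w => w.1 * β w) (Complex.exp (ξ t)) (Complex.exp (η t)) * ξ' +
      D.polySum (fun w => w.2 * β w) (Complex.exp (ξ t)) (Complex.exp (η t)) * η' = 0 := by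
  have h1 : HasDerivAt (fun s => D.polySum β (Complex.exp (ξ s)) (Complex.exp (η s)))
      (∑ w ∈ D.supp, β w * ((w.1 * Complex.exp (ξ t) ^ w.1 * ξ') * Complex.exp (η t) ^ w.2 +
        Complex.exp (ξ t) ^ w.1 * (w.2 * Complex.exp (η t) ^ w.2 * η'))) t := by
    unfold polySum
    exact HasDerivAt.fun_sum fun w _ =>
      ((hasDerivAt_exp_pow hξ w.1).mul (hasDerivAt_exp_pow hη w.2)).const_mul _
  have h2 : HasDerivAt (fun s => D.polySum β (Complex.exp (ξ s)) (Complex.exp (η s))) 0 t :=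
    (hasDerivAt_const t (0 : ℂ)).congr_of_eventuallyEq h0
  rw [← h1.unique h2, polySum, polySum, Finset.sum_mul, Finset.sum_mul, ← Finset.sum_add_distrib]
  exact Finset.sum_congr rfl fun w _ => by ring

/-- The case distinction in `omega` hides its continuity; measurability together with domination is
enough for integrability. -/
lemma measurable_omega {ε : ℝ} {I : ℕ} (j₀ : Fin (D.d I))
    (hf : ∀ x y : ℂ, D.fAt ε x y = D.polySum (D.b ε) x y) {x y v w : ℝ → ℂ}
    (hx : Measurable x) (hy : Measurable y) (hv : Measurable v) (hw : Measurable w) :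
    Measurable fun t => D.omega ε I j₀ (x t) (y t) (v t) (w t) := by
  have hfx : ∀ a b : ℂ, deriv (fun s => D.fAt ε s b) a =
      ∑ w ∈ D.supp, D.b ε w * ((w.1 * a ^ (w.1 - 1)) * b ^ w.2) := fun a b => by
    have : (fun s => D.fAt ε s b) = fun s => D.polySum (D.b ε) s b := by funext s; exact hf s b
    rw [this, (D.hasDerivAt_polySum_fst _ _ _).deriv]
  have hfy : ∀ a b : ℂ, deriv (fun s => D.fAt ε a s) b =
      ∑ w ∈ D.supp, D.b ε w * (a ^ w.1 * (w.2 * b ^ (w.2 - 1))) := fun a b => by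
    have : (fun s => D.fAt ε a s) = fun s => D.polySum (D.b ε) a s := by funext s; exact hf a s
    rw [this, (D.hasDerivAt_polySum_snd _ _ _).deriv]
  simp only [omega, hfx, hfy]
  have m1 : Measurable fun t => ∑ w ∈ D.supp, D.b ε w * ((w.1 * x t ^ (w.1 - 1)) * y t ^ w.2) := by
    fun_prop
  have m2 : Measurable fun t => ∑ w ∈ D.supp, D.b ε w * (x t ^ w.1 * (w.2 * y t ^ (w.2 - 1))) := by
    fun_prop
  have m3 : Measurable fun t => D.phi ε I j₀ (x t) := by
    unfold phi; fun_prop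
  refine (m3.mul (hy.pow_const _)).mul (Measurable.ite ?_ (hv.div m2) (hw.div m1).neg)
  exact (m2 (measurableSet_singleton 0)).compl

/-- The source of the error O(1) over a whole edge: the integrand is at most the sum of two
exponentials decaying from the two ends, each of integral at most 1/c. -/
lemma integral_ePow_min_le {c ε : ℝ} (hc : 0 < c) (hε : 0 < ε) :
    ∫ t in (0 : ℝ)..1, ePow ε (c * min t (1 - t)) / ε ≤ 2 / c := by
  have hle : ∫ t in (0 : ℝ)..1, ePow ε (c * min t (1 - t)) / ε ≤
      ∫ t in (0 : ℝ)..1, (Real.exp (-(c * t) / ε) / ε + Real.exp (-(c * (1 - t)) / ε) / ε) := by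
    refine intervalIntegral.integral_mono_on zero_le_one ?_ ?_ fun t _ => ?_
    · refine Continuous.intervalIntegrable ?_ _ _
      unfold ePow; fun_prop
    · refine Continuous.intervalIntegrable ?_ _ _
      fun_prop
    · rcases min_choice t (1 - t) with h | h
      · rw [h, ePow]
        have : 0 ≤ Real.exp (-(c * (1 - t)) / ε) / ε := by positivity
        linarith
      · rw [h, ePow]
        have : 0 ≤ Real.exp (-(c * t) / ε) / ε := by positivity
        linarith
  refine hle.trans ?_
  rw [intervalIntegral.integral_eq_sub_of_hasDerivAt
    (f := fun t => -(Real.exp (-(c * t) / ε) / c) + Real.exp (-(c * (1 - t)) / ε) / c)]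
  · have h1 := Real.exp_pos (-(c * 1) / ε)
    have h2 : 0 < Real.exp (-(c * 1) / ε) / c := by positivity
    simp only [sub_self, mul_zero, neg_zero, zero_div, Real.exp_zero, sub_zero]
    have : 2 / c = 1 / c + 1 / c := by ring
    linarith
  · intro t _
    have e1 : HasDerivAt (fun t : ℝ => -(c * t) / ε) (-(c * 1) / ε) t :=
      ((hasDerivAt_id t).const_mul c).neg.div_const ε
    have e2 : HasDerivAt (fun t : ℝ => -(c * (1 - t)) / ε) (-(c * (-1)) / ε) t :=
      (((hasDerivAt_id t).const_sub 1).const_mul c).neg.div_const ε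
    refine (((e1.exp.div_const c).neg).add (e2.exp.div_const c)).congr_deriv ?_
    field_simp
  · refine Continuous.intervalIntegrable ?_ _ _
    fun_prop

end CurveData

end TropInt

end

/-! ### From an approximation of the numerator to the integral -/

noncomputable section

namespace TropInt

namespace CurveData

variable (D : CurveData)

/-- The parameter on the edge of the point that a path reaches at the time `t`. -/
def param (s₀ s₁ t : ℝ) : ℝ := (1 - t) * s₀ + t * s₁

lemma param_mem {s₀ s₁ t : ℝ} (h₀ : s₀ ∈ Icc (0 : ℝ) 1) (h₁ : s₁ ∈ Icc (0 : ℝ) 1)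
    (ht : t ∈ Icc (0 : ℝ) 1) : param s₀ s₁ t ∈ Icc (0 : ℝ) 1 := by
  obtain ⟨a, b⟩ := h₀
  obtain ⟨c, d⟩ := h₁
  obtain ⟨e, f⟩ := ht
  constructor
  · unfold param; nlinarith [mul_nonneg (sub_nonneg.mpr f) a, mul_nonneg e c]
  · unfold param; nlinarith [mul_nonneg (sub_nonneg.mpr f) (sub_nonneg.mpr b),
      mul_nonneg e (sub_nonneg.mpr d)]

/-- The distance of `s` from the end points of the unit interval. -/
def edgeDist (s : ℝ) : ℝ := min s (1 - s)

lemma edgeDist_nonneg {s : ℝ} (hs : s ∈ Icc (0 : ℝ) 1) : 0 ≤ edgeDist s :=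
  le_min hs.1 (sub_nonneg.mpr hs.2)

/-- `φ(x) x y^{N-I} = α x f_x + β y f_y` on the path, up to an error that decays exponentially with
the distance from the end points of the edge. -/
def NumApprox (I : ℕ) (j₀ : Fin (D.d I)) (Q₀ Q₁ : ℝ × ℝ) (s₀ s₁ : ℝ) (α β : ℂ)
    (ξ η : ℝ → ℝ → ℂ) (K : ℝ) : Prop :=
  ∃ C > 0, ∃ c > 0, ∀ᶠ ε in 𝓝[>] (0 : ℝ), ∀ t ∈ Icc (0 : ℝ) 1,
    K * ε ≤ edgeDist (param s₀ s₁ t) →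
      ‖D.num ε I j₀ (Complex.exp (ξ ε t)) (Complex.exp (η ε t)) -
        α * D.polySum (fun w => w.1 * D.b ε w) (Complex.exp (ξ ε t)) (Complex.exp (η ε t)) -
        β * D.polySum (fun w => w.2 * D.b ε w) (Complex.exp (ξ ε t)) (Complex.exp (η ε t))‖ ≤
      C * (ePow ε (D.tropVal (pt Q₀ Q₁ (param s₀ s₁ t))) *
        ePow ε (c * edgeDist (param s₀ s₁ t)))

/-- The properties of a path along an edge, without reference to a cylinder. -/
def PathNear (Q₀ Q₁ : ℝ × ℝ) (s₀ s₁ M : ℝ) (ξ η : ℝ → ℝ → ℂ) : Prop :=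
  ∀ᶠ ε : ℝ in 𝓝[>] 0, ContDiff ℝ 1 (ξ ε) ∧ ContDiff ℝ 1 (η ε) ∧ ∀ t ∈ Icc (0 : ℝ) 1,
    D.polySum (D.b ε) (Complex.exp (ξ ε t)) (Complex.exp (η ε t)) = 0 ∧
    Near M ε (pt Q₀ Q₁ (param s₀ s₁ t)) (ξ ε t) (η ε t) ∧
    ‖deriv (ξ ε) t‖ ≤ M / ε ∧ ‖deriv (η ε) t‖ ≤ M / ε

variable {D}

lemma RunsAlong.exists_pathNear {g : Polynomial (Polynomial ℂ)} {Q₀ Q₁ : ℝ × ℝ} {s₀ s₁ : ℝ}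
    {ξ η : ℝ → ℝ → ℂ} (h : D.RunsAlong g (pt Q₀ Q₁ s₀) (pt Q₀ Q₁ s₁) ξ η) :
    ∃ M, D.PathNear Q₀ Q₁ s₀ s₁ M ξ η := by
  obtain ⟨⟨M, hM⟩, -⟩ := h
  refine ⟨M, ?_⟩
  filter_upwards [hM, D.eventually_fAt] with ε ⟨h1, h2, h3⟩ hf
  refine ⟨h1, h2, fun t ht => ?_⟩
  obtain ⟨a, b, c, d, e⟩ := h3 t ht
  refine ⟨by rw [← hf]; exact a, ?_, d, e⟩
  rw [param, ← pt_pt]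
  exact ⟨b, c⟩

variable {Q₀ Q₁ : ℝ × ℝ} {T : Set (ℕ × ℕ)} {I : ℕ} {j₀ : Fin (D.d I)} {s₀ s₁ : ℝ} {α β : ℂ}
  {ξ η : ℝ → ℝ → ℂ} {K M : ℝ}

/-- The restriction on the distance from the end points in `NumApprox` can be dropped. -/
lemma NumApprox.of_le (hIN : I ≤ D.N) (hc : D.c I ≠ 0)
    (hp : D.PathNear Q₀ Q₁ s₀ s₁ M ξ η)
    (h : D.NumApprox I j₀ Q₀ Q₁ s₀ s₁ α β ξ η K) : D.NumApprox I j₀ Q₀ Q₁ s₀ s₁ α β ξ η 0 := by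
  obtain ⟨C, hC, c, hc0, hev⟩ := h
  obtain ⟨Cn, hCn, hn⟩ := exists_num_le hIN hc j₀ M
  obtain ⟨Cg, hCg, hg⟩ := exists_grad_le D M
  refine ⟨max C ((Cn + ‖α‖ * Cg + ‖β‖ * Cg) * Real.exp (c * K)), lt_max_of_lt_left hC, c, hc0, ?_⟩
  filter_upwards [hev, hn, hg, hp, self_mem_nhdsWithin] with ε e1 e2 e3 e4 hε t ht _
  have hε : 0 < ε := hε
  have hE := ePow_pos ε (D.tropVal (pt Q₀ Q₁ (param s₀ s₁ t)))
  have hE' := ePow_pos ε (c * edgeDist (param s₀ s₁ t))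
  rcases le_or_gt (K * ε) (edgeDist (param s₀ s₁ t)) with hK | hK
  · exact (e1 t ht hK).trans (mul_le_mul_of_nonneg_right (le_max_left _ _) (by positivity))
  · obtain ⟨-, hnear, -⟩ := e4.2.2 t ht
    obtain ⟨w, hw, -, hle⟩ := e2 _ _ _ hnear
    have hgr := e3 _ _ _ hnear
    rw [grad] at hgr
    have n0 := hle.trans (mul_le_mul_of_nonneg_left (ePow_le hε (D.tropVal_le hw _)) hCn.le)
    have n1 := mul_le_mul_of_nonneg_left ((le_max_left _ _).trans hgr) (norm_nonneg α)
    have n2 := mul_le_mul_of_nonneg_left ((le_max_right _ _).trans hgr) (norm_nonneg β)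
    rw [← norm_mul] at n1 n2
    -- Within Kε of an end the decay factor is at least e^{-cK}, so the crude bound is absorbed at
    -- the price of the constant e^{cK}.
    have h3 : 1 ≤ Real.exp (c * K) * ePow ε (c * edgeDist (param s₀ s₁ t)) := by
      rw [ePow, ← Real.exp_add, Real.one_le_exp_iff]
      have : c * edgeDist (param s₀ s₁ t) / ε ≤ c * K := by
        rw [div_le_iff₀ hε]; nlinarith
      rw [neg_div]; linarith
    refine (norm_sub_le _ _).trans ((add_le_add (norm_sub_le _ _) le_rfl).trans ?_)
    have h4 := mul_nonneg (norm_nonneg α) hCg.le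
    have h5 := mul_nonneg (norm_nonneg β) hCg.le
    calc _ ≤ (Cn + ‖α‖ * Cg + ‖β‖ * Cg) * ePow ε (D.tropVal (pt Q₀ Q₁ (param s₀ s₁ t))) * 1 := by
          linarith
      _ ≤ (Cn + ‖α‖ * Cg + ‖β‖ * Cg) * ePow ε (D.tropVal (pt Q₀ Q₁ (param s₀ s₁ t))) *
          (Real.exp (c * K) * ePow ε (c * edgeDist (param s₀ s₁ t))) :=
          mul_le_mul_of_nonneg_left h3 (by positivity)
      _ = ((Cn + ‖α‖ * Cg + ‖β‖ * Cg) * Real.exp (c * K)) *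
          (ePow ε (D.tropVal (pt Q₀ Q₁ (param s₀ s₁ t))) *
            ePow ε (c * edgeDist (param s₀ s₁ t))) := by ring
      _ ≤ _ := mul_le_mul_of_nonneg_right (le_max_right _ _) (by positivity)

open MeasureTheory in
-- The approximation turns the integrand into -αη' + βξ' plus an error. The first two terms
-- integrate exactly, and the gradient bound cancels the factor 𝐞^{Val} in the error.
lemma exists_norm_pathIntegral_le (h : D.EdgeSupp Q₀ Q₁ T) (htns : D.TotallyNonSingular)
    (hIN : I + 1 ≤ D.N) (hc : D.c I ≠ 0) (h₀ : s₀ ∈ Icc (0 : ℝ) 1)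
    (h₁ : s₁ ∈ Icc (0 : ℝ) 1) (hp : D.PathNear Q₀ Q₁ s₀ s₁ M ξ η)
    (hK : D.NumApprox I j₀ Q₀ Q₁ s₀ s₁ α β ξ η K) :
    ∃ C > 0, ∃ c > 0, ∀ᶠ ε in 𝓝[>] (0 : ℝ),
      ‖D.pathIntegral ε I j₀ (ξ ε) (η ε) + α * (η ε 1 - η ε 0) - β * (ξ ε 1 - ξ ε 0)‖ ≤
        C * ∫ t in (0 : ℝ)..1, ePow ε (c * edgeDist (param s₀ s₁ t)) / ε := by
  obtain ⟨C, hC, c, hc0, hnum⟩ := hK.of_le (by omega) hc hp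
  obtain ⟨m, hm, hgrad⟩ := h.eventually_le_grad htns M
  have hM : 0 ≤ M := by
    obtain ⟨ε, he⟩ := hp.exists
    exact (norm_nonneg _).trans (he.2.2 0 (by norm_num)).2.1.1
  refine ⟨C * (M + 1) / m, by positivity, c, hc0, ?_⟩
  filter_upwards [hnum, hgrad, hp, D.eventually_fAt, self_mem_nhdsWithin] with ε e1 e2 e3 hf hε
  have hε : 0 < ε := hε
  obtain ⟨hξ, hη, e4⟩ := e3
  have dξ : ∀ t, HasDerivAt (ξ ε) (deriv (ξ ε) t) t := fun t =>
    ((hξ.differentiable one_ne_zero) t).hasDerivAt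
  have dη : ∀ t, HasDerivAt (η ε) (deriv (η ε) t) t := fun t =>
    ((hη.differentiable one_ne_zero) t).hasDerivAt
  have cξ : Continuous (deriv (ξ ε)) := hξ.continuous_deriv le_rfl
  have cη : Continuous (deriv (η ε)) := hη.continuous_deriv le_rfl
  set Ω : ℝ → ℂ := fun t => D.omega ε I j₀ (Complex.exp (ξ ε t)) (Complex.exp (η ε t))
    (deriv (fun s => Complex.exp (ξ ε s)) t) (deriv (fun s => Complex.exp (η ε s)) t) with hΩ
  set F : ℝ → ℂ := fun t => Ω t + α * deriv (η ε) t - β * deriv (ξ ε) t with hF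
  set bd : ℝ → ℝ := fun t => C * (M + 1) / m * (ePow ε (c * edgeDist (param s₀ s₁ t)) / ε)
  have hbound : ∀ t ∈ Ioo (0 : ℝ) 1, ‖F t‖ ≤ bd t := by
    intro t ht
    have ht' := Ioo_subset_Icc_self ht
    obtain ⟨f0, hnear, d1, d2⟩ := e4 t ht'
    have hpar := param_mem h₀ h₁ ht'
    -- The equation f = 0 is known only for times in [0, 1], so it can be differentiated only at
    -- inner times. The time t = 1 is discarded as a null set below.
    have htan := tangent_eq_zero (D := D) (β := D.b ε) (dξ t) (dη t) (by
      filter_upwards [Ioo_mem_nhds ht.1 ht.2] with s hs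
      exact (e4 s (Ioo_subset_Icc_self hs)).1)
    have hE := ePow_pos ε (D.tropVal (pt Q₀ Q₁ (param s₀ s₁ t)))
    -- M may be 0; M + 1 keeps the final constant positive.
    have hMM : M / ε ≤ (M + 1) / ε := by gcongr; linarith
    have := norm_omega_sub_le hIN j₀ hf (Complex.exp_ne_zero (ξ ε t)) (Complex.exp_ne_zero (η ε t))
      htan (mul_pos hm hE) (e2 _ hpar _ _ hnear f0) (d1.trans hMM) (d2.trans hMM)
      (e1 t ht' (by rw [zero_mul]; exact edgeDist_nonneg hpar))
    rw [← (dξ t).cexp.deriv, ← (dη t).cexp.deriv] at this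
    refine this.trans (le_of_eq ?_)
    simp only [bd]
    field_simp
  have hmeas : Measurable Ω := by
    refine measurable_omega j₀ hf ?_ ?_ (measurable_deriv _) (measurable_deriv _)
    · exact (Complex.continuous_exp.comp hξ.continuous).measurable
    · exact (Complex.continuous_exp.comp hη.continuous).measurable
  have hbdc : Continuous bd := by
    simp only [bd, ePow, edgeDist, param]; fun_prop
  have hae : ∀ᵐ t, t ∈ Ioc (0 : ℝ) 1 → ‖F t‖ ≤ bd t := by
    have : ∀ᵐ t : ℝ, t ≠ 1 := by simp [ae_iff, measure_singleton]
    filter_upwards [this] with t h1 ht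
    exact hbound t ⟨ht.1, lt_of_le_of_ne ht.2 h1⟩
  have hFm : Measurable F :=
    (hmeas.add (cη.measurable.const_mul α)).sub (cξ.measurable.const_mul β)
  have hFi : IntervalIntegrable F volume 0 1 := by
    rw [intervalIntegrable_iff_integrableOn_Ioc_of_le zero_le_one]
    refine Integrable.mono' (g := bd) ?_ hFm.aestronglyMeasurable ?_
    · exact (hbdc.integrableOn_Icc (a := 0) (b := 1)).mono_set Ioc_subset_Icc_self
    · rwa [ae_restrict_iff' measurableSet_Ioc]
  have iη : IntervalIntegrable (fun t => α * deriv (η ε) t) volume 0 1 :=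
    (cη.const_mul α).intervalIntegrable _ _
  have iξ : IntervalIntegrable (fun t => β * deriv (ξ ε) t) volume 0 1 :=
    (cξ.const_mul β).intervalIntegrable _ _
  have hΩF : Ω = fun t => F t - α * deriv (η ε) t + β * deriv (ξ ε) t := by
    funext t; simp only [hF]; ring
  have hint : D.pathIntegral ε I j₀ (ξ ε) (η ε) + α * (η ε 1 - η ε 0) - β * (ξ ε 1 - ξ ε 0) =
      ∫ t in (0 : ℝ)..1, F t := by
    have e5 : D.pathIntegral ε I j₀ (ξ ε) (η ε) = ∫ t in (0 : ℝ)..1, Ω t := rfl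
    rw [e5, hΩF, intervalIntegral.integral_add (hFi.sub iη) iξ, intervalIntegral.integral_sub hFi iη,
      intervalIntegral.integral_const_mul, intervalIntegral.integral_const_mul,
      intervalIntegral.integral_eq_sub_of_hasDerivAt (fun t _ => dη t) (cη.intervalIntegrable _ _),
      intervalIntegral.integral_eq_sub_of_hasDerivAt (fun t _ => dξ t) (cξ.intervalIntegrable _ _)]
    ring
  rw [hint, ← intervalIntegral.integral_const_mul]
  exact intervalIntegral.norm_integral_le_of_norm_le zero_le_one hae (hbdc.intervalIntegrable _ _)

/-- Approximating the numerator of `ω_E` by `α x f_x + β y f_y` along the cylinder determines the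
asymptotics of the integrals. -/
lemma integralAsymp_of_numApprox (h : D.EdgeSupp Q₀ Q₁ T) (htns : D.TotallyNonSingular)
    (hIN : I + 1 ≤ D.N) (hc : D.c I ≠ 0) {g : Polynomial (Polynomial ℂ)}
    (hK : ∀ s₀ ∈ Icc (0 : ℝ) 1, ∀ s₁ ∈ Icc (0 : ℝ) 1, 0 < s₀ + s₁ → s₀ + s₁ < 2 →
      ∀ (M : ℝ) (ξ η : ℝ → ℝ → ℂ), D.PathNear Q₀ Q₁ s₀ s₁ M ξ η →
        D.RunsAlong g (pt Q₀ Q₁ s₀) (pt Q₀ Q₁ s₁) ξ η →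
          ∃ K, D.NumApprox I j₀ Q₀ Q₁ s₀ s₁ α β ξ η K) :
    D.IntegralAsymp I j₀ Q₀ Q₁ g
      (fun P₀ P₁ ε => α * ((P₁.2 - P₀.2) / ε : ℝ) - β * ((P₁.1 - P₀.1) / ε : ℝ)) := by
  constructor
  · intro P₀ hP₀ P₁ hP₁ ξ η hr hst
    rw [openSegment_eq_pt] at hP₀ hP₁
    obtain ⟨s₀, hs₀, rfl⟩ := hP₀
    obtain ⟨s₁, hs₁, rfl⟩ := hP₁
    obtain ⟨M, hp⟩ := hr.exists_pathNear
    obtain ⟨K, hnum⟩ := hK s₀ (Ioo_subset_Icc_self hs₀) s₁ (Ioo_subset_Icc_self hs₁)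
      (add_pos hs₀.1 hs₁.1) (by linarith [hs₀.2, hs₁.2]) M ξ η hp hr
    obtain ⟨C, hC, c, hc0, hev⟩ := exists_norm_pathIntegral_le h htns hIN hc
      (Ioo_subset_Icc_self hs₀) (Ioo_subset_Icc_self hs₁) hp hnum
    rw [Asymptotics.isLittleO_one_iff]
    -- Between inner points the parameter is a convex combination of s₀ and s₁, so its distance from
    -- the ends is at least the smaller of the two distances. The error is then exponentially small.
    obtain ⟨d, hd, hdle⟩ : ∃ d > 0, ∀ t ∈ Icc (0 : ℝ) 1, d ≤ edgeDist (param s₀ s₁ t) := by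
      refine ⟨min (min s₀ (1 - s₀)) (min s₁ (1 - s₁)), ?_, ?_⟩
      · exact lt_min (lt_min hs₀.1 (sub_pos.mpr hs₀.2)) (lt_min hs₁.1 (sub_pos.mpr hs₁.2))
      · rintro t ⟨ht0, ht1⟩
        set d := min (min s₀ (1 - s₀)) (min s₁ (1 - s₁))
        have a1 : d ≤ s₀ := (min_le_left _ _).trans (min_le_left _ _)
        have a2 : d ≤ 1 - s₀ := (min_le_left _ _).trans (min_le_right _ _)
        have a3 : d ≤ s₁ := (min_le_right _ _).trans (min_le_left _ _)
        have a4 : d ≤ 1 - s₁ := (min_le_right _ _).trans (min_le_right _ _)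
        refine le_min ?_ ?_ <;> unfold param
        · nlinarith [mul_le_mul_of_nonneg_left a1 (sub_nonneg.mpr ht1),
            mul_le_mul_of_nonneg_left a3 ht0]
        · nlinarith [mul_le_mul_of_nonneg_left a2 (sub_nonneg.mpr ht1),
            mul_le_mul_of_nonneg_left a4 ht0]
    have hlim : Tendsto (fun ε : ℝ => C * (ePow ε (c * d) / ε)) (𝓝[>] 0) (𝓝 0) := by
      have hcd : 0 < c * d := mul_pos hc0 hd
      have h1 := (Real.tendsto_pow_mul_exp_neg_atTop_nhds_zero 1).comp
        (tendsto_inv_nhdsGT_zero.const_mul_atTop hcd)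
      have h2 := h1.const_mul (C / (c * d))
      rw [mul_zero] at h2
      refine h2.congr fun ε => ?_
      simp only [Function.comp, ePow, pow_one, div_eq_mul_inv, neg_mul]
      field_simp
    have hint : ∀ ε : ℝ, 0 < ε →
        ∫ t in (0 : ℝ)..1, ePow ε (c * edgeDist (param s₀ s₁ t)) / ε ≤ ePow ε (c * d) / ε := by
      intro ε hε
      have hcont : Continuous fun t => ePow ε (c * edgeDist (param s₀ s₁ t)) / ε := by
        simp only [ePow, edgeDist, param]; fun_prop
      have hmono := intervalIntegral.integral_mono_on (μ := MeasureTheory.volume)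
        (g := fun _ => ePow ε (c * d) / ε) zero_le_one
        (hcont.intervalIntegrable 0 1) intervalIntegrable_const fun t ht =>
          div_le_div_of_nonneg_right (ePow_le hε (mul_le_mul_of_nonneg_left (hdle t ht) hc0.le))
            hε.le
      simpa using hmono
    have hev' : ∀ᶠ ε in 𝓝[>] (0 : ℝ),
        ‖D.pathIntegral ε I j₀ (ξ ε) (η ε) + α * (η ε 1 - η ε 0) - β * (ξ ε 1 - ξ ε 0)‖ ≤
          C * (ePow ε (c * d) / ε) := by
      filter_upwards [hev, self_mem_nhdsWithin] with ε he hε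
      exact he.trans (mul_le_mul_of_nonneg_left (hint ε hε) hC.le)
    have hlim' := squeeze_zero_norm' hev' hlim
    -- Straightness replaces the net displacements by -(P₁ - P₀)/ε up to o(1).
    have htot := (hlim'.sub (hst.2.const_mul α)).add (hst.1.const_mul β)
    simp only [mul_zero, sub_zero, add_zero] at htot
    refine htot.congr fun ε => ?_
    ring
  · intro ξ η hr
    have hr' : D.RunsAlong g (pt Q₀ Q₁ 0) (pt Q₀ Q₁ 1) ξ η := by
      simpa [pt] using hr
    obtain ⟨M, hp⟩ := hr'.exists_pathNear
    obtain ⟨K, hnum⟩ := hK 0 (by norm_num) 1 (by norm_num) (by norm_num) (by norm_num) M ξ η hp hr'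
    obtain ⟨C, hC, c, hc0, hev⟩ := exists_norm_pathIntegral_le h htns hIN hc
      (by norm_num) (by norm_num) hp hnum
    -- The summand with 2/c bounds the integrated error. Each net displacement differs from its
    -- nominal value by at most M at either end, hence by 2M in all.
    refine Asymptotics.IsBigO.of_bound (C * (2 / c) + ‖α‖ * (2 * M) + ‖β‖ * (2 * M)) ?_
    filter_upwards [hev, hp, self_mem_nhdsWithin] with ε he hpε hε
    have hε : 0 < ε := hε
    obtain ⟨-, n0, -⟩ := hpε.2.2 0 (by norm_num)
    obtain ⟨-, n1, -⟩ := hpε.2.2 1 (by norm_num)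
    simp only [param, sub_zero, one_mul, zero_mul, add_zero, sub_self, zero_add, Near, pt] at n0 n1
    have hint : C * ∫ t in (0 : ℝ)..1, ePow ε (c * edgeDist (param 0 1 t)) / ε ≤ C * (2 / c) := by
      refine mul_le_mul_of_nonneg_left ?_ hC.le
      simpa [param, edgeDist] using integral_ePow_min_le hc0 hε
    have diff : ∀ (z : ℝ → ℂ) (a b : ℝ), ‖z 0 + ((a / ε : ℝ) : ℂ)‖ ≤ M →
        ‖z 1 + ((b / ε : ℝ) : ℂ)‖ ≤ M → ‖z 1 - z 0 + (((b - a) / ε : ℝ) : ℂ)‖ ≤ 2 * M := by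
      intro z a b ha hb
      have e : z 1 - z 0 + (((b - a) / ε : ℝ) : ℂ) =
          (z 1 + ((b / ε : ℝ) : ℂ)) - (z 0 + ((a / ε : ℝ) : ℂ)) := by push_cast; ring
      rw [e]
      exact (norm_sub_le _ _).trans (by linarith)
    have dξ := mul_le_mul_of_nonneg_left (diff (ξ ε) _ _ n0.1 n1.1) (norm_nonneg β)
    have dη := mul_le_mul_of_nonneg_left (diff (η ε) _ _ n0.2 n1.2) (norm_nonneg α)
    rw [← norm_mul] at dξ dη
    have e : D.pathIntegral ε I j₀ (ξ ε) (η ε) -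
        (α * ((Q₁.2 - Q₀.2) / ε : ℝ) - β * ((Q₁.1 - Q₀.1) / ε : ℝ)) =
        (D.pathIntegral ε I j₀ (ξ ε) (η ε) + α * (η ε 1 - η ε 0) - β * (ξ ε 1 - ξ ε 0)) -
        α * (η ε 1 - η ε 0 + (((Q₁.2 - Q₀.2) / ε : ℝ) : ℂ)) +
        β * (ξ ε 1 - ξ ε 0 + (((Q₁.1 - Q₀.1) / ε : ℝ) : ℂ)) := by ring
    rw [e, norm_one, mul_one]
    refine (norm_add_le _ _).trans (add_le_add ((norm_sub_le _ _).trans (add_le_add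
      (he.trans hint) dη)) dξ)

end CurveData

end TropInt

end

/-! ### Finding α and β: inactive edges, points far from the root, non-vertical edges -/

noncomputable section

namespace TropInt

namespace CurveData

variable {D : CurveData} {Q₀ Q₁ : ℝ × ℝ} {T : Set (ℕ × ℕ)} {I : ℕ} {j₀ : Fin (D.d I)}
  {s₀ s₁ : ℝ} {ξ η : ℝ → ℝ → ℂ} {M : ℝ}

/-! ### The numerator of `ω_E` along a path -/

variable (D) in
/-- The part `a_I(x) y^{N-I}` of `f`. -/
def layer (ε : ℝ) (I : ℕ) (x y : ℂ) : ℂ :=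
  D.polySum (fun w => if w.2 = D.N - I then D.b ε w else 0) x y

/-- The constant `-1 / (2πi)`. -/
def kap : ℂ := -(2 * Real.pi * Complex.I)⁻¹

lemma phi_mul_sub (ε : ℝ) (j₀ : Fin (D.d I)) (x : ℂ) :
    D.phi ε I j₀ x * (x - D.rootAt ε I j₀) = kap * (D.aAt ε I).eval x := by
  rw [aAt_eval, phi, kap, ← Finset.mul_prod_erase Finset.univ _ (Finset.mem_univ j₀)]
  ring

/-- This is n = κ x/(x - r) · a_I(x) y^{N-I} without the division, so that it holds at x = r as
well. -/
lemma eventually_num_mul_sub (hI : I ≤ D.N) (j₀ : Fin (D.d I)) : ∀ᶠ ε in 𝓝[>] (0 : ℝ), ∀ x y : ℂ,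
    D.num ε I j₀ x y * (x - D.rootAt ε I j₀) = kap * (x * D.layer ε I x y) := by
  filter_upwards [D.eventually_aAt_eval] with ε hε x y
  rw [layer, ← hε I hI x y, num]
  linear_combination (x * y ^ (D.N - I)) * phi_mul_sub ε j₀ x

/-- The numerator is small along edges at which `a_I(x) y^{N-I}` is not minimal. -/
lemma numApprox_inactive (h : D.EdgeSupp Q₀ Q₁ T) (hI : I ≤ D.N) (hc : D.c I ≠ 0)
    (hT : ∀ w ∈ T, w.2 ≠ D.N - I) (h₀ : s₀ ∈ Icc (0 : ℝ) 1) (h₁ : s₁ ∈ Icc (0 : ℝ) 1)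
    (hp : D.PathNear Q₀ Q₁ s₀ s₁ M ξ η) : D.NumApprox I j₀ Q₀ Q₁ s₀ s₁ 0 0 ξ η 0 := by
  obtain ⟨c, hc0, hg⟩ := h.exists_gap
  obtain ⟨C, hC, hev⟩ := exists_num_le hI hc j₀ M
  refine ⟨C, hC, c, hc0, ?_⟩
  filter_upwards [hev, hp, self_mem_nhdsWithin] with ε e1 e2 hε t ht _
  obtain ⟨-, hnear, -⟩ := e2.2.2 t ht
  obtain ⟨w, hw, hw2, hle⟩ := e1 _ _ _ hnear
  simp only [zero_mul, sub_zero]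
  refine hle.trans (mul_le_mul_of_nonneg_left ?_ hC.le)
  rw [← ePow_add]
  exact ePow_le hε ((hg _ (param_mem h₀ h₁ ht) w hw).2 fun hwT => hT w hwT hw2)

/-- Since |x| is comparable to 𝐞^X and |r| to 𝐞^B, the sign of B - X decides whether x/(x - r) is
close to 1 or to 0. The powers of 𝐞 are kept to give the rate. -/
lemma exists_norm_root_le (hI : I ≤ D.N) (j : Fin (D.d I)) (M : ℝ) :
    ∃ C > 0, ∀ᶠ ε in 𝓝[>] (0 : ℝ), ∀ (X : ℝ) (ζ : ℂ), ‖ζ + ((X / ε : ℝ) : ℂ)‖ ≤ M →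
      ‖D.rootAt ε I j‖ ≤ C * ePow ε (D.B I j - X) * ‖Complex.exp ζ‖ ∧
      ‖Complex.exp ζ‖ ≤ C * ePow ε (X - D.B I j) * ‖D.rootAt ε I j‖ := by
  have hu := D.u_unit I hI j
  have hl : 0 < ‖(D.u I j).leadingCoeff‖ := norm_pos_iff.mpr hu.leadingCoeff_ne
  set l := ‖(D.u I j).leadingCoeff‖
  refine ⟨max ((l + 1) * Real.exp M) (Real.exp M * (2 / l)), lt_max_of_lt_left (by positivity), ?_⟩
  filter_upwards [hu.tendsto.norm.eventually_lt_const (lt_add_one l),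
    hu.tendsto.norm.eventually_const_lt (half_lt_self hl)] with ε h1 h2 X ζ hζ
  have hx : ‖Complex.exp ζ‖ = ‖Complex.exp (ζ + ((X / ε : ℝ) : ℂ))‖ * ePow ε X := by
    rw [← norm_ePow ε X, ← norm_mul, ← exp_eq_mul_ePow]
  have hx1 := norm_exp_le hζ
  have hx2 := exp_neg_le_norm_exp hζ
  set z := ‖Complex.exp (ζ + ((X / ε : ℝ) : ℂ))‖
  have hr : ‖D.rootAt ε I j‖ = ‖seriesVal ε (D.u I j)‖ * ePow ε (D.B I j) := by
    rw [rootAt, norm_mul, norm_ePow]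
  set v := ‖seriesVal ε (D.u I j)‖
  have pX := ePow_pos ε X
  have pB := ePow_pos ε (D.B I j)
  have hM := Real.exp_pos M
  rw [hx, hr, ePow_sub, ePow_sub]
  constructor
  · have e1 : 1 ≤ Real.exp M * z := by
      rw [Real.exp_neg] at hx2
      calc (1 : ℝ) = Real.exp M * (Real.exp M)⁻¹ := by field_simp
        _ ≤ _ := mul_le_mul_of_nonneg_left hx2 hM.le
    calc v * ePow ε (D.B I j) ≤ (l + 1) * ePow ε (D.B I j) * 1 := by
          rw [mul_one]; exact mul_le_mul_of_nonneg_right h1.le pB.le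
      _ ≤ (l + 1) * ePow ε (D.B I j) * (Real.exp M * z) :=
          mul_le_mul_of_nonneg_left e1 (by positivity)
      _ = (l + 1) * Real.exp M * (ePow ε (D.B I j) / ePow ε X) * (z * ePow ε X) := by
          field_simp
      _ ≤ _ := by
          have hz : 0 ≤ z := norm_nonneg _
          gcongr
          exact le_max_left _ _
  · have e1 : 1 ≤ 2 / l * v := by
      rw [div_mul_eq_mul_div, le_div_iff₀ hl]; linarith
    calc z * ePow ε X ≤ Real.exp M * ePow ε X * 1 := by
          rw [mul_one]; exact mul_le_mul_of_nonneg_right hx1 pX.le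
      _ ≤ Real.exp M * ePow ε X * (2 / l * v) := mul_le_mul_of_nonneg_left e1 (by positivity)
      _ = Real.exp M * (2 / l) * (ePow ε X / ePow ε (D.B I j)) * (v * ePow ε (D.B I j)) := by
          field_simp
      _ ≤ _ := by
          have hv : 0 ≤ v := norm_nonneg _
          gcongr
          exact le_max_right _ _

open Classical in
/-- A linear combination of `f` and its parts that only involves exponents outside `T`. -/
lemma exists_combination_le (h : D.EdgeSupp Q₀ Q₁ T) (M : ℝ) (γ : ℕ × ℕ → ℂ)
    (hγ : ∀ w ∈ T, γ w = 0) (h₀ : s₀ ∈ Icc (0 : ℝ) 1) (h₁ : s₁ ∈ Icc (0 : ℝ) 1)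
    (hp : D.PathNear Q₀ Q₁ s₀ s₁ M ξ η) : ∃ C > 0, ∃ c > 0, ∀ᶠ ε in 𝓝[>] (0 : ℝ),
      ∀ t ∈ Icc (0 : ℝ) 1,
        ‖D.polySum (fun w => γ w * D.b ε w) (Complex.exp (ξ ε t)) (Complex.exp (η ε t))‖ ≤
          C * (ePow ε (D.tropVal (pt Q₀ Q₁ (param s₀ s₁ t))) *
            ePow ε (c * edgeDist (param s₀ s₁ t))) := by
  obtain ⟨c, hc0, hg⟩ := h.exists_gap
  obtain ⟨C, hC, hev⟩ := EdgeSupp.eventually_rest_le hg M γ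
  refine ⟨C, hC, c, hc0, ?_⟩
  filter_upwards [hev, hp] with ε e1 e2 t ht
  have := e1 _ (param_mem h₀ h₁ ht) _ _ (e2.2.2 t ht).2.1
  refine le_trans (le_of_eq ?_) this
  congr 1
  refine D.polySum_congr (fun w _ => ?_) _ _
  split_ifs with hw
  · rw [hγ w hw]
  · rfl

/-- Along a vertical edge with `a_I(x) y^{N-I}` minimal, `a_I(x) y^{N-I}` is small. -/
lemma exists_layer_le (h : D.EdgeSupp Q₀ Q₁ T) (hT : ∀ w ∈ T, w.2 = D.N - I)
    (h₀ : s₀ ∈ Icc (0 : ℝ) 1) (h₁ : s₁ ∈ Icc (0 : ℝ) 1)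
    (hp : D.PathNear Q₀ Q₁ s₀ s₁ M ξ η) : ∃ C > 0, ∃ c > 0, ∀ᶠ ε in 𝓝[>] (0 : ℝ),
      ∀ t ∈ Icc (0 : ℝ) 1, ‖D.layer ε I (Complex.exp (ξ ε t)) (Complex.exp (η ε t))‖ ≤
          C * (ePow ε (D.tropVal (pt Q₀ Q₁ (param s₀ s₁ t))) *
            ePow ε (c * edgeDist (param s₀ s₁ t))) := by
  -- On the curve f may be subtracted freely. Here this cancels all exponents of `T`, since they all
  -- belong to the layer a_I y^{N-I}.
  obtain ⟨C, hC, c, hc0, hev⟩ := exists_combination_le h M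
    (fun w => (if w.2 = D.N - I then 1 else 0) - 1) (fun w hw => by simp [hT w hw]) h₀ h₁ hp
  refine ⟨C, hC, c, hc0, ?_⟩
  filter_upwards [hev, hp] with ε e1 e2 t ht
  have h0 := (e2.2.2 t ht).1
  have := e1 t ht
  have e : D.layer ε I (Complex.exp (ξ ε t)) (Complex.exp (η ε t)) =
      D.polySum (fun w => ((if w.2 = D.N - I then 1 else 0) - 1) * D.b ε w)
        (Complex.exp (ξ ε t)) (Complex.exp (η ε t)) := by
    have e' : D.layer ε I (Complex.exp (ξ ε t)) (Complex.exp (η ε t)) -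
        D.polySum (D.b ε) (Complex.exp (ξ ε t)) (Complex.exp (η ε t)) = _ := D.polySum_sub _ _ _ _
    rw [h0, sub_zero] at e'
    rw [e']
    exact D.polySum_congr (fun w _ => by split_ifs <;> ring) _ _
  rwa [e]

/-- When |x/(x - r)| ≤ R, the numerator inherits the smallness of a_I(x) y^{N-I}. -/
lemma numApprox_of_far (h : D.EdgeSupp Q₀ Q₁ T) (hI : I ≤ D.N) (hT : ∀ w ∈ T, w.2 = D.N - I)
    (h₀ : s₀ ∈ Icc (0 : ℝ) 1) (h₁ : s₁ ∈ Icc (0 : ℝ) 1)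
    (hp : D.PathNear Q₀ Q₁ s₀ s₁ M ξ η) {K R : ℝ} (hR : 0 < R)
    (hfar : ∀ᶠ ε in 𝓝[>] (0 : ℝ), ∀ t ∈ Icc (0 : ℝ) 1, K * ε ≤ edgeDist (param s₀ s₁ t) →
      ‖Complex.exp (ξ ε t)‖ ≤ R * ‖Complex.exp (ξ ε t) - D.rootAt ε I j₀‖) :
    D.NumApprox I j₀ Q₀ Q₁ s₀ s₁ 0 0 ξ η K := by
  obtain ⟨C, hC, c, hc0, hev⟩ := exists_layer_le h hT h₀ h₁ hp
  refine ⟨(‖kap‖ * R + 1) * C, by positivity, c, hc0, ?_⟩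
  filter_upwards [hev, hfar, eventually_num_mul_sub hI j₀] with ε e1 e2 e3 t ht hK
  have h1 := e2 t ht hK
  have h2 := e3 (Complex.exp (ξ ε t)) (Complex.exp (η ε t))
  have h3 := e1 t ht
  set x := Complex.exp (ξ ε t) with hx
  set y := Complex.exp (η ε t)
  have hx0 : 0 < ‖x‖ := norm_pos_iff.mpr (Complex.exp_ne_zero _)
  have hd : 0 < ‖x - D.rootAt ε I j₀‖ := by
    by_contra hle
    have : ‖x - D.rootAt ε I j₀‖ = 0 := le_antisymm (not_lt.mp hle) (norm_nonneg _)
    rw [this, mul_zero] at h1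
    linarith
  simp only [zero_mul, sub_zero]
  have h4 : ‖D.num ε I j₀ x y‖ * ‖x - D.rootAt ε I j₀‖ ≤
      (‖kap‖ * R * ‖D.layer ε I x y‖) * ‖x - D.rootAt ε I j₀‖ := by
    rw [← norm_mul, h2, norm_mul, norm_mul]
    calc _ ≤ ‖kap‖ * ((R * ‖x - D.rootAt ε I j₀‖) * ‖D.layer ε I x y‖) := by gcongr
      _ = _ := by ring
  refine (le_of_mul_le_mul_right h4 hd).trans ?_
  rw [mul_assoc (‖kap‖ * R + 1)]
  have : 0 ≤ ‖kap‖ := norm_nonneg _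
  exact mul_le_mul (by linarith) h3 (norm_nonneg _) (by positivity)

lemma norm_le_two_mul_sub {x r : ℂ} (h : ‖r‖ ≤ 1 / 2 * ‖x‖) : ‖x‖ ≤ 2 * ‖x - r‖ := by
  have := norm_sub_norm_le x r
  linarith

lemma norm_le_two_mul_sub' {x r : ℂ} (h : ‖x‖ ≤ 1 / 2 * ‖r‖) : ‖r‖ ≤ 2 * ‖x - r‖ := by
  rw [norm_sub_rev]; exact norm_le_two_mul_sub h

/-- The numerator is small along vertical edges that do not lie over `B`. -/
lemma numApprox_vertical_ne (h : D.EdgeSupp Q₀ Q₁ T) (hI : I ≤ D.N) (hT : ∀ w ∈ T, w.2 = D.N - I)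
    (hv : Q₀.1 = Q₁.1) (hB : Q₀.1 ≠ D.B I j₀) (h₀ : s₀ ∈ Icc (0 : ℝ) 1) (h₁ : s₁ ∈ Icc (0 : ℝ) 1)
    (hp : D.PathNear Q₀ Q₁ s₀ s₁ M ξ η) : D.NumApprox I j₀ Q₀ Q₁ s₀ s₁ 0 0 ξ η 0 := by
  obtain ⟨C, hC, hev⟩ := exists_norm_root_le hI j₀ M
  refine numApprox_of_far h hI hT h₀ h₁ hp two_pos ?_
  have hX : ∀ s, (pt Q₀ Q₁ s).1 = Q₀.1 := fun s => by simp only [pt, ← hv]; ring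
  rcases lt_or_gt_of_ne hB with hlt | hlt
  · have hsm := ((tendsto_ePow (sub_pos.mpr hlt)).const_mul C).eventually_lt_const
      (u := 1 / 2) (by norm_num)
    filter_upwards [hev, hp, hsm] with ε e1 e2 e3 t ht _
    obtain ⟨-, hn, -⟩ := e2.2.2 t ht
    have := (e1 _ _ hn.1).1
    rw [hX] at this
    exact norm_le_two_mul_sub (this.trans (mul_le_mul_of_nonneg_right e3.le (norm_nonneg _)))
  · have hsm := ((tendsto_ePow (sub_pos.mpr hlt)).const_mul C).eventually_lt_const
      (u := 1 / 2) (by norm_num)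
    filter_upwards [hev, hp, hsm] with ε e1 e2 e3 t ht _
    obtain ⟨-, hn, -⟩ := e2.2.2 t ht
    have := (e1 _ _ hn.1).2
    rw [hX] at this
    have h4 := this.trans (mul_le_mul_of_nonneg_right e3.le (norm_nonneg _))
    have h5 := norm_le_two_mul_sub' h4
    linarith [norm_nonneg (D.rootAt ε I j₀)]

/-- Along a non-vertical edge on which `a_I(x) y^{N-I}` is minimal, this part of `f` is proportional
to `y f_y` up to a small error. -/
lemma exists_layer_sub_le {w v : ℕ × ℕ} (h : D.EdgeSupp Q₀ Q₁ {w, v}) (hw : w.2 = D.N - I)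
    (hv : v.2 ≠ w.2) (h₀ : s₀ ∈ Icc (0 : ℝ) 1) (h₁ : s₁ ∈ Icc (0 : ℝ) 1)
    (hp : D.PathNear Q₀ Q₁ s₀ s₁ M ξ η) : ∃ C > 0, ∃ c > 0, ∀ᶠ ε in 𝓝[>] (0 : ℝ),
      ∀ t ∈ Icc (0 : ℝ) 1,
        ‖D.layer ε I (Complex.exp (ξ ε t)) (Complex.exp (η ε t)) - ((w.2 : ℂ) - v.2)⁻¹ *
          D.polySum (fun w => w.2 * D.b ε w) (Complex.exp (ξ ε t)) (Complex.exp (η ε t))‖ ≤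
          C * (ePow ε (D.tropVal (pt Q₀ Q₁ (param s₀ s₁ t))) *
            ePow ε (c * edgeDist (param s₀ s₁ t))) := by
  have hne : (w.2 : ℂ) - v.2 ≠ 0 := sub_ne_zero.mpr (by exact_mod_cast hv.symm)
  -- The combination y f_y - v₂ f kills the monomial v and multiplies w by w₂ - v₂. Since f = 0 on
  -- the curve, (w₂ - v₂)⁻¹ y f_y agrees with the layer of w up to exponents outside the pair.
  obtain ⟨C, hC, c, hc0, hev⟩ := exists_combination_le h M
    (fun u => (if u.2 = D.N - I then 1 else 0) - ((w.2 : ℂ) - v.2)⁻¹ * (u.2 - v.2))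
    (fun u hu => by
      rcases hu with rfl | rfl
      · rw [if_pos hw, inv_mul_cancel₀ hne, sub_self]
      · rw [if_neg (by rw [← hw]; exact hv), sub_self, mul_zero, sub_self]) h₀ h₁ hp
  refine ⟨C, hC, c, hc0, ?_⟩
  filter_upwards [hev, hp] with ε e1 e2 t ht
  have h0 := (e2.2.2 t ht).1
  have h1 := e1 t ht
  refine le_trans (le_of_eq (congrArg _ ?_)) h1
  have e : ∀ a b : ℂ, a = b - ((w.2 : ℂ) - v.2)⁻¹ * v.2 *
      D.polySum (D.b ε) (Complex.exp (ξ ε t)) (Complex.exp (η ε t)) → a = b := by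
    intro a b hab; rw [hab, h0, mul_zero, sub_zero]
  refine e _ _ ?_
  simp only [layer, polySum, Finset.mul_sum, ← Finset.sum_sub_distrib]
  refine Finset.sum_congr rfl fun u _ => ?_
  split_ifs <;> ring

lemma exists_layer_norm_le {w v : ℕ × ℕ} (h : D.EdgeSupp Q₀ Q₁ {w, v}) (hw : w.2 = D.N - I)
    (hv : v.2 ≠ w.2) (h₀ : s₀ ∈ Icc (0 : ℝ) 1) (h₁ : s₁ ∈ Icc (0 : ℝ) 1)
    (hp : D.PathNear Q₀ Q₁ s₀ s₁ M ξ η) : ∃ C > 0, ∀ᶠ ε in 𝓝[>] (0 : ℝ), ∀ t ∈ Icc (0 : ℝ) 1,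
        ‖D.layer ε I (Complex.exp (ξ ε t)) (Complex.exp (η ε t))‖ ≤
          C * ePow ε (D.tropVal (pt Q₀ Q₁ (param s₀ s₁ t))) := by
  obtain ⟨C, hC, c, hc0, hev⟩ := exists_layer_sub_le h hw hv h₀ h₁ hp
  obtain ⟨Cg, hCg, hg⟩ := exists_grad_le D M
  refine ⟨C + ‖((w.2 : ℂ) - v.2)⁻¹‖ * Cg, by positivity, ?_⟩
  filter_upwards [hev, hg, hp, self_mem_nhdsWithin] with ε e1 e2 e3 hε t ht
  have h1 := e1 t ht
  have h2 := (le_max_right _ _).trans (e2 _ _ _ (e3.2.2 t ht).2.1)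
  have h3 := mul_le_mul_of_nonneg_left h2 (norm_nonneg ((w.2 : ℂ) - v.2)⁻¹)
  rw [← norm_mul] at h3
  have h4 : ePow ε (c * edgeDist (param s₀ s₁ t)) ≤ 1 := by
    rw [← ePow_zero ε]
    exact ePow_le hε (mul_nonneg hc0.le (edgeDist_nonneg (param_mem h₀ h₁ ht)))
  have h5 := mul_le_mul_of_nonneg_left (mul_le_mul_of_nonneg_left h4
    (ePow_pos ε (D.tropVal (pt Q₀ Q₁ (param s₀ s₁ t)))).le) hC.le
  have h6 := norm_le_norm_sub_add (D.layer ε I (Complex.exp (ξ ε t)) (Complex.exp (η ε t)))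
    (((w.2 : ℂ) - v.2)⁻¹ * D.polySum (fun w => w.2 * D.b ε w) (Complex.exp (ξ ε t))
      (Complex.exp (η ε t)))
  linarith

/-- The numerator along a non-vertical edge to the left of `B`. -/
lemma numApprox_left {w v : ℕ × ℕ} (h : D.EdgeSupp Q₀ Q₁ {w, v}) (hI : I ≤ D.N)
    (hw : w.2 = D.N - I) (hv : v.2 ≠ w.2) (hQ : Q₀.1 < Q₁.1) (hB : Q₁.1 ≤ D.B I j₀)
    (h₀ : s₀ ∈ Icc (0 : ℝ) 1) (h₁ : s₁ ∈ Icc (0 : ℝ) 1) (hp : D.PathNear Q₀ Q₁ s₀ s₁ M ξ η) :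
    ∃ K, D.NumApprox I j₀ Q₀ Q₁ s₀ s₁ 0 (kap * ((w.2 : ℂ) - v.2)⁻¹) ξ η K := by
  obtain ⟨C, hC, c, hc0, hev⟩ := exists_layer_sub_le h hw hv h₀ h₁ hp
  obtain ⟨Cl, hCl, hl⟩ := exists_layer_norm_le h hw hv h₀ h₁ hp
  obtain ⟨Cr, hCr, hr⟩ := exists_norm_root_le hI j₀ M
  have hL := sub_pos.mpr hQ
  obtain ⟨K, -, hK⟩ := exists_mul_ePow_le Cr hL (δ := 1 / 2) (by norm_num) hCr.le
  refine ⟨K, (‖kap‖ + 1) * (Cl * (2 * Cr) + C), by positivity, min c (Q₁.1 - Q₀.1),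
    lt_min hc0 hL, ?_⟩
  filter_upwards [hev, hl, hr, hp, eventually_num_mul_sub hI j₀, self_mem_nhdsWithin] with
    ε e1 e2 e3 e4 e5 hε t ht hKt
  have hε : 0 < ε := hε
  have hpar := param_mem h₀ h₁ ht
  have hd := edgeDist_nonneg hpar
  have n1 := e1 t ht
  have n2 := e2 t ht
  have n3 := (e3 _ _ (e4.2.2 t ht).2.1.1).1
  have n5 := e5 (Complex.exp (ξ ε t)) (Complex.exp (η ε t))
  have hE := ePow_pos ε (D.tropVal (pt Q₀ Q₁ (param s₀ s₁ t)))
  -- B lies at or beyond the right end, so B - X is at least the width times the relative distance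
  -- from that end. Hence r/x decays at the rate required of the error, even when B is the abscissa
  -- of the vertex.
  have hBX : (Q₁.1 - Q₀.1) * edgeDist (param s₀ s₁ t) ≤
      D.B I j₀ - (pt Q₀ Q₁ (param s₀ s₁ t)).1 := by
    have : edgeDist (param s₀ s₁ t) ≤ 1 - param s₀ s₁ t := min_le_right _ _
    simp only [pt]
    nlinarith
  have hsmall : Cr * ePow ε (D.B I j₀ - (pt Q₀ Q₁ (param s₀ s₁ t)).1) ≤
      Cr * ePow ε ((Q₁.1 - Q₀.1) * edgeDist (param s₀ s₁ t)) :=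
    mul_le_mul_of_nonneg_left (ePow_le hε hBX) hCr.le
  set d := edgeDist (param s₀ s₁ t)
  set E := ePow ε (D.tropVal (pt Q₀ Q₁ (param s₀ s₁ t)))
  set x := Complex.exp (ξ ε t) with hx
  set y := Complex.exp (η ε t)
  set r := D.rootAt ε I j₀
  set A := D.layer ε I x y
  set P := D.polySum (fun w => w.2 * D.b ε w) x y
  have hx0 : 0 < ‖x‖ := norm_pos_iff.mpr (Complex.exp_ne_zero _)
  have hr1 : ‖r‖ ≤ Cr * ePow ε ((Q₁.1 - Q₀.1) * d) * ‖x‖ :=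
    n3.trans (mul_le_mul_of_nonneg_right hsmall hx0.le)
  have hx2 : ‖x‖ ≤ 2 * ‖x - r‖ :=
    norm_le_two_mul_sub (hr1.trans (mul_le_mul_of_nonneg_right (hK ε hε d hKt) hx0.le))
  have hxr : 0 < ‖x - r‖ := by linarith
  have hxr0 : x - r ≠ 0 := norm_pos_iff.mp hxr
  have m1 : ePow ε ((Q₁.1 - Q₀.1) * d) ≤ ePow ε (min c (Q₁.1 - Q₀.1) * d) :=
    ePow_le hε (mul_le_mul_of_nonneg_right (min_le_right _ _) hd)
  have m2 : ePow ε (c * d) ≤ ePow ε (min c (Q₁.1 - Q₀.1) * d) :=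
    ePow_le hε (mul_le_mul_of_nonneg_right (min_le_left _ _) hd)
  set e := ePow ε (min c (Q₁.1 - Q₀.1) * d)
  have he : 0 < e := ePow_pos _ _
  have hratio : ‖r / (x - r)‖ ≤ 2 * Cr * e := by
    rw [norm_div, div_le_iff₀ hxr]
    calc ‖r‖ ≤ Cr * e * ‖x‖ := hr1.trans (by gcongr)
      _ ≤ Cr * e * (2 * ‖x - r‖) := by gcongr
      _ = _ := by ring
  -- x/(x - r) = 1 + r/(x - r): the first error term comes from the root, the second from replacing
  -- a_I y^{N-I} by y f_y.
  have hnum : D.num ε I j₀ x y - 0 * D.polySum (fun w => w.1 * D.b ε w) x y -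
      kap * ((w.2 : ℂ) - v.2)⁻¹ * P =
      kap * (A * (r / (x - r)) + (A - ((w.2 : ℂ) - v.2)⁻¹ * P)) := by
    have : D.num ε I j₀ x y = kap * (x * A) / (x - r) := by
      rw [eq_div_iff hxr0]; exact n5
    have hxA : kap * (x * A) / (x - r) = kap * (A * (r / (x - r)) + A) := by
      field_simp; ring
    rw [this, hxA]; ring
  rw [hnum, norm_mul]
  have k1 : ‖A * (r / (x - r))‖ ≤ Cl * E * (2 * Cr * e) := by
    rw [norm_mul]; gcongr
  have k2 : ‖A - ((w.2 : ℂ) - v.2)⁻¹ * P‖ ≤ C * (E * e) := n1.trans (by gcongr)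
  have k3 := (norm_add_le _ _).trans (add_le_add k1 k2)
  calc _ ≤ (‖kap‖ + 1) * (Cl * E * (2 * Cr * e) + C * (E * e)) :=
        mul_le_mul (by linarith) k3 (norm_nonneg _) (by positivity)
    _ = _ := by ring

/-- The numerator along a non-vertical edge to the right of `B`. -/
lemma numApprox_right {w v : ℕ × ℕ} (h : D.EdgeSupp Q₀ Q₁ {w, v}) (hI : I ≤ D.N)
    (hw : w.2 = D.N - I) (hv : v.2 ≠ w.2) (hQ : Q₀.1 < Q₁.1) (hB : D.B I j₀ ≤ Q₀.1)
    (h₀ : s₀ ∈ Icc (0 : ℝ) 1) (h₁ : s₁ ∈ Icc (0 : ℝ) 1) (hp : D.PathNear Q₀ Q₁ s₀ s₁ M ξ η) :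
    ∃ K, D.NumApprox I j₀ Q₀ Q₁ s₀ s₁ 0 0 ξ η K := by
  obtain ⟨Cl, hCl, hl⟩ := exists_layer_norm_le h hw hv h₀ h₁ hp
  obtain ⟨Cr, hCr, hr⟩ := exists_norm_root_le hI j₀ M
  have hL := sub_pos.mpr hQ
  obtain ⟨K, -, hK⟩ := exists_mul_ePow_le Cr hL (δ := 1 / 2) (by norm_num) hCr.le
  refine ⟨K, (‖kap‖ + 1) * (2 * Cr * Cl), by positivity, Q₁.1 - Q₀.1, hL, ?_⟩
  filter_upwards [hl, hr, hp, eventually_num_mul_sub hI j₀, self_mem_nhdsWithin] with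
    ε e2 e3 e4 e5 hε t ht hKt
  have hε : 0 < ε := hε
  have n2 := e2 t ht
  have n3 := (e3 _ _ (e4.2.2 t ht).2.1.1).2
  have n5 := e5 (Complex.exp (ξ ε t)) (Complex.exp (η ε t))
  have hE := ePow_pos ε (D.tropVal (pt Q₀ Q₁ (param s₀ s₁ t)))
  -- The mirror estimate: B lies at or before the left end, so now x/r decays.
  have hBX : (Q₁.1 - Q₀.1) * edgeDist (param s₀ s₁ t) ≤
      (pt Q₀ Q₁ (param s₀ s₁ t)).1 - D.B I j₀ := by
    have : edgeDist (param s₀ s₁ t) ≤ param s₀ s₁ t := min_le_left _ _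
    simp only [pt]
    nlinarith
  have hsmall : Cr * ePow ε ((pt Q₀ Q₁ (param s₀ s₁ t)).1 - D.B I j₀) ≤
      Cr * ePow ε ((Q₁.1 - Q₀.1) * edgeDist (param s₀ s₁ t)) :=
    mul_le_mul_of_nonneg_left (ePow_le hε hBX) hCr.le
  set d := edgeDist (param s₀ s₁ t)
  set E := ePow ε (D.tropVal (pt Q₀ Q₁ (param s₀ s₁ t)))
  set x := Complex.exp (ξ ε t) with hx
  set y := Complex.exp (η ε t)
  set r := D.rootAt ε I j₀
  set A := D.layer ε I x y
  have hx0 : 0 < ‖x‖ := norm_pos_iff.mpr (Complex.exp_ne_zero _)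
  have hr1 : ‖x‖ ≤ Cr * ePow ε ((Q₁.1 - Q₀.1) * d) * ‖r‖ :=
    n3.trans (mul_le_mul_of_nonneg_right hsmall (norm_nonneg _))
  have hr2 : ‖x‖ ≤ 1 / 2 * ‖r‖ :=
    hr1.trans (mul_le_mul_of_nonneg_right (hK ε hε d hKt) (norm_nonneg _))
  have hx2 : ‖r‖ ≤ 2 * ‖x - r‖ := norm_le_two_mul_sub' hr2
  have hxr : 0 < ‖x - r‖ := by linarith
  set e := ePow ε ((Q₁.1 - Q₀.1) * d)
  have he : 0 < e := ePow_pos _ _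
  simp only [zero_mul, sub_zero]
  refine le_of_mul_le_mul_right ?_ hxr
  rw [← norm_mul, n5, norm_mul, norm_mul]
  calc _ ≤ (‖kap‖ + 1) * (Cr * e * (2 * ‖x - r‖) * (Cl * E)) := by
        have : ‖x‖ ≤ Cr * e * (2 * ‖x - r‖) :=
          hr1.trans (mul_le_mul_of_nonneg_left hx2 (by positivity))
        gcongr
        linarith
    _ = _ := by ring

end CurveData

end TropInt

end

/-! ### The truncation over B and the neighbourhood of the root -/

noncomputable section

namespace TropInt

/-! ### Auxiliary facts on polynomials -/

lemma evalEval_eq_sum (p : Polynomial (Polynomial ℂ)) (x y : ℂ) :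
    p.evalEval x y = ∑ i ∈ p.support, (p.coeff i).eval x * y ^ i := by
  rw [Polynomial.evalEval, Polynomial.eval_eq_sum (x := Polynomial.C y), Polynomial.sum,
    Polynomial.eval_finsetSum]
  simp

lemma exists_norm_evalEval_le (p : Polynomial (Polynomial ℂ)) (M : ℝ) :
    ∃ C, ∀ z ζ : ℂ, ‖z‖ ≤ M → ‖ζ‖ ≤ M →
      ‖p.evalEval (Complex.exp z) (Complex.exp ζ)‖ ≤ C := by
  have hc : Continuous fun q : ℂ × ℂ => p.evalEval (Complex.exp q.1) (Complex.exp q.2) := by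
    simp only [evalEval_eq_sum]
    fun_prop
  obtain ⟨C, hC⟩ := ((isCompact_closedBall (0 : ℂ) M).prod
    (isCompact_closedBall (0 : ℂ) M)).exists_bound_of_continuousOn hc.continuousOn
  exact ⟨C, fun z ζ hz hζ => hC (z, ζ) (by simp [hz, hζ])⟩

/-- The logarithmic derivative of a factored polynomial. -/
lemma mul_eval_derivative_factored {ι : Type*} (c : ℂ) (m : ℕ) (s : Finset ι) (r : ι → ℂ) (x : ℂ)
    (hx : ∀ j ∈ s, x ≠ r j) :
    x * (Polynomial.C c * Polynomial.X ^ m *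
      ∏ j ∈ s, (Polynomial.X - Polynomial.C (r j))).derivative.eval x =
    (c * x ^ m * ∏ j ∈ s, (x - r j)) * (m + ∑ j ∈ s, x / (x - r j)) := by
  classical
  induction s using Finset.induction_on with
  | empty =>
    simp only [Finset.prod_empty, mul_one, Finset.sum_empty, add_zero,
      Polynomial.derivative_C_mul, Polynomial.derivative_X_pow, Polynomial.eval_mul,
      Polynomial.eval_C, Polynomial.eval_pow, Polynomial.eval_X]
    linear_combination c * CurveData.mul_pow_pred m x
  | insert i s hi ih =>
    have ih := ih fun j hj => hx j (Finset.mem_insert_of_mem hj)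
    have hxi := sub_ne_zero.mpr (hx i (Finset.mem_insert_self i s))
    rw [Finset.prod_insert hi, Finset.prod_insert hi, Finset.sum_insert hi,
      mul_left_comm (Polynomial.C c * Polynomial.X ^ m), Polynomial.derivative_mul]
    have he : (Polynomial.C c * Polynomial.X ^ m *
        ∏ j ∈ s, (Polynomial.X - Polynomial.C (r j))).eval x =
        c * x ^ m * ∏ j ∈ s, (x - r j) := by
      simp [Polynomial.eval_prod]
    simp only [Polynomial.derivative_sub, Polynomial.derivative_X, Polynomial.derivative_C,
      sub_zero, one_mul, Polynomial.eval_add, Polynomial.eval_mul (p := Polynomial.X - _),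
      Polynomial.eval_sub, Polynomial.eval_X, Polynomial.eval_C, he]
    have h2 : x / (x - r i) * (x - r i) = x := div_mul_cancel₀ _ hxi
    linear_combination (x - r i) * ih - (c * x ^ m * ∏ j ∈ s, (x - r j)) * h2

namespace CurveData

variable {D : CurveData} {Q₀ Q₁ : ℝ × ℝ} {T : Set (ℕ × ℕ)} {I : ℕ} {j₀ : Fin (D.d I)}
  {s₀ s₁ : ℝ} {ξ η : ℝ → ℝ → ℂ} {M : ℝ}

/-! ### Vertical edges over `B` -/

/-- Over `B`, the leading coefficient of the root `u` is a root of the truncation of `a_I`. -/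
lemma lead_eval_eq_zero (hI : I ≤ D.N) {P : ℝ × ℝ} (hP : P.1 = D.B I j₀) :
    D.polySum (fun w => (if w.2 = D.N - I then 1 else 0) * D.lead (D.Theta P) w)
      (D.u I j₀).leadingCoeff 1 = 0 := by
  -- For each small ε, u(ε) is an exact zero of the rescaled a_I because P has abscissa B. The
  -- statement is the limit of this equation.
  have h0 : ∀ᶠ ε in 𝓝[>] (0 : ℝ), D.polySum
      (fun w => (if w.2 = D.N - I then 1 else 0) * D.nb ε P w) (seriesVal ε (D.u I j₀)) 1 = 0 := by
    filter_upwards [D.eventually_aAt_eval] with ε hε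
    have h1 := hε I hI (D.rootAt ε I j₀) (1 * (ePow ε P.2 : ℂ))
    rw [aAt_eval, Finset.prod_eq_zero (Finset.mem_univ j₀) (sub_self _), mul_zero, zero_mul,
      rootAt, ← hP] at h1
    have h2 := D.polySum_scale (fun w => if w.2 = D.N - I then 1 else 0) ε P
      (seriesVal ε (D.u I j₀)) 1
    rw [D.polySum_congr (γ := fun w => if w.2 = D.N - I then D.b ε w else 0)
      (fun w _ => by split_ifs <;> simp), ← h1] at h2
    exact (mul_eq_zero.mp h2.symm).resolve_left (ePow_ne_zero _ _)
  have hlim : Tendsto (fun ε => D.polySum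
      (fun w => (if w.2 = D.N - I then 1 else 0) * D.nb ε P w) (seriesVal ε (D.u I j₀)) 1)
      (𝓝[>] 0) (𝓝 (D.polySum
        (fun w => (if w.2 = D.N - I then 1 else 0) * D.lead (D.Theta P) w)
        (D.u I j₀).leadingCoeff 1)) := by
    refine tendsto_finsetSum _ fun w hw => ?_
    exact ((D.tendsto_nb P hw).const_mul _).mul
      (((D.u_unit I hI j₀).tendsto.pow w.1).mul_const _)
  exact tendsto_nhds_unique (hlim.congr' (h0.mono fun _ h => h)) tendsto_const_nhds |>.symm ▸ rfl

/-- Over `B`, a minimal monomial of `a_I(x) y^{N-I}` is never the only one. -/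
lemma exists_ne_of_mem_Theta (hI : I ≤ D.N) {P : ℝ × ℝ} (hP : P.1 = D.B I j₀) {w : ℕ × ℕ}
    (hw : w ∈ D.Theta P) (hw2 : w.2 = D.N - I) : ∃ v ∈ D.Theta P, v.2 = D.N - I ∧ v ≠ w := by
  by_contra hcon
  push Not at hcon
  have h := lead_eval_eq_zero hI hP
  rw [polySum, Finset.sum_eq_single w] at h
  -- A single monomial with non-zero coefficient cannot vanish at the non-zero number ū.
  · rw [if_pos hw2, lead, if_pos hw] at h
    simp only [one_mul, one_pow, mul_one, mul_eq_zero] at h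
    rcases h with h | h
    · exact hw.1 (HahnSeries.leadingCoeff_eq_zero.mp h)
    · exact (D.u_unit I hI j₀).leadingCoeff_ne (eq_zero_of_pow_eq_zero h)
  · intro v _ hne
    by_cases hv2 : v.2 = D.N - I
    · rw [lead, if_neg fun hv => hne (hcon v hv hv2)]; simp
    · simp [hv2]
  · intro h'; exact absurd (D.mem_Theta.mp hw).1 h'

variable (D) in
/-- The truncation of a coefficient `a_I(x)` to the exponents in `T`. -/
def leadPoly (T : Set (ℕ × ℕ)) : Polynomial ℂ :=
  ∑ w ∈ D.supp, Polynomial.C (D.lead T w) * Polynomial.X ^ w.1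

lemma leadPoly_eval (T : Set (ℕ × ℕ)) (z : ℂ) :
    (D.leadPoly T).eval z = D.polySum (D.lead T) z 1 := by
  simp [leadPoly, polySum, Polynomial.eval_finsetSum]

lemma polySum_lead {k : ℕ} (hT : ∀ w ∈ T, w.2 = k) (x y : ℂ) :
    D.polySum (D.lead T) x y = (D.leadPoly T).eval x * y ^ k := by
  rw [leadPoly_eval, polySum, polySum, Finset.sum_mul]
  refine Finset.sum_congr rfl fun w _ => ?_
  by_cases hw : w ∈ T
  · rw [hT w hw]; ring
  · simp [lead, hw]

lemma leadPoly_ne_zero (h : D.EdgeSupp Q₀ Q₁ T) {k : ℕ} (hT : ∀ w ∈ T, w.2 = k) :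
    D.leadPoly T ≠ 0 := by
  obtain ⟨w, hw⟩ := h.nontrivial.nonempty
  intro h0
  have h1 := congrArg (fun p => Polynomial.coeff p w.1) h0
  simp only [leadPoly, Polynomial.finsetSum_coeff, Polynomial.coeff_C_mul, Polynomial.coeff_X_pow,
    Polynomial.coeff_zero] at h1
  rw [Finset.sum_eq_single w] at h1
  · rw [if_pos rfl, mul_one, lead, if_pos hw, HahnSeries.leadingCoeff_eq_zero] at h1
    exact D.mem_supp.mp (h.subset_supp hw) h1
  · intro v _ hne
    by_cases hv : v ∈ T
    · rw [if_neg, mul_zero]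
      intro h2
      exact hne (Prod.ext h2.symm ((hT v hv).trans (hT w hw).symm))
    · simp [lead, hv]
  · intro h'; exact absurd (h.subset_supp hw) h'

lemma trunc_eq (P : ℝ × ℝ) {k : ℕ} (hP : ∀ w ∈ D.Theta P, w.2 = k) :
    D.trunc P = Polynomial.C (D.leadPoly (D.Theta P)) * Polynomial.X ^ k := by
  classical
  rw [trunc, leadPoly, map_sum, Finset.sum_mul, D.sum_supp]
  refine Finset.sum_congr rfl fun i _ => Finset.sum_congr rfl fun l _ => ?_
  by_cases h : (l, i) ∈ D.Theta P
  · rw [if_pos h, lead, if_pos h, ← hP _ h, Polynomial.C_mul_X_pow_eq_monomial,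
      Polynomial.C_mul_X_pow_eq_monomial]
  · rw [if_neg h, lead, if_neg h]; simp

lemma leadPoly_eval_eq_zero (h : D.EdgeSupp Q₀ Q₁ T) (hI : I ≤ D.N) (hT : ∀ w ∈ T, w.2 = D.N - I)
    (h0 : Q₀.1 = D.B I j₀) (h1 : Q₁.1 = D.B I j₀) :
    (D.leadPoly T).eval (D.u I j₀).leadingCoeff = 0 := by
  have hP : (pt Q₀ Q₁ (1 / 2)).1 = D.B I j₀ := by simp only [pt, h0, h1]; ring
  have := lead_eval_eq_zero hI hP
  rw [h.Theta_half] at this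
  rw [leadPoly_eval, ← this]
  refine D.polySum_congr (fun w _ => ?_) _ _
  by_cases hw : w ∈ T
  · rw [if_pos (hT w hw), one_mul]
  · simp [lead, hw]

/-- The root of the truncation is simple. -/
lemma exists_leadPoly_eq (h : D.EdgeSupp Q₀ Q₁ T) (htns : D.TotallyNonSingular) (hI : I ≤ D.N)
    (hT : ∀ w ∈ T, w.2 = D.N - I) (h0 : Q₀.1 = D.B I j₀) (h1 : Q₁.1 = D.B I j₀) :
    ∃ q : Polynomial ℂ,
      D.leadPoly T = (Polynomial.X - Polynomial.C (D.u I j₀).leadingCoeff) * q ∧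
        q.eval (D.u I j₀).leadingCoeff ≠ 0 := by
  have hr := leadPoly_eval_eq_zero h hI hT h0 h1
  set a := (D.u I j₀).leadingCoeff with ha
  have ha0 : a ≠ 0 := (D.u_unit I hI j₀).leadingCoeff_ne
  obtain ⟨q, hq⟩ := Polynomial.dvd_iff_isRoot.mpr hr
  refine ⟨q, hq, fun hqa => ?_⟩
  have hs := smooth_lead htns (h.mem_tropCurve (openSegment_subset_segment ℝ _ _
    (pt_mem_openSegment Q₀ Q₁ (s := 1 / 2) (by norm_num))))
  rw [h.Theta_half] at hs
  have hfun : D.polySum (D.lead T) = fun x y => (D.leadPoly T).eval x * y ^ (D.N - I) := by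
    funext x y; exact polySum_lead hT x y
  rw [hfun] at hs
  -- The truncation is `leadPoly` times y^{N-I}, so a double root ū would make (ū, 1) a singular
  -- point in the torus.
  rcases hs a 1 ha0 one_ne_zero (by simp only [hr, zero_mul]) with h2 | h2
  · simp only [one_pow, mul_one] at h2
    refine h2 ?_
    rw [Polynomial.deriv, hq]
    simp [hqa]
  · simp [hr] at h2

/-- Membership of an irreducible factor other than `x - ū`: along its cylinder, `x` stays away
from `ū`. -/
lemma eventually_far_of_component (h : D.EdgeSupp Q₀ Q₁ T) (htns : D.TotallyNonSingular)
    (hI : I ≤ D.N) (hT : ∀ w ∈ T, w.2 = D.N - I) (h0 : Q₀.1 = D.B I j₀) (h1 : Q₁.1 = D.B I j₀)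
    {g : Polynomial (Polynomial ℂ)} (hg : D.IsComponent Q₀ Q₁ g)
    (hne : ¬ Associated g (D.compE I j₀)) {z ζ : ℝ → ℂ} {M : ℝ}
    (hz : ∀ᶠ ε in 𝓝[>] (0 : ℝ), ‖z ε‖ ≤ M ∧ ‖ζ ε‖ ≤ M)
    (hlim : Tendsto (fun ε => g.evalEval (Complex.exp (z ε)) (Complex.exp (ζ ε))) (𝓝[>] 0) (𝓝 0)) :
    ∃ ρ > 0, ∀ᶠ ε in 𝓝[>] (0 : ℝ), ρ ≤ ‖Complex.exp (z ε) - (D.u I j₀).leadingCoeff‖ := by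
  obtain ⟨q, hq, hqa⟩ := exists_leadPoly_eq h htns hI hT h0 h1
  set a := (D.u I j₀).leadingCoeff with ha
  have hdvd := hg.2 _ (pt_mem_openSegment Q₀ Q₁ (s := 1 / 2) (by norm_num))
  have hprime : Prime g := hg.1.prime
  rw [trunc_eq (k := D.N - I) _ (by rw [h.Theta_half]; exact hT), h.Theta_half, hq,
    Polynomial.C_mul] at hdvd
  have hmul : ∀ p : Polynomial (Polynomial ℂ), g ∣ p →
      Tendsto (fun ε => p.evalEval (Complex.exp (z ε)) (Complex.exp (ζ ε))) (𝓝[>] 0) (𝓝 0) := by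
    rintro _ ⟨s, rfl⟩
    obtain ⟨C, hC⟩ := exists_norm_evalEval_le s M
    simp only [Polynomial.evalEval_mul]
    refine hlim.zero_mul_isBoundedUnder_le ⟨C, ?_⟩
    rw [eventually_map]
    filter_upwards [hz] with ε hε
    exact hC _ _ hε.1 hε.2
  -- The prime g divides (x - ū) q(x) y^{N-I}. The first factor is excluded by hypothesis, the
  -- second forces q(x) → 0 although q(ū) ≠ 0, and the third would force y → 0, which is impossible
  -- for bounded logarithms.
  rcases hprime.dvd_or_dvd hdvd with hd | hd
  · rcases hprime.dvd_or_dvd hd with hd | hd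
    · refine absurd (hg.1.associated_of_dvd ?_ hd) hne
      exact (Polynomial.prime_C_iff.mpr (Polynomial.prime_X_sub_C a)).irreducible
    · have hl := hmul _ hd
      simp only [Polynomial.evalEval_C] at hl
      have hc : ∀ᶠ y in 𝓝 a, ‖q.eval a‖ / 2 < ‖q.eval y‖ :=
        q.continuous.norm.continuousAt.eventually_const_lt (half_lt_self (norm_pos_iff.mpr hqa))
      obtain ⟨ρ, hρ, hball⟩ := Metric.eventually_nhds_iff.mp hc
      refine ⟨ρ, hρ, ?_⟩
      have hl' : ∀ᶠ ε in 𝓝[>] (0 : ℝ), ‖q.eval (Complex.exp (z ε))‖ < ‖q.eval a‖ / 2 :=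
        hl.norm.eventually_lt_const (by
          rw [norm_zero]; exact half_pos (norm_pos_iff.mpr hqa))
      filter_upwards [hl'] with ε hε
      by_contra hlt
      have := hball (y := Complex.exp (z ε)) (by rw [dist_eq_norm]; exact not_le.mp hlt)
      exact absurd (this.trans hε) (lt_irrefl _)
  · have hl := hmul _ (hprime.dvd_of_dvd_pow hd)
    simp only [Polynomial.evalEval_X] at hl
    refine ⟨1, one_pos, ?_⟩
    have hl' := hl.norm.eventually_lt_const (u := Real.exp (-M)) (by
      rw [norm_zero]; exact Real.exp_pos _)
    filter_upwards [hl', hz] with ε e1 e2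
    exact absurd e1 (not_lt.mpr (exp_neg_le_norm_exp e2.2))

/-- Near `ū`, the other roots of `a_I` are at a distance comparable to `|x|`. -/
lemma exists_other_roots_far (hI : I ≤ D.N) (hc : D.c I ≠ 0) (hgen : D.Generic)
    (j₀ : Fin (D.d I)) : ∃ R > 0, ∃ ρ > 0, ∀ᶠ ε in 𝓝[>] (0 : ℝ), ∀ z : ℂ,
      ‖z - (D.u I j₀).leadingCoeff‖ < ρ → ∀ j ≠ j₀,
        ‖z * (ePow ε (D.B I j₀) : ℂ)‖ ≤ R * ‖z * (ePow ε (D.B I j₀) : ℂ) - D.rootAt ε I j‖ := by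
  set a := (D.u I j₀).leadingCoeff with ha
  have ha0 : a ≠ 0 := (D.u_unit I hI j₀).leadingCoeff_ne
  -- Divided by 𝐞^{min(B, B')}, both x and x - r_j converge jointly in (ε, z), the latter to a
  -- non-zero number. For B = B' this is where the leading coefficients must be distinct.
  have key : ∀ j, ∃ R > 0, ∀ᶠ p in 𝓝[>] (0 : ℝ) ×ˢ 𝓝 a, j ≠ j₀ →
      ‖p.2 * (ePow p.1 (D.B I j₀) : ℂ)‖ ≤
        R * ‖p.2 * (ePow p.1 (D.B I j₀) : ℂ) - D.rootAt p.1 I j‖ := by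
    intro j
    by_cases hj : j = j₀
    · exact ⟨1, one_pos, Eventually.of_forall fun _ h => absurd hj h⟩
    set B : ℝ := ((D.B I j₀ : ℚ) : ℝ) with hBdef
    set B' : ℝ := ((D.B I j : ℚ) : ℝ) with hBdef'
    have hN : Tendsto (fun p : ℝ × ℂ => p.2 * (ePow p.1 (B - min B B') : ℂ))
        (𝓝[>] (0 : ℝ) ×ˢ 𝓝 a) (𝓝 (a * (if B - min B B' = 0 then 1 else 0))) :=
      tendsto_snd.mul ((tendsto_ePow_of_nonneg (sub_nonneg.mpr (min_le_left B B'))).comp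
        tendsto_fst)
    have hu : Tendsto (fun p : ℝ × ℂ => seriesVal p.1 (D.u I j) * (ePow p.1 (B' - min B B') : ℂ))
        (𝓝[>] (0 : ℝ) ×ˢ 𝓝 a)
        (𝓝 ((D.u I j).leadingCoeff * (if B' - min B B' = 0 then 1 else 0))) :=
      ((D.u_unit I hI j).tendsto.comp tendsto_fst).mul
        ((tendsto_ePow_of_nonneg (sub_nonneg.mpr (min_le_right B B'))).comp tendsto_fst)
    have hne : a * (if B - min B B' = 0 then 1 else 0) -
        (D.u I j).leadingCoeff * (if B' - min B B' = 0 then 1 else 0) ≠ 0 := by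
      rcases lt_trichotomy B B' with h | h | h
      · rw [min_eq_left h.le, if_pos (sub_self _), if_neg (sub_pos.mpr h).ne']
        simpa using ha0
      · rw [← h, min_self, if_pos (sub_self _)]
        have hBB : D.B I j = D.B I j₀ := by
          have : (D.B I j₀ : ℝ) = D.B I j := h
          exact_mod_cast this.symm
        have := hgen ⟨I, j⟩ ⟨I, j₀⟩ hI hI hc hc (by simpa using hj) hBB
        simpa [sub_eq_zero] using this.symm
      · rw [min_eq_right h.le, if_pos (sub_self _), if_neg (sub_pos.mpr h).ne']
        simpa using (D.u_unit I hI j).leadingCoeff_ne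
    set n := a * (if B - min B B' = 0 then 1 else 0)
    have hL := norm_pos_iff.mpr hne
    set L := ‖n - (D.u I j).leadingCoeff * (if B' - min B B' = 0 then 1 else 0)‖
    refine ⟨(‖n‖ + 1) * (2 / L), by positivity, ?_⟩
    filter_upwards [hN.norm.eventually_lt_const (lt_add_one _),
      (hN.sub hu).norm.eventually_const_lt (half_lt_self hL)] with p h1 h2 _
    have hm := ePow_ne_zero p.1 (min B B')
    have e1 : p.2 * (ePow p.1 B : ℂ) =
        (ePow p.1 (min B B') : ℂ) * (p.2 * (ePow p.1 (B - min B B') : ℂ)) := by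
      rw [ePow_sub]; push_cast; field_simp
    have e2 : p.2 * (ePow p.1 B : ℂ) - D.rootAt p.1 I j =
        (ePow p.1 (min B B') : ℂ) * (p.2 * (ePow p.1 (B - min B B') : ℂ) -
          seriesVal p.1 (D.u I j) * (ePow p.1 (B' - min B B') : ℂ)) := by
      rw [rootAt, ← hBdef', ePow_sub, ePow_sub]; push_cast; field_simp
    rw [e2, e1, norm_mul, norm_mul (ePow p.1 (min B B') : ℂ) (_ - _), norm_ePow]
    have e3 : 1 ≤ 2 / L * ‖p.2 * (ePow p.1 (B - min B B') : ℂ) -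
        seriesVal p.1 (D.u I j) * (ePow p.1 (B' - min B B') : ℂ)‖ := by
      rw [div_mul_eq_mul_div, le_div_iff₀ hL]; linarith
    have h1' : ‖p.2 * (ePow p.1 (B - min B B') : ℂ)‖ ≤ (‖n‖ + 1) * (2 / L *
        ‖p.2 * (ePow p.1 (B - min B B') : ℂ) -
          seriesVal p.1 (D.u I j) * (ePow p.1 (B' - min B B') : ℂ)‖) :=
      h1.le.trans (le_mul_of_one_le_right (by positivity) e3)
    refine (mul_le_mul_of_nonneg_left h1' (ePow_pos p.1 (min B B')).le).trans (le_of_eq ?_)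
    ring
  choose R hR hev using key
  obtain ⟨R', hR', hle⟩ := exists_le_finset Finset.univ R
  obtain ⟨pa, hpa, pb, hpb, hp⟩ := Filter.eventually_prod_iff.mp (Filter.eventually_all.mpr hev)
  obtain ⟨ρ, hρ, hball⟩ := Metric.eventually_nhds_iff.mp hpb
  refine ⟨R', hR', ρ, hρ, ?_⟩
  filter_upwards [hpa] with ε hε z hz j hj
  have := hp hε (hball (by rw [dist_eq_norm]; exact hz)) j hj
  exact this.trans (mul_le_mul_of_nonneg_right (hle j (Finset.mem_univ j)) (norm_nonneg _))

/-- Where `x` is not close to the other roots of `a_I`, the numerator of `ω_E` is proportional to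
`x f_x` along a vertical edge, up to a small error. -/
lemma numApprox_of_near (h : D.EdgeSupp Q₀ Q₁ T) (hI : I ≤ D.N) (hT : ∀ w ∈ T, w.2 = D.N - I)
    (h₀ : s₀ ∈ Icc (0 : ℝ) 1) (h₁ : s₁ ∈ Icc (0 : ℝ) 1)
    (hp : D.PathNear Q₀ Q₁ s₀ s₁ M ξ η) {K R : ℝ} (hR : 0 < R)
    (hfar : ∀ᶠ ε in 𝓝[>] (0 : ℝ), ∀ t ∈ Icc (0 : ℝ) 1, K * ε ≤ edgeDist (param s₀ s₁ t) →
      ∀ j ≠ j₀, ‖Complex.exp (ξ ε t)‖ ≤ R * ‖Complex.exp (ξ ε t) - D.rootAt ε I j‖) :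
    D.NumApprox I j₀ Q₀ Q₁ s₀ s₁ kap 0 ξ η K := by
  obtain ⟨C, hC, c, hc0, hev⟩ := exists_layer_le h hT h₀ h₁ hp
  obtain ⟨C', hC', c', hc0', hev'⟩ := exists_combination_le h M
    (fun w => (if w.2 = D.N - I then 0 else w.1)) (fun w hw => by simp [hT w hw]) h₀ h₁ hp
  set L : ℝ := D.m I + ∑ j ∈ Finset.univ.erase j₀, R with hLdef
  have hL : 0 ≤ L := by positivity
  refine ⟨(‖kap‖ + 1) * (L * C + C'), by positivity, min c c', lt_min hc0 hc0', ?_⟩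
  filter_upwards [hev, hev', hfar, D.eventually_aAt_eval, eventually_num_mul_sub hI j₀,
    self_mem_nhdsWithin] with ε e1 e2 e3 e4 e5 hε t ht hK
  have hε : 0 < ε := hε
  have hd := edgeDist_nonneg (param_mem h₀ h₁ ht)
  have n1 := e1 t ht
  have n2 := e2 t ht
  have n3 := e3 t ht hK
  have hE := ePow_pos ε (D.tropVal (pt Q₀ Q₁ (param s₀ s₁ t)))
  have m1 : ePow ε (c * edgeDist (param s₀ s₁ t)) ≤ ePow ε (min c c' * edgeDist (param s₀ s₁ t)) :=
    ePow_le hε (mul_le_mul_of_nonneg_right (min_le_left _ _) hd)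
  have m2 : ePow ε (c' * edgeDist (param s₀ s₁ t)) ≤
      ePow ε (min c c' * edgeDist (param s₀ s₁ t)) :=
    ePow_le hε (mul_le_mul_of_nonneg_right (min_le_right _ _) hd)
  have he := ePow_pos ε (min c c' * edgeDist (param s₀ s₁ t))
  set E := ePow ε (D.tropVal (pt Q₀ Q₁ (param s₀ s₁ t)))
  set e := ePow ε (min c c' * edgeDist (param s₀ s₁ t))
  set x := Complex.exp (ξ ε t) with hx
  set y := Complex.exp (η ε t)
  have hx0 : x ≠ 0 := Complex.exp_ne_zero _
  have hxr : ∀ j ∈ Finset.univ.erase j₀, x ≠ D.rootAt ε I j := by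
    intro j hj hh
    have := n3 j (Finset.ne_of_mem_erase hj)
    rw [← hh, sub_self, norm_zero, mul_zero] at this
    exact hx0 (norm_le_zero_iff.mp this)
  set Λ : ℂ := D.m I + ∑ j ∈ Finset.univ.erase j₀, x / (x - D.rootAt ε I j) with hΛ
  have hΛn : ‖Λ‖ ≤ L := by
    refine (norm_add_le _ _).trans (add_le_add (by simp) (norm_sum_le_of_le _ fun j hj => ?_))
    rw [norm_div, div_le_iff₀ (norm_pos_iff.mpr (sub_ne_zero.mpr (hxr j hj)))]
    exact n3 j (Finset.ne_of_mem_erase hj)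
  set ψ : Polynomial ℂ := Polynomial.C (seriesVal ε (D.c I) * (ePow ε (D.A I) : ℂ)) *
    Polynomial.X ^ D.m I * ∏ j ∈ Finset.univ.erase j₀,
      (Polynomial.X - Polynomial.C (D.rootAt ε I j)) with hψ
  have hψx : kap * ψ.eval x = D.phi ε I j₀ x := by
    rw [hψ, phi, kap]
    simp only [Polynomial.eval_mul, Polynomial.eval_C, Polynomial.eval_pow, Polynomial.eval_X,
      Polynomial.eval_prod, Polynomial.eval_sub]
    ring
  have hfact : D.aAt ε I = (Polynomial.X - Polynomial.C (D.rootAt ε I j₀)) * ψ := by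
    rw [aAt, factored, ← Finset.mul_prod_erase Finset.univ _ (Finset.mem_univ j₀), hψ]
    ring
  have hlog := mul_eval_derivative_factored (seriesVal ε (D.c I) * (ePow ε (D.A I) : ℂ)) (D.m I)
    (Finset.univ.erase j₀) (D.rootAt ε I) x hxr
  rw [← hψ] at hlog
  have hψx' : seriesVal ε (D.c I) * (ePow ε (D.A I) : ℂ) * x ^ D.m I *
      ∏ j ∈ Finset.univ.erase j₀, (x - D.rootAt ε I j) = ψ.eval x := by
    simp [hψ, Polynomial.eval_prod]
  rw [hψx'] at hlog
  -- The product rule for a_I = (x - r)ψ. The term x ψ is the numerator up to κ y^{N-I}; the other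
  -- is a_I times the logarithmic derivative Λ of ψ, bounded because the other roots are far away.
  have hder : x * ((D.aAt ε I).derivative.eval x) = x * ψ.eval x +
      (D.aAt ε I).eval x * Λ := by
    rw [hfact]
    simp only [Polynomial.derivative_mul, Polynomial.derivative_sub, Polynomial.derivative_X,
      Polynomial.derivative_C, sub_zero, one_mul, Polynomial.eval_add, Polynomial.eval_mul,
      Polynomial.eval_sub, Polynomial.eval_X, Polynomial.eval_C]
    linear_combination (x - D.rootAt ε I j₀) * hlog
  have hlay : D.polySum (fun w => w.1 * (if w.2 = D.N - I then D.b ε w else 0)) x y =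
      x * ((D.aAt ε I).derivative.eval x) * y ^ (D.N - I) := by
    rw [← mul_deriv_fst]
    have : (fun s => D.polySum (fun w => if w.2 = D.N - I then D.b ε w else 0) s y) =
        fun s => (D.aAt ε I).eval s * y ^ (D.N - I) := by
      funext s; exact (e4 I hI s y).symm
    rw [this, deriv_mul_const (D.aAt ε I).differentiableAt, Polynomial.deriv]
    ring
  have hsplit : D.polySum (fun w => w.1 * D.b ε w) x y =
      D.polySum (fun w => w.1 * (if w.2 = D.N - I then D.b ε w else 0)) x y +
      D.polySum (fun w => (if w.2 = D.N - I then 0 else (w.1 : ℂ)) * D.b ε w) x y := by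
    simp only [polySum, ← Finset.sum_add_distrib]
    refine Finset.sum_congr rfl fun w _ => ?_
    split_ifs <;> ring
  have hlayer : D.layer ε I x y = (D.aAt ε I).eval x * y ^ (D.N - I) := (e4 I hI x y).symm
  have hfin : D.num ε I j₀ x y - kap * D.polySum (fun w => w.1 * D.b ε w) x y -
      0 * D.polySum (fun w => w.2 * D.b ε w) x y = -kap * (Λ * D.layer ε I x y +
        D.polySum (fun w => (if w.2 = D.N - I then 0 else (w.1 : ℂ)) * D.b ε w) x y) := by
    rw [hsplit, hlay, hder, hlayer, num, ← hψx]
    ring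
  rw [hfin, norm_mul, norm_neg]
  have k1 : ‖Λ * D.layer ε I x y‖ ≤ L * (C * (E * e)) := by
    rw [norm_mul]
    exact mul_le_mul hΛn (n1.trans (by gcongr)) (norm_nonneg _) hL
  have k2 : ‖D.polySum (fun w => (if w.2 = D.N - I then 0 else (w.1 : ℂ)) * D.b ε w) x y‖ ≤
      C' * (E * e) := n2.trans (by gcongr)
  calc _ ≤ (‖kap‖ + 1) * (L * (C * (E * e)) + C' * (E * e)) :=
        mul_le_mul (by linarith) ((norm_add_le _ _).trans (add_le_add k1 k2)) (norm_nonneg _)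
          (by positivity)
    _ = _ := by ring

end CurveData

end TropInt

end

/-! ### Staying on one cylinder, and the integral over each kind of edge -/

noncomputable section

namespace TropInt

namespace CurveData

variable {D : CurveData} {Q₀ Q₁ : ℝ × ℝ} {T : Set (ℕ × ℕ)} {I : ℕ} {j₀ : Fin (D.d I)}
  {s₀ s₁ : ℝ} {ξ η : ℝ → ℝ → ℂ} {M : ℝ}

/-- The good times form an interval, as `edgeDist` is concave and `param` affine. This is what lets
the intermediate value theorem exclude a change of cylinder. -/
lemma convex_edgeDist_param (s₀ s₁ K : ℝ) :
    Convex ℝ {t : ℝ | t ∈ Icc (0 : ℝ) 1 ∧ K ≤ edgeDist (param s₀ s₁ t)} := by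
  refine (convex_Icc 0 1).inter ?_
  intro x hx y hy p q hp hq hpq
  have e : param s₀ s₁ (p • x + q • y) = p * param s₀ s₁ x + q * param s₀ s₁ y := by
    simp only [param, smul_eq_mul]
    linear_combination (-s₀) * hpq
  obtain ⟨x1, x2⟩ := le_min_iff.mp
    (show K ≤ min (param s₀ s₁ x) (1 - param s₀ s₁ x) from hx)
  obtain ⟨y1, y2⟩ := le_min_iff.mp
    (show K ≤ min (param s₀ s₁ y) (1 - param s₀ s₁ y) from hy)
  have k1 := mul_le_mul_of_nonneg_left x1 hp
  have k2 := mul_le_mul_of_nonneg_left x2 hp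
  have k3 := mul_le_mul_of_nonneg_left y1 hq
  have k4 := mul_le_mul_of_nonneg_left y2 hq
  have k5 : K = p * K + q * K := by rw [← add_mul, hpq, one_mul]
  show K ≤ edgeDist _
  rw [e]
  refine le_min ?_ ?_ <;> linarith

lemma lt_iff_lt_of_ne {S : Set ℝ} (hS : Convex ℝ S) {f : ℝ → ℝ} (hf : Continuous f) {ρ : ℝ}
    (hne : ∀ t ∈ S, f t ≠ ρ) {a b : ℝ} (ha : a ∈ S) (hb : b ∈ S) (hlt : f a < ρ) : f b < ρ := by
  by_contra hle
  obtain ⟨t, ht, hte⟩ := hS.isPreconnected.intermediate_value ha hb hf.continuousOn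
    ⟨hlt.le, not_lt.mp hle⟩
  exact hne t ht hte

/-- Inside a vertical edge over `B`, a path does not cross a small circle around `ū`. -/
lemma exists_circle (h : D.EdgeSupp Q₀ Q₁ T) (hT : ∀ w ∈ T, w.2 = D.N - I)
    (hp : D.PathNear Q₀ Q₁ s₀ s₁ M ξ η) (h₀ : s₀ ∈ Icc (0 : ℝ) 1) (h₁ : s₁ ∈ Icc (0 : ℝ) 1)
    (h2 : 0 < s₀ + s₁) (h3 : s₀ + s₁ < 2) (hv : Q₀.1 = Q₁.1) (a : ℂ) {ρ₀ : ℝ} (hρ₀ : 0 < ρ₀) :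
    ∃ ρ > 0, ρ < ρ₀ ∧ ∃ K : ℝ, ∀ᶠ ε in 𝓝[>] (0 : ℝ), ∀ t ∈ Icc (0 : ℝ) 1,
      K * ε ≤ edgeDist (param s₀ s₁ t) →
        (‖Complex.exp (ξ ε (1 / 2) + ((Q₀.1 / ε : ℝ) : ℂ)) - a‖ < ρ →
          ‖Complex.exp (ξ ε t + ((Q₀.1 / ε : ℝ) : ℂ)) - a‖ < ρ) ∧
        (ρ ≤ ‖Complex.exp (ξ ε (1 / 2) + ((Q₀.1 / ε : ℝ) : ℂ)) - a‖ →
          ρ ≤ ‖Complex.exp (ξ ε t + ((Q₀.1 / ε : ℝ) : ℂ)) - a‖) := by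
  have hX : ∀ s, (pt Q₀ Q₁ s).1 = Q₀.1 := fun s => by simp only [pt, ← hv]; ring
  have hfin : ((D.leadPoly T).rootSet ℂ \ {a}).Finite := ((D.leadPoly T).rootSet_finite ℂ).sdiff
  -- The radius is chosen so that the circle around a meets no root of `leadPoly`, whose modulus
  -- therefore has a positive minimum m on it.
  obtain ⟨r, hr, hball⟩ := Metric.isOpen_iff.mp hfin.isClosed.isOpen_compl a (by simp)
  obtain ⟨ρ, hρ, hρlt⟩ := exists_between (lt_min hr hρ₀)
  have hne : ∀ z : ℂ, ‖z - a‖ = ρ → (D.leadPoly T).eval z ≠ 0 := by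
    intro z hz h0
    have hzr : z ∈ Metric.ball a r := by
      rw [Metric.mem_ball, dist_eq_norm, hz]
      exact hρlt.trans_le (min_le_left _ _)
    refine hball hzr ⟨?_, ?_⟩
    · rw [Polynomial.mem_rootSet]
      exact ⟨leadPoly_ne_zero h hT, by simpa using h0⟩
    · rintro rfl
      rw [sub_self, norm_zero] at hz
      exact hρ.ne hz
  obtain ⟨z₀, hz₀, hmin⟩ := (isCompact_sphere a ρ).exists_isMinOn
    (NormedSpace.sphere_nonempty.mpr hρ.le) (D.leadPoly T).continuous.norm.continuousOn
  have hm : 0 < ‖(D.leadPoly T).eval z₀‖ :=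
    norm_pos_iff.mpr (hne z₀ (by rw [← dist_eq_norm]; exact hz₀))
  set m := ‖(D.leadPoly T).eval z₀‖
  have hA := D.monBound_pos M
  obtain ⟨c, hc0, hg⟩ := h.exists_gap
  -- This tolerance makes the rescaled f differ from `leadPoly`(x) y^{N-I} by at most half the
  -- minimum of the latter on the circle with |y| ≥ e^{-M}, so f cannot vanish there.
  obtain ⟨K, hK0, hev⟩ := EdgeSupp.nb_close hc0 hg
    (δ := m / 2 * Real.exp (-M) ^ (D.N - I) / D.monBound M) (by positivity)
  -- The conditions 0 < s₀ + s₁ < 2 place the middle of the path inside the edge, also for a path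
  -- from end to end. The reference time 1/2 is thus a good one.
  have hmid : 0 < edgeDist (param s₀ s₁ (1 / 2)) := by
    refine lt_min ?_ ?_ <;> unfold param <;> linarith
  have hKs : ∀ᶠ ε in 𝓝[>] (0 : ℝ), K * ε ≤ edgeDist (param s₀ s₁ (1 / 2)) := by
    have h1 : Tendsto (fun ε : ℝ => K * ε) (𝓝[>] 0) (𝓝 (K * 0)) :=
      (tendsto_id.const_mul K).mono_left nhdsWithin_le_nhds
    rw [mul_zero] at h1
    exact (h1.eventually_lt_const hmid).mono fun _ h => h.le
  refine ⟨ρ, hρ, hρlt.trans_le (min_le_right _ _), K, ?_⟩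
  filter_upwards [hev, hp, hKs] with ε e1 e2 e3 t ht hKt
  have hcross : ∀ t ∈ {t : ℝ | t ∈ Icc (0 : ℝ) 1 ∧ K * ε ≤ edgeDist (param s₀ s₁ t)},
      ‖Complex.exp (ξ ε t + ((Q₀.1 / ε : ℝ) : ℂ)) - a‖ ≠ ρ := by
    rintro t ⟨ht, hKt⟩ heq
    obtain ⟨f0, hn, -⟩ := e2.2.2 t ht
    have hpar := param_mem h₀ h₁ ht
    have hcl := e1 _ hpar hKt
    have hsc := D.polySum_scale_exp (fun _ => 1) ε (pt Q₀ Q₁ (param s₀ s₁ t)) (ξ ε t) (η ε t)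
    simp only [one_mul] at hsc
    rw [f0] at hsc
    have hsc0 := (mul_eq_zero.mp hsc.symm).resolve_left (ePow_ne_zero _ _)
    have hsub := D.polySum_sub (D.nb ε (pt Q₀ Q₁ (param s₀ s₁ t))) (D.lead T)
      (Complex.exp (ξ ε t + (((pt Q₀ Q₁ (param s₀ s₁ t)).1 / ε : ℝ) : ℂ)))
      (Complex.exp (η ε t + (((pt Q₀ Q₁ (param s₀ s₁ t)).2 / ε : ℝ) : ℂ)))
    have hle := D.norm_polySum_le hcl (norm_exp_le hn.1) (norm_exp_le hn.2)
    rw [← hsub, hsc0, zero_sub, norm_neg, polySum_lead hT, hX, norm_mul, norm_pow] at hle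
    have hge : m ≤ ‖(D.leadPoly T).eval (Complex.exp (ξ ε t + ((Q₀.1 / ε : ℝ) : ℂ)))‖ :=
      hmin (by rw [Metric.mem_sphere, dist_eq_norm]; exact heq)
    have hy := pow_le_pow_left₀ (Real.exp_pos (-M)).le (exp_neg_le_norm_exp hn.2) (D.N - I)
    have hpw : 0 < Real.exp (-M) ^ (D.N - I) := by positivity
    have h5 := mul_le_mul hge hy hpw.le (norm_nonneg _)
    have h6 : m / 2 * Real.exp (-M) ^ (D.N - I) / D.monBound M * D.monBound M =
        m / 2 * Real.exp (-M) ^ (D.N - I) := div_mul_cancel₀ _ hA.ne'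
    rw [h6] at hle
    have h7 := h5.trans hle
    nlinarith [mul_pos hm hpw]
  have hcont : Continuous fun t => ‖Complex.exp (ξ ε t + ((Q₀.1 / ε : ℝ) : ℂ)) - a‖ := by
    have := e2.1.continuous
    fun_prop
  have hconv := convex_edgeDist_param s₀ s₁ (K * ε)
  refine ⟨fun hlt => lt_iff_lt_of_ne hconv hcont hcross ⟨by norm_num, e3⟩ ⟨ht, hKt⟩ hlt,
    fun hle => ?_⟩
  by_contra hlt
  exact absurd (lt_iff_lt_of_ne hconv hcont hcross ⟨ht, hKt⟩ ⟨by norm_num, e3⟩ (not_le.mp hlt))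
    (not_lt.mpr hle)

lemma RunsAlong.tendsto_half {g : Polynomial (Polynomial ℂ)}
    (hr : D.RunsAlong g (pt Q₀ Q₁ s₀) (pt Q₀ Q₁ s₁) ξ η) :
    Tendsto (fun ε : ℝ => g.evalEval
      (Complex.exp (ξ ε (1 / 2) + (((pt Q₀ Q₁ (param s₀ s₁ (1 / 2))).1 / ε : ℝ) : ℂ)))
      (Complex.exp (η ε (1 / 2) + (((pt Q₀ Q₁ (param s₀ s₁ (1 / 2))).2 / ε : ℝ) : ℂ))))
      (𝓝[>] 0) (𝓝 0) := by
  have := hr.2 (1 / 2) (by norm_num)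
  rw [param, ← pt_pt]
  exact this

/-- The numerator along the cylinder of `x - ū`. -/
lemma numApprox_compE (h : D.EdgeSupp Q₀ Q₁ T) (hI : I ≤ D.N) (hc : D.c I ≠ 0) (hgen : D.Generic)
    (hT : ∀ w ∈ T, w.2 = D.N - I) (hB : Q₀.1 = D.B I j₀) (hv : Q₀.1 = Q₁.1)
    (h₀ : s₀ ∈ Icc (0 : ℝ) 1) (h₁ : s₁ ∈ Icc (0 : ℝ) 1) (h2 : 0 < s₀ + s₁) (h3 : s₀ + s₁ < 2)
    (hp : D.PathNear Q₀ Q₁ s₀ s₁ M ξ η)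
    (hr : D.RunsAlong (D.compE I j₀) (pt Q₀ Q₁ s₀) (pt Q₀ Q₁ s₁) ξ η) :
    ∃ K, D.NumApprox I j₀ Q₀ Q₁ s₀ s₁ kap 0 ξ η K := by
  have hX : ∀ s, (pt Q₀ Q₁ s).1 = Q₀.1 := fun s => by simp only [pt, ← hv]; ring
  obtain ⟨R, hR, ρ₀, hρ₀, hroots⟩ := exists_other_roots_far hI hc hgen j₀
  obtain ⟨ρ, hρ, hρlt, K, hK⟩ := exists_circle h hT hp h₀ h₁ h2 h3 hv
    (D.u I j₀).leadingCoeff hρ₀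
  refine ⟨K, numApprox_of_near h hI hT h₀ h₁ hp hR ?_⟩
  have hlim := hr.tendsto_half
  simp only [hX, compE, Polynomial.evalEval_C, Polynomial.eval_sub, Polynomial.eval_X,
    Polynomial.eval_C] at hlim
  have hnear := hlim.norm.eventually_lt_const (u := ρ) (by rwa [norm_zero])
  filter_upwards [hroots, hK, hnear] with ε e1 e2 e3 t ht hKt j hj
  have := e1 _ (((e2 t ht hKt).1 e3).trans hρlt) j hj
  rwa [← hB, ← exp_eq_mul_ePow] at this

/-- The numerator along the other cylinders over the same edge. -/
lemma numApprox_ne_compE (h : D.EdgeSupp Q₀ Q₁ T) (htns : D.TotallyNonSingular) (hI : I ≤ D.N)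
    (hT : ∀ w ∈ T, w.2 = D.N - I) (hB : Q₀.1 = D.B I j₀) (hv : Q₀.1 = Q₁.1)
    {g : Polynomial (Polynomial ℂ)} (hg : D.IsComponent Q₀ Q₁ g)
    (hne : ¬ Associated g (D.compE I j₀))
    (h₀ : s₀ ∈ Icc (0 : ℝ) 1) (h₁ : s₁ ∈ Icc (0 : ℝ) 1) (h2 : 0 < s₀ + s₁) (h3 : s₀ + s₁ < 2)
    (hp : D.PathNear Q₀ Q₁ s₀ s₁ M ξ η)
    (hr : D.RunsAlong g (pt Q₀ Q₁ s₀) (pt Q₀ Q₁ s₁) ξ η) :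
    ∃ K, D.NumApprox I j₀ Q₀ Q₁ s₀ s₁ 0 0 ξ η K := by
  have hX : ∀ s, (pt Q₀ Q₁ s).1 = Q₀.1 := fun s => by simp only [pt, ← hv]; ring
  obtain ⟨ρ₀, hρ₀, hfar⟩ := eventually_far_of_component h htns hI hT hB (hv ▸ hB) hg hne
    (hp.mono fun ε e => (e.2.2 (1 / 2) (by norm_num)).2.1) hr.tendsto_half
  simp only [hX] at hfar
  obtain ⟨ρ, hρ, hρlt, K, hK⟩ := exists_circle h hT hp h₀ h₁ h2 h3 hv
    (D.u I j₀).leadingCoeff hρ₀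
  -- The circle is centred at ū and the actual rescaled root is u(ε); for small ε they differ by
  -- less than ρ/2, leaving distance ρ/2 from the root.
  have hu := (tendsto_iff_norm_sub_tendsto_zero.mp
    (D.u_unit I hI j₀).tendsto).eventually_lt_const (half_pos hρ)
  refine ⟨K, numApprox_of_far h hI hT h₀ h₁ hp (R := Real.exp M * (2 / ρ)) (by positivity) ?_⟩
  filter_upwards [hfar, hK, hu, hp] with ε e1 e2 e3 e4 t ht hKt
  have h4 := (e2 t ht hKt).2 (hρlt.le.trans e1)
  have hn := (e4.2.2 t ht).2.1.1
  rw [hX] at hn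
  have hz := norm_exp_le hn
  rw [exp_eq_mul_ePow (ξ ε t) ε Q₀.1]
  set z := Complex.exp (ξ ε t + ((Q₀.1 / ε : ℝ) : ℂ))
  have h5 : ρ / 2 ≤ ‖z - seriesVal ε (D.u I j₀)‖ := by
    have := norm_sub_le_norm_sub_add_norm_sub z (seriesVal ε (D.u I j₀)) (D.u I j₀).leadingCoeff
    linarith
  have e5 : z * (ePow ε Q₀.1 : ℂ) - D.rootAt ε I j₀ =
      (z - seriesVal ε (D.u I j₀)) * (ePow ε Q₀.1 : ℂ) := by rw [rootAt, hB]; ring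
  rw [e5, norm_mul, norm_mul, ← mul_assoc]
  refine mul_le_mul_of_nonneg_right ?_ (norm_nonneg _)
  have h6 : 1 ≤ 2 / ρ * ‖z - seriesVal ε (D.u I j₀)‖ := by
    rw [div_mul_eq_mul_div, le_div_iff₀ hρ]; linarith
  rw [mul_assoc]
  exact hz.trans (le_mul_of_one_le_right (Real.exp_pos _).le h6)

/-! ### The integrals over the edges -/

lemma IntegralAsymp.congr {g : Polynomial (Polynomial ℂ)} {m m' : ℝ × ℝ → ℝ × ℝ → ℝ → ℂ}
    (h : D.IntegralAsymp I j₀ Q₀ Q₁ g m)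
    (hm : ∀ P₀ ∈ segment ℝ Q₀ Q₁, ∀ P₁ ∈ segment ℝ Q₀ Q₁, ∀ ε, m P₀ P₁ ε = m' P₀ P₁ ε) :
    D.IntegralAsymp I j₀ Q₀ Q₁ g m' := by
  have hsub := openSegment_subset_segment ℝ Q₀ Q₁
  constructor
  · intro P₀ hP₀ P₁ hP₁ ξ η hr hs
    simpa only [hm P₀ (hsub hP₀) P₁ (hsub hP₁)] using h.1 P₀ hP₀ P₁ hP₁ ξ η hr hs
  · intro ξ η hr
    simpa only [hm Q₀ (left_mem_segment ℝ Q₀ Q₁) Q₁ (right_mem_segment ℝ Q₀ Q₁)] using h.2 ξ η hr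

lemma integralAsymp_zero (h : D.EdgeSupp Q₀ Q₁ T) (htns : D.TotallyNonSingular)
    (hIN : I + 1 ≤ D.N) (hc : D.c I ≠ 0) {g : Polynomial (Polynomial ℂ)}
    (hK : ∀ s₀ ∈ Icc (0 : ℝ) 1, ∀ s₁ ∈ Icc (0 : ℝ) 1, 0 < s₀ + s₁ → s₀ + s₁ < 2 →
      ∀ (M : ℝ) (ξ η : ℝ → ℝ → ℂ), D.PathNear Q₀ Q₁ s₀ s₁ M ξ η →
        D.RunsAlong g (pt Q₀ Q₁ s₀) (pt Q₀ Q₁ s₁) ξ η →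
          ∃ K, D.NumApprox I j₀ Q₀ Q₁ s₀ s₁ 0 0 ξ η K) :
    D.IntegralAsymp I j₀ Q₀ Q₁ g (fun _ _ _ => 0) :=
  (integralAsymp_of_numApprox h htns hIN hc hK).congr fun _ _ _ _ _ => by simp

lemma integralAsymp_inactive (h : D.EdgeSupp Q₀ Q₁ T) (htns : D.TotallyNonSingular)
    (hIN : I + 1 ≤ D.N) (hc : D.c I ≠ 0) (hT : ∀ w ∈ T, w.2 ≠ D.N - I)
    (g : Polynomial (Polynomial ℂ)) : D.IntegralAsymp I j₀ Q₀ Q₁ g (fun _ _ _ => 0) :=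
  integralAsymp_zero h htns hIN hc fun _ h₀ _ h₁ _ _ _ _ _ hp _ =>
    ⟨0, numApprox_inactive h (by omega) hc hT h₀ h₁ hp⟩

/-- A non-vertical edge on which `a_I(x) y^{N-I}` is minimal does not pass over `B`. -/
lemma le_or_le_of_active {w v : ℕ × ℕ} (h : D.EdgeSupp Q₀ Q₁ {w, v}) (hI : I ≤ D.N)
    (hw : w.2 = D.N - I) (hv : v.2 ≠ w.2) (hQ : Q₀.1 < Q₁.1) (j₀ : Fin (D.d I)) :
    Q₁.1 ≤ D.B I j₀ ∨ (D.B I j₀ : ℝ) ≤ Q₀.1 := by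
  by_contra hcon
  push Not at hcon
  obtain ⟨h1, h2⟩ := hcon
  have hL := sub_pos.mpr hQ
  set s : ℝ := (D.B I j₀ - Q₀.1) / (Q₁.1 - Q₀.1) with hs
  have hs0 : s ∈ Ioo (0 : ℝ) 1 :=
    ⟨div_pos (sub_pos.mpr h2) hL, (div_lt_one hL).mpr (by linarith)⟩
  have hP : (pt Q₀ Q₁ s).1 = D.B I j₀ := by
    have : s * (Q₁.1 - Q₀.1) = D.B I j₀ - Q₀.1 := div_mul_cancel₀ _ hL.ne'
    simp only [pt]
    linarith
  have hTh := h.Theta_eq (pt_mem_openSegment Q₀ Q₁ hs0)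
  -- Above B a second minimal exponent with power N - I would be needed, but the only other exponent
  -- v has a different power.
  obtain ⟨u, hu, hu2, hne⟩ := exists_ne_of_mem_Theta hI hP (w := w) (by rw [hTh]; simp) hw
  rw [hTh] at hu
  rcases hu with rfl | rfl
  · exact hne rfl
  · exact hv (hu2.trans hw.symm)

/-- Both signs of the main term are covered at once, carried by w₂ - v₂. As the edge lies on one
side of B, min(B, ·) is either the abscissa or constant along it. -/
lemma integralAsymp_active {w v : ℕ × ℕ} (h : D.EdgeSupp Q₀ Q₁ {w, v})
    (htns : D.TotallyNonSingular) (hIN : I + 1 ≤ D.N) (hc : D.c I ≠ 0) (hw : w.2 = D.N - I)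
    (hv : v.2 ≠ w.2) (hQ : Q₀.1 < Q₁.1) (g : Polynomial (Polynomial ℂ)) :
    D.IntegralAsymp I j₀ Q₀ Q₁ g (fun P₀ P₁ ε => -(kap * ((w.2 : ℂ) - v.2)⁻¹) *
      ((((min (D.B I j₀ : ℝ) P₁.1 - min (D.B I j₀ : ℝ) P₀.1) / ε : ℝ)) : ℂ)) := by
  have hI : I ≤ D.N := by omega
  have hbd : ∀ P ∈ segment ℝ Q₀ Q₁, Q₀.1 ≤ P.1 ∧ P.1 ≤ Q₁.1 := by
    rw [segment_eq_pt]
    rintro _ ⟨s, ⟨hs0, hs1⟩, rfl⟩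
    constructor <;> simp only [pt] <;> nlinarith
  rcases le_or_le_of_active h hI hw hv hQ j₀ with hB | hB
  · refine (integralAsymp_of_numApprox h htns hIN hc fun s₀ h₀ s₁ h₁ _ _ M ξ η hp _ =>
      numApprox_left h hI hw hv hQ hB h₀ h₁ hp).congr fun P₀ hP₀ P₁ hP₁ ε => ?_
    rw [min_eq_right ((hbd P₀ hP₀).2.trans hB), min_eq_right ((hbd P₁ hP₁).2.trans hB)]
    ring
  · refine (integralAsymp_zero h htns hIN hc fun s₀ h₀ s₁ h₁ _ _ M ξ η hp _ =>
      numApprox_right h hI hw hv hQ hB h₀ h₁ hp).congr fun P₀ hP₀ P₁ hP₁ ε => ?_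
    rw [min_eq_left (hB.trans (hbd P₀ hP₀).1), min_eq_left (hB.trans (hbd P₁ hP₁).1)]
    simp

end CurveData

end TropInt

end

/-! ### The main theorem: sorting the edges by their powers of y -/

open TropInt CurveData in
theorem mainTheorem6 (D : TropInt.CurveData)
    (hns : D.NonSingular) (htns : D.TotallyNonSingular) (hgen : D.Generic) (hreg : D.Regular)
    (I : ℕ) (hI : 1 ≤ I) (hIN : I + 1 ≤ D.N) (j₀ : Fin (D.d I))
    (B Y₀ Y₁ : ℝ) (hB : B = D.B I j₀) (hY₀ : Y₀ = D.NN I B) (hY₁ : Y₁ = D.NN (I + 1) B)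
    (hY : Y₀ < Y₁) :
    -- the cylinder of the vertical edge `E`
    (D.IsEdge (B, Y₀) (B, Y₁) ∧ D.IsComponent (B, Y₀) (B, Y₁) (D.compE I j₀) ∧
      D.IntegralAsymp I j₀ (B, Y₀) (B, Y₁) (D.compE I j₀)
        (fun P₀ P₁ ε => -(2 * Real.pi * Complex.I * ε)⁻¹ * ((P₁.2 - P₀.2 : ℝ) : ℂ))) ∧
    -- all other cylinders of vertical edges
    (∀ (Q₀ Q₁ : ℝ × ℝ) (g : Polynomial (Polynomial ℂ)),
      D.IsEdge Q₀ Q₁ → D.IsComponent Q₀ Q₁ g → Q₀.1 = Q₁.1 →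
      ¬ (segment ℝ Q₀ Q₁ = segment ℝ (B, Y₀) (B, Y₁) ∧ Associated g (D.compE I j₀)) →
      D.IntegralAsymp I j₀ Q₀ Q₁ g (fun _ _ _ => 0)) ∧
    -- non-vertical edges in `G_I`
    (∀ (Q₀ Q₁ : ℝ × ℝ) (g : Polynomial (Polynomial ℂ)),
      D.IsEdge Q₀ Q₁ → D.IsComponent Q₀ Q₁ g → Q₀.1 < Q₁.1 →
      segment ℝ Q₀ Q₁ ⊆ D.G I → ¬ segment ℝ Q₀ Q₁ ⊆ D.G (I + 1) →
      D.IntegralAsymp I j₀ Q₀ Q₁ g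
        (fun P₀ P₁ ε => -(2 * (D.vThickness Q₀ Q₁ : ℂ) * Real.pi * Complex.I * ε)⁻¹ *
          ((min B P₁.1 - min B P₀.1 : ℝ) : ℂ))) ∧
    -- non-vertical edges in `G_{I+1}`
    (∀ (Q₀ Q₁ : ℝ × ℝ) (g : Polynomial (Polynomial ℂ)),
      D.IsEdge Q₀ Q₁ → D.IsComponent Q₀ Q₁ g → Q₀.1 < Q₁.1 →
      segment ℝ Q₀ Q₁ ⊆ D.G (I + 1) → ¬ segment ℝ Q₀ Q₁ ⊆ D.G I →
      D.IntegralAsymp I j₀ Q₀ Q₁ g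
        (fun P₀ P₁ ε => (2 * (D.vThickness Q₀ Q₁ : ℂ) * Real.pi * Complex.I * ε)⁻¹ *
          ((min B P₁.1 - min B P₀.1 : ℝ) : ℂ))) ∧
    -- non-vertical edges in some other `G_J`, and in neither `G_I` nor `G_{I+1}`
    (∀ (J : ℕ) (Q₀ Q₁ : ℝ × ℝ) (g : Polynomial (Polynomial ℂ)),
      1 ≤ J → J ≤ D.N → D.IsEdge Q₀ Q₁ → D.IsComponent Q₀ Q₁ g → Q₀.1 ≠ Q₁.1 →
      segment ℝ Q₀ Q₁ ⊆ D.G J →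
      ¬ segment ℝ Q₀ Q₁ ⊆ D.G I → ¬ segment ℝ Q₀ Q₁ ⊆ D.G (I + 1) →
      D.IntegralAsymp I j₀ Q₀ Q₁ g (fun _ _ _ => 0)) ∧
    -- edges in `G_I ∩ G_{I+1}`
    (∀ (Q₀ Q₁ : ℝ × ℝ) (g : Polynomial (Polynomial ℂ)),
      D.IsEdge Q₀ Q₁ → D.IsComponent Q₀ Q₁ g →
      segment ℝ Q₀ Q₁ ⊆ D.G I ∩ D.G (I + 1) →
      D.IntegralAsymp I j₀ Q₀ Q₁ g (fun _ _ _ => 0)) := by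
  have hI' : I ≤ D.N := by omega
  subst hB hY₀ hY₁
  obtain ⟨Y, hYl, hYr⟩ := exists_between hY
  have hY2 : ∀ w ∈ D.Theta ((D.B I j₀ : ℝ), Y), w.2 = D.N - I := fun w hw =>
    snd_eq_of_between hI hIN hYl hYr hw
  obtain ⟨w₀, hw₀⟩ := D.Theta_nonempty ((D.B I j₀ : ℝ), Y)
  -- Intermediate coefficients may vanish, but the power N - I is minimal between the two graphs, so
  -- a_I is not zero.
  have hc : D.c I ≠ 0 := by
    intro h0
    obtain ⟨hle, hco⟩ := D.coeff_eq_a (D.mem_Theta.mp hw₀).1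
    have hIe : D.N - w₀.2 = I := by rw [hY2 w₀ hw₀]; omega
    refine hw₀.1 ?_
    rw [hco, hIe, a, factored, h0]
    simp
  obtain ⟨v₀, hv₀, -, hne₀⟩ := exists_ne_of_mem_Theta (j₀ := j₀) hI' rfl hw₀ (hY2 w₀ hw₀)
  have hE := edgeSupp_vertical hI hIN hYl hYr ⟨w₀, hw₀, v₀, hv₀, hne₀.symm⟩
  refine ⟨⟨hE.isEdge, ⟨?_, fun P hP => ?_⟩, ?_⟩, ?_, ?_, ?_, ?_, ?_⟩
  · exact (Polynomial.prime_C_iff.mpr (Polynomial.prime_X_sub_C _)).irreducible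
  · have hTh := hE.Theta_eq hP
    rw [trunc_eq (k := D.N - I) P (by rw [hTh]; exact hY2), hTh, compE]
    exact Dvd.dvd.mul_right (map_dvd Polynomial.C (Polynomial.dvd_iff_isRoot.mpr
      (leadPoly_eval_eq_zero hE hI' hY2 rfl rfl))) _
  · refine (integralAsymp_of_numApprox hE htns hIN hc fun s₀ h₀ s₁ h₁ h2 h3 M ξ η hp hr =>
      numApprox_compE hE hI' hc hgen hY2 rfl rfl h₀ h₁ h2 h3 hp hr).congr
      fun P₀ _ P₁ _ ε => ?_
    rw [kap]
    push_cast
    simp only [mul_inv]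
    ring
  · intro Q₀ Q₁ g hQ hg hv hne
    obtain ⟨T, hT⟩ := hQ.exists_edgeSupp
    obtain ⟨w, hw⟩ := hT.nontrivial.nonempty
    by_cases hw2 : w.2 = D.N - I
    · have hT2 : ∀ u ∈ T, u.2 = D.N - I := fun u hu =>
        (hT.snd_eq_of_vertical hv hu hw).trans hw2
      by_cases hB : Q₀.1 = D.B I j₀
      · have hseg := hT.segment_eq hE hv rfl hB hT2 hY2
        have hna : ¬ Associated g (D.compE I j₀) := fun ha => hne ⟨hseg, ha⟩
        exact integralAsymp_zero hT htns hIN hc fun s₀ h₀ s₁ h₁ h2 h3 M ξ η hp hr =>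
          numApprox_ne_compE hT htns hI' hT2 hB hv hg hna h₀ h₁ h2 h3 hp hr
      · exact integralAsymp_zero hT htns hIN hc fun s₀ h₀ s₁ h₁ _ _ M ξ η hp _ =>
          ⟨0, numApprox_vertical_ne hT hI' hT2 hv hB h₀ h₁ hp⟩
    · exact integralAsymp_inactive hT htns hIN hc (fun u hu hu2 =>
        hw2 ((hT.snd_eq_of_vertical hv hw hu).trans hu2)) g
  · intro Q₀ Q₁ g hQ _ hlt hG hG'
    obtain ⟨T, hT⟩ := hQ.exists_edgeSupp
    obtain ⟨w, v, hvw, rfl⟩ := hT.exists_pair hreg hlt.ne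
    rw [hT.subset_G_iff hvw hI hI'] at hG
    rw [hT.subset_G_iff hvw (by omega) hIN] at hG'
    -- The edge separates the layers I - 1 and I but not I and I + 1, so its lower power is N - I.
    -- The difference of the powers in `integralAsymp_active` is then -q, which gives the negative
    -- sign.
    have hv2 : v.2 = D.N - I := by omega
    rw [Set.pair_comm] at hT
    refine (integralAsymp_active hT htns hIN hc hv2 hvw.ne' hlt g).congr fun P₀ _ P₁ _ ε => ?_
    rw [Set.pair_comm] at hT
    rw [hT.vThickness_eq hvw, kap, Nat.cast_sub hvw.le, ← neg_sub (w.2 : ℂ) v.2, inv_neg]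
    push_cast
    simp only [mul_inv]
    ring
  · intro Q₀ Q₁ g hQ _ hlt hG hG'
    obtain ⟨T, hT⟩ := hQ.exists_edgeSupp
    obtain ⟨w, v, hvw, rfl⟩ := hT.exists_pair hreg hlt.ne
    rw [hT.subset_G_iff hvw (by omega) hIN] at hG
    rw [hT.subset_G_iff hvw hI hI'] at hG'
    -- Here the upper power is N - I and the difference is +q.
    have hw2 : w.2 = D.N - I := by omega
    refine (integralAsymp_active hT htns hIN hc hw2 hvw.ne hlt g).congr fun P₀ _ P₁ _ ε => ?_
    rw [hT.vThickness_eq hvw, kap, Nat.cast_sub hvw.le]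
    push_cast
    simp only [mul_inv]
    ring
  · intro J Q₀ Q₁ g _ _ hQ _ hne _ hG hG'
    obtain ⟨T, hT⟩ := hQ.exists_edgeSupp
    obtain ⟨w, v, hvw, rfl⟩ := hT.exists_pair hreg hne
    rw [hT.subset_G_iff hvw hI hI'] at hG
    rw [hT.subset_G_iff hvw (by omega) hIN] at hG'
    refine integralAsymp_inactive hT htns hIN hc (fun u hu => ?_) g
    -- A lower power N - I would put the edge in G_I, an upper power N - I in G_{I+1}.
    rcases hu with rfl | rfl <;> omega
  · intro Q₀ Q₁ g hQ _ hG
    obtain ⟨T, hT⟩ := hQ.exists_edgeSupp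
    have hG1 := hG.trans inter_subset_left
    have hG2 := hG.trans inter_subset_right
    have hne : Q₀.1 ≠ Q₁.1 := fun hv => not_segment_subset_G hT.ne hv I hG1
    obtain ⟨w, v, hvw, rfl⟩ := hT.exists_pair hreg hne
    rw [hT.subset_G_iff hvw hI hI'] at hG1
    rw [hT.subset_G_iff hvw (by omega) hIN] at hG2
    refine integralAsymp_inactive hT htns hIN hc (fun u hu => ?_) g
    -- Lying in both graphs means v₂ < N - I < w₂, so a_I y^{N-I} is not minimal.
    rcases hu with rfl | rfl <;> omega
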